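/- **Games.** A mean-payoff game $G=(V,V_{\rm Max},V_{\rm Min},E,w)$ is a nonempty finite graph in which every vertex has an outgoing edge, with $V$ partitioned into the vertices of Max and of Min, and $w:V\to\mathbb Z$. The payoff of an infinite path is $\liminf_{n\to\infty}\frac1n\sum_{i=0}^n w(v_i)$. The *0-mean partition* of $G$ is the partition $(W_{\rm Max},W_{\rm Min})$ of $V$ such that Max has a positional strategy that guarantees payoff $>0$ from every vertex of $W_{\rm Max}$, and Min has a positional strategy that guarantees payoff $\le 0$ from every vertex of $W_{\rm Min}$. **Strategy improvement.** It works in the modified game, in which every Max vertex has an additional edge to a sink $s$ of weight $0$, where the play ends. For positional strategies $\sigma$ of Max and $\tau$ of Min, $\mathrm{val}^{\sigma,\tau}(v)$ is the sum of the weights on the play from $v$ if the play reaches $s$; otherwise it is $-\infty$ or $\infty$, according to whether the cycle that the play repeats has weight $\le 0$ or $>0$. Put $\mathrm{val}^\sigma(v)=\min_\tau \mathrm{val}^{\sigma,\tau}(v)$, and $\mathrm{val}^\sigma(s)=0$. An edge $(v,u)$ of the modified game with $v\in V_{\rm Max}$, $u\ne\sigma(v)$ is *profitable* in $\sigma$ if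 $\mathrm{val}^\sigma(\sigma(v))<\mathrm{val}^\sigma(u)$. A *strategy improvement run* is a sequence $\sigma_0,\dots,\sigma_k$ of Max strategies in which $\sigma_{i+1}=\sigma_i[F_i]$ arises from $\sigma_i$ by switching a nonempty set $F_i$ of edges profitable in $\sigma_i$, at most one from each vertex. A *starting strategy* is a Max strategy $\sigma_0$ with $\mathrm{val}^{\sigma_0}(v)>-\infty$ for every vertex $v$. In a preprocessing step the vertices $v$ with $\mathrm{val}^\sigma(v)=-\infty$ for every $\sigma$ are removed from the game (they belong to $W_{\rm Min}$); in the resulting games, and in their sub-games, a Max vertex may be left with only the edge to $s$. **Algorithms.** A *strategy improvement algorithm* is a program of a random access machine (unit cost per elementary command or test, integer addition, subtraction and comparison, indirect addressing; all cells outside the input have arbitrary content) that is given the game, as lists of its vertices and edges with owners and weights, and a starting strategy, and that performs a strategy improvement run from this strategy, reporting the switched edges of every iteration. Such an algorithm *solves the positive cycle problem* if, on every nonempty game in which every Min vertex has an outgoing edge, from every starting strategy, it returns the last strategy $\rho$ of its run, where either $\mathrm{val}^\rho(v)=\infty$ for some $v$, or no Max strategy has valuation $\infty$ at any vertex. It *finds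 the 0-mean partition* if, on every mean-payoff game $G$, with every starting strategy for the preprocessed game, it performs a strategy improvement run on the preprocessed game and returns the 0-mean partition of $G$. **Proposition.** Let $\kappa$ be a real-valued function of the game with $|V|+|E|=O(\kappa(G))$ and $\kappa(H)\le\kappa(G)$ for every induced sub-game $H$ of $G$ (both $G$ and $H$ nonempty games in which every Min vertex has an outgoing edge). Suppose that some strategy improvement algorithm solves the positive cycle problem in $O(\kappa)$ time. Then there is a strategy improvement algorithm that finds the 0-mean partition in $O(|V|\cdot\kappa)$ time, including the preprocessing. -/

import Mathlib

open Filter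

namespace StratImp

/-! ## Mean-payoff games -/

/-- The data of a game played on a finite graph: the vertices are natural numbers, divided between
the players Max and Min, and carry integer weights (the values of `weight` off the vertex set are
irrelevant). -/
structure Arena where
  maxV : Finset ℕ
  minV : Finset ℕ
  disj : Disjoint maxV minV
  edges : Finset (ℕ × ℕ)
  edges_mem : ∀ e ∈ edges, e.1 ∈ maxV ∪ minV ∧ e.2 ∈ maxV ∪ minV
  weight : ℕ → ℤ

namespace Arena

/-- The vertex set. -/
def verts (G : Arena) : Finset ℕ := G.maxV ∪ G.minV

/-- A mean-payoff game: a nonempty arena in which every vertex has an outgoing edge. -/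
def IsMeanPayoffGame (G : Arena) : Prop :=
  G.verts.Nonempty ∧ ∀ v ∈ G.verts, ∃ u, (v, u) ∈ G.edges

/-- The sub-game `G ↾ U`: all vertices outside `U` are removed. -/
def restrict (G : Arena) (U : Finset ℕ) : Arena where
  maxV := G.maxV ∩ U
  minV := G.minV ∩ U
  disj := Finset.disjoint_of_subset_left Finset.inter_subset_left
    (Finset.disjoint_of_subset_right Finset.inter_subset_left G.disj)
  edges := G.edges.filter fun e => e.1 ∈ U ∧ e.2 ∈ U
  edges_mem := by
    intro e he
    have h := G.edges_mem e (Finset.mem_filter.1 he).1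
    have h' := (Finset.mem_filter.1 he).2
    simp only [Finset.mem_union, Finset.mem_inter] at h ⊢
    tauto
  weight := G.weight

/-! ### The mean-payoff game itself, and its 0-mean partition -/

/-- Positional Max strategies of the mean-payoff game (values off `maxV` are irrelevant). -/
def IsGameMaxStrategy (G : Arena) (σ : ℕ → ℕ) : Prop := ∀ v ∈ G.maxV, (v, σ v) ∈ G.edges

/-- Positional Min strategies (values off `minV` are irrelevant). -/
def IsMinStrategy (G : Arena) (τ : ℕ → ℕ) : Prop := ∀ v ∈ G.minV, (v, τ v) ∈ G.edges

/-- The `i`-th vertex of the play from `v` induced by `σ` and `τ` in the mean-payoff game. -/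
def gamePlay (G : Arena) (σ τ : ℕ → ℕ) (v : ℕ) (i : ℕ) : ℕ :=
  (fun x => if x ∈ G.maxV then σ x else τ x)^[i] v

/-- The payoff `liminf (1/n) ∑_{i=0}^{n} w(v_i)` of an infinite path. -/
noncomputable def payoff (G : Arena) (π : ℕ → ℕ) : ℝ :=
  liminf (fun n : ℕ => (1 / (n : ℝ)) * ∑ i ∈ Finset.range (n + 1), (G.weight (π i) : ℝ)) atTop

/-- `σ` is a winning strategy for Max on `W`. -/
def MaxWinning (G : Arena) (σ : ℕ → ℕ) (W : Finset ℕ) : Prop :=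
  G.IsGameMaxStrategy σ ∧
    ∀ τ, G.IsMinStrategy τ → ∀ v ∈ W, 0 < G.payoff (G.gamePlay σ τ v)

/-- `τ` is a winning strategy for Min on `W`. -/
def MinWinning (G : Arena) (τ : ℕ → ℕ) (W : Finset ℕ) : Prop :=
  G.IsMinStrategy τ ∧
    ∀ σ, G.IsGameMaxStrategy σ → ∀ v ∈ W, G.payoff (G.gamePlay σ τ v) ≤ 0

/-- `(WMax, WMin)` is the 0-mean partition of `G`. -/
def IsZeroMeanPartition (G : Arena) (WMax WMin : Finset ℕ) : Prop :=
  WMax ∪ WMin = G.verts ∧ Disjoint WMax WMin ∧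
    (∃ σ, G.MaxWinning σ WMax) ∧ (∃ τ, G.MinWinning τ WMin)

/-! ### The modified game

Every Max vertex gets an additional retreat edge to a sink of weight 0. Vertices of the modified
game are elements of `Option ℕ`, with `none` as the sink. -/

/-- The modified game is playable: there is a vertex, and Min can always move. (Max can always move
to the sink. After vertices have been removed in preprocessing, this may be the only move of a Max
vertex.) -/
def IsPlayable (G : Arena) : Prop :=
  G.verts.Nonempty ∧ ∀ v ∈ G.minV, ∃ u, (v, u) ∈ G.edges

/-- The edges that leave the Max vertices in the modified game. -/
def MaxEdge (G : Arena) (v : ℕ) (u : Option ℕ) : Prop :=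
  v ∈ G.maxV ∧ (u = none ∨ ∃ x, u = some x ∧ (v, x) ∈ G.edges)

/-- Positional Max strategies of the modified game (values off `maxV` are irrelevant). -/
def IsMaxStrategy (G : Arena) (σ : ℕ → Option ℕ) : Prop := ∀ v ∈ G.maxV, G.MaxEdge v (σ v)

/-- One move in the modified game; a play that has reached the sink is over, and stays there. -/
def move (G : Arena) (σ : ℕ → Option ℕ) (τ : ℕ → ℕ) : Option ℕ → Option ℕ
  | none => none
  | some v => if v ∈ G.maxV then σ v else some (τ v)

/-- Position after `i` moves of the play from `x` in the modified game. -/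
def play (G : Arena) (σ : ℕ → Option ℕ) (τ : ℕ → ℕ) (x : Option ℕ) (i : ℕ) : Option ℕ :=
  (G.move σ τ)^[i] x

/-- The weight function of the modified game. -/
def weight' (G : Arena) : Option ℕ → ℤ
  | none => 0
  | some v => G.weight v

open Classical in
/-- The valuation `val^{σ,τ}`: the total weight before the sink if the play reaches the sink, and
otherwise `-∞` or `∞`, according to whether the weight of the cycle that the play repeats is
nonpositive or positive. (Moves depend on the position only, so a position that recurs after `p > 0`
moves closes the cycle; going round it several times does not change the sign.) -/
noncomputable def valuation (G : Arena) (σ : ℕ → Option ℕ) (τ : ℕ → ℕ) (x : Option ℕ) : EReal :=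
  if h : ∃ k, G.play σ τ x k = none then
    (((∑ i ∈ Finset.range (Nat.find h), G.weight' (G.play σ τ x i) : ℤ) : ℝ) : EReal)
  else if ∃ k p, 0 < p ∧ G.play σ τ x (k + p) = G.play σ τ x k ∧
      ∑ i ∈ Finset.Ico k (k + p), G.weight' (G.play σ τ x i) ≤ 0 then ⊥
  else ⊤

/-- `τ` is a best response of Min to `σ`. -/
def IsBestResponse (G : Arena) (σ : ℕ → Option ℕ) (τ : ℕ → ℕ) : Prop :=
  G.IsMinStrategy τ ∧ ∀ τ', G.IsMinStrategy τ' →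
    ∀ x, (x = none ∨ ∃ v ∈ G.verts, x = some v) → G.valuation σ τ x ≤ G.valuation σ τ' x

/-- The valuation `val^σ`: the least valuation that Min can achieve against `σ`, i.e. the valuation
against a best response (see `val_eq_of_isBestResponse`). -/
noncomputable def val (G : Arena) (σ : ℕ → Option ℕ) (x : Option ℕ) : EReal :=
  ⨅ τ : {τ : ℕ → ℕ // G.IsMinStrategy τ}, G.valuation σ τ.1 x

theorem val_eq_of_isBestResponse (G : Arena) (σ : ℕ → Option ℕ) (τ : ℕ → ℕ)
    (h : G.IsBestResponse σ τ) (x : Option ℕ) (hx : x = none ∨ ∃ v ∈ G.verts, x = some v) :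
    G.val σ x = G.valuation σ τ x :=
  le_antisymm (iInf_le (fun τ : {τ : ℕ → ℕ // G.IsMinStrategy τ} => G.valuation σ τ.1 x) ⟨τ, h.1⟩)
    (le_iInf fun τ' => h.2 τ'.1 τ'.2 x hx)

/-! ### Strategy improvement -/

/-- A starting strategy for strategy improvement: a Max strategy with all valuations above `-∞`. -/
def IsStart (G : Arena) (σ : ℕ → Option ℕ) : Prop :=
  G.IsMaxStrategy σ ∧ ∀ v ∈ G.verts, ⊥ < G.val σ (some v)

/-- The vertices on which no Max strategy achieves a valuation above `-∞`, because Min can enforce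
a nonpositive cycle without passing through a Max vertex. -/
def Hopeless (G : Arena) (v : ℕ) : Prop :=
  ∀ σ, G.IsMaxStrategy σ → G.val σ (some v) = ⊥

open Classical in
/-- The result of the preprocessing: the hopeless vertices are removed. -/
noncomputable def core (G : Arena) : Arena := G.restrict (G.verts.filter fun v => ¬ G.Hopeless v)

/-- The edge `(v, u)` of the modified game is profitable in `σ`. -/
def Profitable (G : Arena) (σ : ℕ → Option ℕ) (v : ℕ) (u : Option ℕ) : Prop :=
  G.MaxEdge v u ∧ u ≠ σ v ∧ G.val σ (σ v) < G.val σ u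

/-- The strategy `σ[F]`. -/
def switchEdges (σ : ℕ → Option ℕ) (F : List (ℕ × Option ℕ)) (v : ℕ) : Option ℕ :=
  (F.lookup v).getD (σ v)

end Arena

/-! ## Random access machines

Programs of a structured random access machine, whose memory consists of arrays of integers. They
report the switched edges of a strategy improvement run: `switch` reports an edge that is switched
in the current iteration, `commit` ends the iteration. -/

/-- A memory: `m a i` is the content of cell `i` of array `a`. -/
abbrev Memory := ℕ → ℤ → ℤ

inductive Expr where
  | const (z : ℤ)
  | read (a : ℕ) (i : Expr)
  | add (e f : Expr)
  | sub (e f : Expr)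

def Expr.eval (m : Memory) : Expr → ℤ
  | .const z => z
  | .read a i => m a (i.eval m)
  | .add e f => e.eval m + f.eval m
  | .sub e f => e.eval m - f.eval m

inductive Cmd where
  | skip
  /-- `a[i] := e` -/
  | assign (a : ℕ) (i e : Expr)
  /-- report that the edge `(v, u)` is switched -/
  | switch (v u : Expr)
  /-- report the end of an iteration -/
  | commit
  | seq (c d : Cmd)
  /-- `if e ≤ f then c else d` -/
  | ite (e f : Expr) (c d : Cmd)
  /-- `while e ≤ f do c` -/
  | loop (e f : Expr) (c : Cmd)

inductive Event where
  | switch (v u : ℤ)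
  | commit

def Memory.set (m : Memory) (a : ℕ) (i z : ℤ) : Memory :=
  Function.update m a (Function.update (m a) i z)

/-- `Exec c m r t m'`: started in the memory `m`, the program `c` halts after `t` steps in the
memory `m'`, and has reported the events `r`. Every elementary command and every test is one step
(expressions have a size that is fixed by the program). -/
inductive Exec : Cmd → Memory → List Event → ℕ → Memory → Prop where
  | skip (m : Memory) : Exec .skip m [] 1 m
  | assign (m : Memory) (a : ℕ) (i e : Expr) :
      Exec (.assign a i e) m [] 1 (m.set a (i.eval m) (e.eval m))
  | switch (m : Memory) (v u : Expr) :
      Exec (.switch v u) m [Event.switch (v.eval m) (u.eval m)] 1 m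
  | commit (m : Memory) : Exec .commit m [Event.commit] 1 m
  | seq {c d : Cmd} {m₁ m₂ m₃ : Memory} {r s : List Event} {t u : ℕ}
      (hc : Exec c m₁ r t m₂) (hd : Exec d m₂ s u m₃) :
      Exec (.seq c d) m₁ (r ++ s) (t + u) m₃
  | ite_true {e f : Expr} {c d : Cmd} {m m' : Memory} {r : List Event} {t : ℕ}
      (h : e.eval m ≤ f.eval m) (hc : Exec c m r t m') : Exec (.ite e f c d) m r (t + 1) m'
  | ite_false {e f : Expr} {c d : Cmd} {m m' : Memory} {r : List Event} {t : ℕ}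
      (h : ¬ e.eval m ≤ f.eval m) (hd : Exec d m r t m') : Exec (.ite e f c d) m r (t + 1) m'
  | loop_done {e f : Expr} {c : Cmd} {m : Memory}
      (h : ¬ e.eval m ≤ f.eval m) : Exec (.loop e f c) m [] 1 m
  | loop_step {e f : Expr} {c : Cmd} {m₁ m₂ m₃ : Memory} {r s : List Event} {t u : ℕ}
      (h : e.eval m₁ ≤ f.eval m₁) (hc : Exec c m₁ r t m₂) (hl : Exec (.loop e f c) m₂ s u m₃) :
      Exec (.loop e f c) m₁ (r ++ s) (t + u + 1) m₃

/-! ## Inputs, outputs and strategy improvement algorithms -/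

/-- Code of a vertex of the modified game; the sink is `-1`. -/
def code : Option ℕ → ℤ
  | none => -1
  | some v => v

/-- Array 6 stores the Max strategy `σ`. -/
def StoresStrategy (m : Memory) (G : Arena) (σ : ℕ → Option ℕ) : Prop :=
  ∀ v ∈ G.maxV, m 6 v = code (σ v)

/-- The memory holds the game `G` and the Max strategy `σ`: array 0 holds `|V|` and `|E|`, array 1 a
list of the vertices, array 2 the owner of each vertex, array 3 the weights, arrays 4 and 5 a list
of the edges, array 6 the strategy. All other cells may have any content. -/
def Encodes (m : Memory) (G : Arena) (σ : ℕ → Option ℕ) : Prop :=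
  m 0 0 = G.verts.card ∧ m 0 1 = G.edges.card ∧
  (∃ vs : List ℕ, vs.Nodup ∧ vs.toFinset = G.verts ∧
    ∀ (i : ℕ) (h : i < vs.length), m 1 i = vs[i]) ∧
  (∀ v ∈ G.maxV, m 2 v = 1) ∧ (∀ v ∈ G.minV, m 2 v = 0) ∧
  (∀ v ∈ G.verts, m 3 v = G.weight v) ∧
  (∃ es : List (ℕ × ℕ), es.Nodup ∧ es.toFinset = G.edges ∧
    ∀ (i : ℕ) (h : i < es.length), m 4 i = es[i].1 ∧ m 5 i = es[i].2) ∧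
  StoresStrategy m G σ

/-- The reported events `r` are those of a strategy improvement run on `G` from `σ` to `ρ`: in every
iteration a nonempty set `F` of profitable edges of the current strategy is switched, which contains
at most one edge from each vertex. -/
inductive ImprovementRun (G : Arena) :
    (ℕ → Option ℕ) → List Event → (ℕ → Option ℕ) → Prop where
  | nil (σ : ℕ → Option ℕ) : ImprovementRun G σ [] σ
  | iteration {σ ρ : ℕ → Option ℕ} {r : List Event} (F : List (ℕ × Option ℕ))
      (hne : F ≠ []) (hprof : ∀ e ∈ F, G.Profitable σ e.1 e.2)
      (hone : (F.map Prod.fst).Nodup)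
      (hrest : ImprovementRun G (Arena.switchEdges σ F) r ρ) :
      ImprovementRun G σ (F.map (fun e => Event.switch e.1 (code e.2)) ++ Event.commit :: r) ρ

/-- `p` is a strategy improvement algorithm that solves the positive cycle problem in time `T`: from
every starting strategy it halts within `T G` steps, performing a strategy improvement run and
storing the last strategy `ρ` of this run, such that some vertex has valuation `∞` under `ρ` unless
no vertex has valuation `∞` under any strategy. -/
def SolvesPositiveCycle (p : Cmd) (T : Arena → ℝ) : Prop :=
  ∀ (G : Arena) (σ : ℕ → Option ℕ) (m : Memory),
    G.IsPlayable → G.IsStart σ → Encodes m G σ →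
    ∃ (r : List Event) (t : ℕ) (m' : Memory) (ρ : ℕ → Option ℕ),
      Exec p m r t m' ∧ (t : ℝ) ≤ T G ∧
      ImprovementRun G σ r ρ ∧ StoresStrategy m' G ρ ∧
      ((∃ v ∈ G.verts, G.val ρ (some v) = ⊤) ∨
        ∀ χ, G.IsMaxStrategy χ → ∀ v ∈ G.verts, G.val χ (some v) < ⊤)

/-- `q` is a strategy improvement algorithm that finds the 0-mean partition in time `T`: on every
mean-payoff game `G`, with any starting strategy for the preprocessed game, it halts within `T G`
steps, performing a strategy improvement run on the preprocessed game, and marks the vertices of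
the two sides of the 0-mean partition of `G` by 1 and 0 in array 7. -/
def FindsZeroMeanPartition (q : Cmd) (T : Arena → ℝ) : Prop :=
  ∀ (G : Arena) (σ : ℕ → Option ℕ) (m : Memory),
    G.IsMeanPayoffGame → G.core.IsStart σ → Encodes m G σ →
    ∃ (r : List Event) (t : ℕ) (m' : Memory) (ρ : ℕ → Option ℕ) (WMax WMin : Finset ℕ),
      Exec q m r t m' ∧ (t : ℝ) ≤ T G ∧
      ImprovementRun G.core σ r ρ ∧
      (∀ v ∈ WMax, m' 7 v = 1) ∧ (∀ v ∈ WMin, m' 7 v = 0) ∧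
      G.IsZeroMeanPartition WMax WMin

end StratImp

/-!
The proof constructs a program from the given program `α`, verifies it in a small program logic, and
rests on the following facts about strategy improvement.

*Hopeless vertices.* The preprocessing has to remove the vertices from which Min can force a
nonpositive cycle that avoids the Max vertices. With the weights `(|V| + 1) w - 1` such a cycle is
negative, so that `|V|` rounds of relaxations of the edges between Min vertices leave an edge that
can still be relaxed exactly if there is such a cycle. The hopeless vertices are those from which
Min can reach such an edge through Min vertices (`hopeless_iff`). This takes time `O(|V| (|V| +
|E|))`.

*Improvement.* Switching profitable edges never decreases the valuation and turns a starting
strategy into a starting strategy (`Improves.val_mono`, `Improves.isStart`).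

*Top vertices.* For a starting strategy `σ`, let `topSet σ` be the set of the vertices of valuation
`∞`. They are the vertices from which no play of `σ` reaches the sink
(`mem_topSet_iff_not_escapes`), so that a graph search in linear time finds them. Removing them does
not change the valuations of the others (`val_rest`), and hence a strategy improvement run on the
remaining game `rest σ` is a strategy improvement run on the whole game (`ImprovementRun.of_rest`).

*Rounds.* In every round the program determines `topSet σ`. If an edge leads from a Max vertex of
the remaining game to this set, then it is profitable, and switching it enlarges the set
(`round_switch`). Otherwise `α` is run on the remaining game. Either the set grows, or no Max
strategy has valuation `∞` at any remaining vertex (`round_rest`), in which case `σ` is `Final`. As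
the set can grow at most `|V|` times, `|V| + 1` rounds suffice. Each of them takes time `O(κ)`,
because the remaining game is an induced sub-game.

*The partition.* For a final strategy `σ`, the set `topSet σ` is the winning region of Max:
following `σ` there, every play repeats a positive cycle. On the remaining game, the valuation of an
optimal starting strategy is a potential that bounds the weights of all plays against suitable moves
of Min (`exists_potential`), and on the hopeless vertices Min repeats nonpositive cycles. See
`isZeroMeanPartition_of_final`.
-/

namespace StratImp

/-! ### Plays and valuations -/

/-- Adding a real number can be moved to the other side of an inequality of extended reals. -/
theorem ereal_le_coe_add_iff (c : ℝ) (x y : EReal) :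
    x ≤ (c : EReal) + y ↔ ((-c : ℝ) : EReal) + x ≤ y := by
  induction x using EReal.rec <;> induction y using EReal.rec
  case coe.coe a b =>
    rw [← EReal.coe_add, ← EReal.coe_add, EReal.coe_le_coe_iff, EReal.coe_le_coe_iff]
    constructor <;> intro h <;> linarith
  all_goals simp [← EReal.coe_add]

theorem ereal_coe_add_eq_top (c : ℝ) (x : EReal) : (c : EReal) + x = ⊤ ↔ x = ⊤ := by
  induction x using EReal.rec <;> simp [← EReal.coe_add]

theorem ereal_coe_add_eq_bot (c : ℝ) (x : EReal) : (c : EReal) + x = ⊥ ↔ x = ⊥ := by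
  induction x using EReal.rec <;> simp [← EReal.coe_add]

theorem ereal_coe_add_lt_iff (c : ℝ) (x y : EReal) :
    (c : EReal) + x < (c : EReal) + y ↔ x < y := by
  induction x using EReal.rec <;> induction y using EReal.rec <;>
    simp [← EReal.coe_add]

theorem ereal_coe_add_le_iff (c : ℝ) (x y : EReal) :
    (c : EReal) + x ≤ (c : EReal) + y ↔ x ≤ y := by
  induction x using EReal.rec <;> induction y using EReal.rec <;>
    simp [← EReal.coe_add]

namespace Arena

variable {G H : Arena} {σ σ' : ℕ → Option ℕ} {τ τ' : ℕ → ℕ}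

/-- Min can always move. -/
def MinMoves (G : Arena) : Prop := ∀ v ∈ G.minV, ∃ u, (v, u) ∈ G.edges

/-- The positions of the modified game. -/
def IsPos (G : Arena) (x : Option ℕ) : Prop := ∀ v, x = some v → v ∈ G.verts

theorem isPos_none : G.IsPos none := by simp [IsPos]

theorem isPos_some {v : ℕ} : G.IsPos (some v) ↔ v ∈ G.verts := by simp [IsPos]

theorem mem_verts {v : ℕ} : v ∈ G.verts ↔ v ∈ G.maxV ∨ v ∈ G.minV := by simp [verts]

theorem mem_verts_of_edge {v u : ℕ} (h : (v, u) ∈ G.edges) : v ∈ G.verts ∧ u ∈ G.verts :=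
  G.edges_mem _ h

theorem not_mem_minV {v : ℕ} (h : v ∈ G.maxV) : v ∉ G.minV :=
  fun h' => Finset.disjoint_left.1 G.disj h h'

theorem not_mem_maxV {v : ℕ} (h : v ∈ G.minV) : v ∉ G.maxV :=
  fun h' => Finset.disjoint_left.1 G.disj h' h

theorem move_max {v : ℕ} (h : v ∈ G.maxV) : G.move σ τ (some v) = σ v := by simp [move, h]

theorem move_min {v : ℕ} (h : v ∈ G.minV) : G.move σ τ (some v) = some (τ v) := by
  simp [move, not_mem_maxV h]

theorem MinMoves.exists_strategy (h : G.MinMoves) : ∃ τ, G.IsMinStrategy τ := by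
  choose! τ hτ using h
  exact ⟨τ, hτ⟩

theorem isPos_move (hσ : G.IsMaxStrategy σ) (hτ : G.IsMinStrategy τ) {x : Option ℕ}
    (hx : G.IsPos x) : G.IsPos (G.move σ τ x) := by
  rcases x with _ | v
  · exact isPos_none
  rcases mem_verts.1 (isPos_some.1 hx) with h | h
  · rw [move_max h]
    rcases (hσ v h).2 with h' | ⟨u, h', hu⟩
    · rw [h']; exact isPos_none
    · rw [h']; exact isPos_some.2 (mem_verts_of_edge hu).2
  · rw [move_min h]
    exact isPos_some.2 (mem_verts_of_edge (hτ v h)).2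

theorem play_zero (x : Option ℕ) : G.play σ τ x 0 = x := rfl

theorem play_succ (x : Option ℕ) (i : ℕ) :
    G.play σ τ x (i + 1) = G.play σ τ (G.move σ τ x) i := Function.iterate_succ_apply _ _ _

theorem play_succ' (x : Option ℕ) (i : ℕ) :
    G.play σ τ x (i + 1) = G.move σ τ (G.play σ τ x i) := Function.iterate_succ_apply' _ _ _

theorem play_add (x : Option ℕ) (i j : ℕ) :
    G.play σ τ x (i + j) = G.play σ τ (G.play σ τ x i) j := by
  rw [add_comm]; exact Function.iterate_add_apply _ _ _ _

theorem play_none (i : ℕ) : G.play σ τ none i = none := by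
  induction i with
  | zero => rfl
  | succ i ih => rw [play_succ]; exact ih

theorem isPos_play (hσ : G.IsMaxStrategy σ) (hτ : G.IsMinStrategy τ) {x : Option ℕ}
    (hx : G.IsPos x) (i : ℕ) : G.IsPos (G.play σ τ x i) := by
  induction i with
  | zero => exact hx
  | succ i ih => rw [play_succ']; exact isPos_move hσ hτ ih

/-- The play from `x` reaches the sink. -/
def Sinks (G : Arena) (σ : ℕ → Option ℕ) (τ : ℕ → ℕ) (x : Option ℕ) : Prop :=
  ∃ k, G.play σ τ x k = none

/-- The play from `x` repeats a cycle of nonpositive weight. -/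
def Sags (G : Arena) (σ : ℕ → Option ℕ) (τ : ℕ → ℕ) (x : Option ℕ) : Prop :=
  ∃ k p, 0 < p ∧ G.play σ τ x (k + p) = G.play σ τ x k ∧
    ∑ i ∈ Finset.Ico k (k + p), G.weight' (G.play σ τ x i) ≤ 0

open Classical in
/-- The valuation of a sequence of positions whose weights are `w`. -/
noncomputable def seqValuation (y : ℕ → Option ℕ) (w : ℕ → ℤ) : EReal :=
  if h : ∃ k, y k = none then (((∑ i ∈ Finset.range (Nat.find h), w i : ℤ) : ℝ) : EReal)
  else if ∃ k p, 0 < p ∧ y (k + p) = y k ∧ ∑ i ∈ Finset.Ico k (k + p), w i ≤ 0 then ⊥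
  else ⊤

theorem valuation_eq_seqValuation (x : Option ℕ) : G.valuation σ τ x =
    seqValuation (G.play σ τ x) (fun i => G.weight' (G.play σ τ x i)) := rfl

/-- Two games in which the positions of a play have the same successors and weights give this play
the same valuation. -/
theorem valuation_congr (S : Option ℕ → Prop) {x : Option ℕ} (hx : S x)
    (hS : ∀ y, S y → S (G.move σ τ y)) (hm : ∀ y, S y → H.move σ' τ' y = G.move σ τ y)
    (hw : ∀ y, S y → H.weight' y = G.weight' y) : H.valuation σ' τ' x = G.valuation σ τ x := by
  have h1 : ∀ i, H.play σ' τ' x i = G.play σ τ x i ∧ S (G.play σ τ x i) := by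
    intro i
    induction i with
    | zero => exact ⟨rfl, hx⟩
    | succ i ih =>
      rw [play_succ', play_succ', ih.1]
      exact ⟨hm _ ih.2, hS _ ih.2⟩
  have h2 : ∀ i, H.weight' (G.play σ τ x i) = G.weight' (G.play σ τ x i) := fun i => hw _ (h1 i).2
  have h3 : ∀ i, H.play σ' τ' x i = G.play σ τ x i := fun i => (h1 i).1
  rw [valuation_eq_seqValuation, valuation_eq_seqValuation, funext h3]
  simp only [h2]

theorem valuation_of_not_sinks (h : ¬ G.Sinks σ τ x) :
    G.valuation σ τ x = ⊥ ∧ G.Sags σ τ x ∨ G.valuation σ τ x = ⊤ ∧ ¬ G.Sags σ τ x := by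
  by_cases h' : G.Sags σ τ x
  · left; exact ⟨(dif_neg h).trans (if_pos h'), h'⟩
  · right; exact ⟨(dif_neg h).trans (if_neg h'), h'⟩

theorem valuation_of_sinks (h : G.Sinks σ τ x) : ∃ z : ℤ, G.valuation σ τ x = ((z : ℝ) : EReal) :=
  ⟨_, dif_pos h⟩

theorem valuation_eq_bot : G.valuation σ τ x = ⊥ ↔ ¬ G.Sinks σ τ x ∧ G.Sags σ τ x := by
  by_cases h : G.Sinks σ τ x
  · obtain ⟨z, hz⟩ := valuation_of_sinks h
    simp [hz, h]
  · rcases valuation_of_not_sinks h with h' | h' <;> simp [h, h'.1, h'.2]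

theorem valuation_eq_top : G.valuation σ τ x = ⊤ ↔ ¬ G.Sinks σ τ x ∧ ¬ G.Sags σ τ x := by
  by_cases h : G.Sinks σ τ x
  · obtain ⟨z, hz⟩ := valuation_of_sinks h
    simp [hz, h]
  · rcases valuation_of_not_sinks h with h' | h' <;> simp [h, h'.1, h'.2]

theorem valuation_none : G.valuation σ τ none = 0 := by
  have h : ∃ k, G.play σ τ none k = none := ⟨0, rfl⟩
  unfold valuation
  rw [dif_pos h]
  have : Nat.find h = 0 := (Nat.find_eq_zero h).2 rfl
  simp [this]

theorem sinks_some {v : ℕ} : G.Sinks σ τ (some v) ↔ G.Sinks σ τ (G.move σ τ (some v)) := by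
  constructor
  · rintro ⟨k, hk⟩
    cases k with
    | zero => simp [play_zero] at hk
    | succ k => exact ⟨k, by rwa [play_succ] at hk⟩
  · rintro ⟨k, hk⟩
    exact ⟨k + 1, by rwa [play_succ]⟩

theorem sags_move {x : Option ℕ} : G.Sags σ τ x ↔ G.Sags σ τ (G.move σ τ x) := by
  constructor
  · rintro ⟨k, p, hp, hc, hs⟩
    refine ⟨k, p, hp, ?_, ?_⟩
    · rw [← play_succ, ← play_succ, play_succ', play_succ', hc]
    · refine le_of_eq_of_le ?_ hs
      simp only [← play_succ]
      rw [Finset.sum_Ico_add' (fun i => G.weight' (G.play σ τ x i)) k (k + p) 1]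
      have h1 := Finset.sum_Ico_succ_top (show k ≤ k + p by omega)
        (fun i => G.weight' (G.play σ τ x i))
      have h2 := Finset.sum_eq_sum_Ico_succ_bot (show k < k + p + 1 by omega)
        (fun i => G.weight' (G.play σ τ x i))
      rw [hc] at h1
      omega
  · rintro ⟨k, p, hp, hc, hs⟩
    refine ⟨k + 1, p, hp, ?_, ?_⟩
    · rw [show k + 1 + p = k + p + 1 by omega, play_succ, play_succ, hc]
    · simp only [← play_succ] at hs
      rw [Finset.sum_Ico_add' (fun i => G.weight' (G.play σ τ x i)) k (k + p) 1] at hs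
      rwa [show k + 1 + p = k + p + 1 by omega]

theorem valuation_some (v : ℕ) : G.valuation σ τ (some v) =
    ((G.weight v : ℝ) : EReal) + G.valuation σ τ (G.move σ τ (some v)) := by
  by_cases h : G.Sinks σ τ (some v)
  · have h' := sinks_some.1 h
    unfold Sinks at h h'
    have h0 : (some v : Option ℕ) ≠ none := by simp
    unfold valuation
    rw [dif_pos h, dif_pos h', ← EReal.coe_add]
    have hf : Nat.find h = Nat.find h' + 1 := by
      rw [Nat.find_eq_iff]
      refine ⟨by rw [play_succ]; exact Nat.find_spec h', fun n hn => ?_⟩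
      cases n with
      | zero => exact h0
      | succ n => rw [play_succ]; exact Nat.find_min h' (by omega)
    rw [hf, Finset.sum_range_succ']
    simp only [play_succ, play_zero, weight']
    push_cast
    rw [add_comm]
  · have h' := fun hh => h (sinks_some.2 hh)
    rcases valuation_of_not_sinks h with a | a <;> rcases valuation_of_not_sinks h' with b | b
    · rw [a.1, b.1]; simp
    · exact absurd (sags_move.1 a.2) b.2
    · exact absurd (sags_move.2 b.2) a.2
    · rw [a.1, b.1]; simp

theorem valuation_play_top {x : Option ℕ} {i : ℕ} (h : G.valuation σ τ (G.play σ τ x i) = ⊤) :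
    G.valuation σ τ x = ⊤ := by
  induction i generalizing x with
  | zero => exact h
  | succ i ih =>
    rw [play_succ] at h
    rcases x with _ | v
    · exact ih h
    · rw [valuation_some, ih h]; simp

/-- A play that returns to its first vertex after `p` moves is valued by the sign of the weight of
this cycle. -/
theorem valuation_cycle_bot {v p : ℕ} (hp : 0 < p) (hc : G.play σ τ (some v) p = some v)
    (hs : ∑ i ∈ Finset.range p, G.weight' (G.play σ τ (some v) i) ≤ 0) :
    G.valuation σ τ (some v) = ⊥ := by
  rw [valuation_eq_bot]
  refine ⟨?_, 0, p, hp, by rwa [zero_add],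
    by rwa [zero_add, ← Finset.range_eq_Ico]⟩
  rintro ⟨k, hk⟩
  have h1 : ∀ n, G.play σ τ (some v) (n * p) = some v := by
    intro n
    induction n with
    | zero => simp [play_zero]
    | succ n ih => rw [Nat.succ_mul, play_add, ih, hc]
  have h2 : G.play σ τ (some v) (k + (k * p - k)) = none := by rw [play_add, hk, play_none]
  rw [show k + (k * p - k) = k * p by
    have : k ≤ k * p := Nat.le_mul_of_pos_right k hp
    omega, h1] at h2
  simp at h2

theorem weight'_some (v : ℕ) : G.weight' (some v) = G.weight v := rfl

/-- The initial part of a play splits off from the valuation. -/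
theorem valuation_split (v j : ℕ) (h : ∀ i < j, G.play σ τ (some v) i ≠ none) :
    G.valuation σ τ (some v) =
      (((∑ i ∈ Finset.range j, G.weight' (G.play σ τ (some v) i) : ℤ) : ℝ) : EReal) +
        G.valuation σ τ (G.play σ τ (some v) j) := by
  induction j with
  | zero => simp [play_zero]
  | succ j ih =>
    rw [ih fun i hi => h i (by omega), Finset.sum_range_succ, play_succ']
    have := h j (by omega)
    obtain ⟨u, hu⟩ := Option.ne_none_iff_exists'.1 this
    rw [hu, valuation_some, weight'_some]
    push_cast
    rw [add_assoc]

/-! ### The valuation of a Max strategy -/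

theorem val_le (hτ : G.IsMinStrategy τ) (x : Option ℕ) : G.val σ x ≤ G.valuation σ τ x :=
  iInf_le (fun τ : {τ : ℕ → ℕ // G.IsMinStrategy τ} => G.valuation σ τ.1 x) ⟨τ, hτ⟩

theorem le_val {x : Option ℕ} {a : EReal} (h : ∀ τ, G.IsMinStrategy τ → a ≤ G.valuation σ τ x) :
    a ≤ G.val σ x := le_iInf fun τ => h τ.1 τ.2

theorem val_none (hG : G.MinMoves) : G.val σ none = 0 := by
  obtain ⟨τ, hτ⟩ := hG.exists_strategy
  refine le_antisymm ((val_le hτ _).trans_eq valuation_none) (le_val fun τ _ => ?_)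
  rw [valuation_none]

/-- Min has only finitely many strategies, up to irrelevant values, so that the best one against a
given vertex exists. -/
theorem exists_valuation_eq_val (hG : G.MinMoves) (hσ : G.IsMaxStrategy σ) {x : Option ℕ}
    (hx : G.IsPos x) : ∃ τ, G.IsMinStrategy τ ∧ G.valuation σ τ x = G.val σ x := by
  classical
  let f : {τ : ℕ → ℕ // G.IsMinStrategy τ} → EReal := fun τ => G.valuation σ τ.1 x
  let g : {τ : ℕ → ℕ // G.IsMinStrategy τ} → (G.minV → G.verts) := fun τ v =>
    ⟨τ.1 v, (mem_verts_of_edge (τ.2 v v.2)).2⟩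
  have hfg : Function.FactorsThrough f g := by
    intro τ τ' h
    refine valuation_congr G.IsPos hx (fun y hy => isPos_move hσ τ'.2 hy) ?_ (fun _ _ => rfl)
    intro y hy
    rcases y with _ | v
    · rfl
    rcases mem_verts.1 (isPos_some.1 hy) with h' | h'
    · rw [move_max h', move_max h']
    · rw [move_min h', move_min h']
      have := congrFun h ⟨v, h'⟩
      simpa [g] using this
  have hfin : (Set.range f).Finite := by
    have : f = Function.extend g f (fun _ => 0) ∘ g := by
      funext τ
      exact (hfg.extend_apply _ τ).symm
    rw [this]
    exact (Set.finite_range (Function.extend g f (fun _ => 0))).subset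
      (Set.range_comp_subset_range _ _)
  obtain ⟨τ, hτ⟩ := hG.exists_strategy
  have hne : (Set.range f).Nonempty := ⟨_, ⟨⟨τ, hτ⟩, rfl⟩⟩
  obtain ⟨τ', h'⟩ := hne.csInf_mem hfin
  exact ⟨τ'.1, τ'.2, h'⟩

theorem val_max {v : ℕ} (hv : v ∈ G.maxV) :
    G.val σ (some v) = ((G.weight v : ℝ) : EReal) + G.val σ (σ v) := by
  apply le_antisymm
  · rw [ereal_le_coe_add_iff]
    refine le_val fun τ hτ => ?_
    rw [← ereal_le_coe_add_iff, ← move_max (σ := σ) (τ := τ) hv, ← valuation_some]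
    exact val_le hτ _
  · refine le_val fun τ hτ => ?_
    rw [valuation_some, ereal_coe_add_le_iff, move_max hv]
    exact val_le hτ _

/-- Against `σ`, Min can move along any edge and then play optimally: if the play that starts with
this edge returns, then either the cycle is bad for Max, or skipping it is at least as good. -/
theorem val_min_le {v u : ℕ} (hv : v ∈ G.minV) (he : (v, u) ∈ G.edges) :
    G.val σ (some v) ≤ ((G.weight v : ℝ) : EReal) + G.val σ (some u) := by
  classical
  rw [ereal_le_coe_add_iff]
  refine le_val fun τ hτ => ?_
  rw [← ereal_le_coe_add_iff]
  set τ' := Function.update τ v u with hτ'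
  have hmin : G.IsMinStrategy τ' := by
    intro x hx
    by_cases h : x = v
    · subst h; simpa [hτ'] using he
    · simpa [hτ', h] using hτ x hx
  have hmove : ∀ y, y ≠ some v → G.move σ τ' y = G.move σ τ y := by
    intro y hy
    rcases y with _ | x
    · rfl
    · have : x ≠ v := fun h => hy (by rw [h])
      simp [move, hτ', this]
  have hv' : G.move σ τ' (some v) = some u := by rw [move_min hv]; simp [hτ']
  by_cases h : ∃ j, G.play σ τ (some u) j = some v
  · have hj := Nat.find_spec h
    set j := Nat.find h
    have hlt : ∀ i < j, G.play σ τ (some u) i ≠ some v := fun i hi => Nat.find_min h hi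
    have heq : ∀ i ≤ j, G.play σ τ' (some u) i = G.play σ τ (some u) i := by
      intro i
      induction i with
      | zero => intro _; rfl
      | succ i ih =>
        intro hi
        rw [play_succ', play_succ', ih (by omega), hmove _ (hlt i (by omega))]
    have hsplit := valuation_split (G := G) (σ := σ) (τ := τ) u j (by
      intro i hi h0
      have : G.play σ τ (some u) (i + (j - i)) = none := by rw [play_add, h0, play_none]
      rw [show i + (j - i) = j by omega, hj] at this
      simp at this)
    rw [hj] at hsplit
    rw [hsplit, ← add_assoc, ← EReal.coe_add, ← Int.cast_add]
    by_cases hW : G.weight v + ∑ i ∈ Finset.range j, G.weight' (G.play σ τ (some u) i) ≤ 0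
    · have : G.valuation σ τ' (some v) = ⊥ := by
        refine valuation_cycle_bot (p := j + 1) (by omega) ?_ ?_
        · rw [play_succ, hv', heq j le_rfl, hj]
        · rw [Finset.sum_range_succ']
          simp only [play_succ, play_zero, hv', weight'_some]
          rw [Finset.sum_congr rfl fun i hi => by
            rw [heq i (by have := Finset.mem_range.1 hi; omega)]]
          omega
      exact ((val_le hmin _).trans_eq this).trans bot_le
    · refine (val_le hτ _).trans ?_
      have : (0 : EReal) ≤
          (((G.weight v + ∑ i ∈ Finset.range j, G.weight' (G.play σ τ (some u) i) : ℤ) : ℝ) :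
            EReal) := by
        have : (0 : ℝ) ≤
            ((G.weight v + ∑ i ∈ Finset.range j, G.weight' (G.play σ τ (some u) i) : ℤ) : ℝ) := by
          exact_mod_cast (not_le.1 hW).le
        exact_mod_cast this
      calc G.valuation σ τ (some v) = 0 + G.valuation σ τ (some v) := (zero_add _).symm
        _ ≤ _ := by gcongr
  · push Not at h
    refine (val_le hmin _).trans_eq ?_
    rw [valuation_some, hv']
    congr 1
    refine valuation_congr (fun y => ∃ j, y = G.play σ τ (some u) j) ⟨0, rfl⟩ ?_ ?_ (fun _ _ => rfl)
    · rintro y ⟨j, rfl⟩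
      exact ⟨j + 1, (play_succ' _ _).symm⟩
    · rintro y ⟨j, rfl⟩
      exact hmove _ (h j)

/-- Some edge is optimal for Min. -/
theorem exists_val_min_ge (hG : G.MinMoves) (hσ : G.IsMaxStrategy σ) {v : ℕ} (hv : v ∈ G.minV) :
    ∃ u, (v, u) ∈ G.edges ∧
      ((G.weight v : ℝ) : EReal) + G.val σ (some u) ≤ G.val σ (some v) := by
  obtain ⟨τ, hτ, h⟩ := exists_valuation_eq_val hG hσ (isPos_some.2 (mem_verts.2 (Or.inr hv)))
  refine ⟨τ v, hτ v hv, ?_⟩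
  rw [← h, valuation_some, move_min hv, ereal_coe_add_le_iff]
  exact val_le hτ _

end Arena
end StratImp

namespace StratImp
namespace Arena

variable {G H : Arena} {σ σ' : ℕ → Option ℕ} {τ τ' : ℕ → ℕ}

/-! ### Improving switches -/

/-- `σ'` arises from `σ` by switching profitable edges. -/
def Improves (G : Arena) (σ σ' : ℕ → Option ℕ) : Prop :=
  G.IsMaxStrategy σ' ∧ ∀ v ∈ G.maxV, σ' v = σ v ∨ G.val σ (σ v) < G.val σ (σ' v)

theorem mem_of_lookup_eq_some {F : List (ℕ × Option ℕ)} {v : ℕ} {u : Option ℕ}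
    (h : F.lookup v = some u) : (v, u) ∈ F := by
  induction F with
  | nil => simp at h
  | cons e F ih =>
    obtain ⟨a, b⟩ := e
    rw [List.lookup_cons] at h
    by_cases hva : v = a
    · subst hva
      simp at h
      simp [h]
    · have : (v == a) = false := by simpa using hva
      rw [this] at h
      exact List.mem_cons_of_mem _ (ih h)

theorem switchEdges_eq (F : List (ℕ × Option ℕ)) (v : ℕ) :
    switchEdges σ F v = σ v ∨ (v, switchEdges σ F v) ∈ F := by
  unfold switchEdges
  cases h : F.lookup v with
  | none => left; rfl
  | some u => right; exact mem_of_lookup_eq_some h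

theorem improves_switchEdges (hσ : G.IsMaxStrategy σ) {F : List (ℕ × Option ℕ)}
    (hF : ∀ e ∈ F, G.Profitable σ e.1 e.2) : G.Improves σ (switchEdges σ F) := by
  refine ⟨fun v hv => ?_, fun v hv => ?_⟩
  · rcases switchEdges_eq (σ := σ) F v with h | h
    · rw [h]; exact hσ v hv
    · exact (hF _ h).1
  · rcases switchEdges_eq (σ := σ) F v with h | h
    · exact Or.inl h
    · exact Or.inr (hF _ h).2.2

theorem IsStart.bot_lt (hG : G.MinMoves) (hσ : G.IsStart σ) {x : Option ℕ} (hx : G.IsPos x) :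
    ⊥ < G.val σ x := by
  rcases x with _ | v
  · rw [val_none hG]; simp
  · exact hσ.2 v (isPos_some.1 hx)

theorem Improves.val_le_move (h : G.Improves σ σ') (hτ : G.IsMinStrategy τ) {v : ℕ}
    (hv : v ∈ G.verts) :
    G.val σ (some v) ≤ ((G.weight v : ℝ) : EReal) + G.val σ (G.move σ' τ (some v)) := by
  rcases mem_verts.1 hv with hv | hv
  · rw [move_max hv, val_max hv, ereal_coe_add_le_iff]
    rcases h.2 v hv with h' | h'
    · rw [h']
    · exact h'.le
  · rw [move_min hv]
    exact val_min_le hv (hτ v hv)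

/-- A play of an improved strategy cannot repeat a nonpositive cycle: going round a cycle, the old
valuations show that its weight is nonnegative, and positive if a switched edge is passed; without
switched edges the cycle was there before. -/
theorem Improves.not_cycle (hG : G.MinMoves) (hσ : G.IsStart σ) (h : G.Improves σ σ')
    (hτ : G.IsMinStrategy τ) {x : Option ℕ} (hx : G.IsPos x) (hns : ¬ G.Sinks σ' τ x) {p : ℕ}
    (hp : 0 < p) (hc : G.play σ' τ x p = x)
    (hs : ∑ i ∈ Finset.range p, G.weight' (G.play σ' τ x i) ≤ 0) : False := by
  have hne : ∀ i, ∃ v ∈ G.verts, G.play σ' τ x i = some v := by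
    intro i
    obtain ⟨v, hv⟩ := Option.ne_none_iff_exists'.1 (fun h0 => hns ⟨i, h0⟩)
    refine ⟨v, ?_, hv⟩
    have := isPos_play h.1 hτ hx i
    rwa [hv, isPos_some] at this
  choose y hyv hy using hne
  have hstep : ∀ i, G.val σ (some (y i)) ≤
      ((G.weight (y i) : ℝ) : EReal) + G.val σ (some (y (i + 1))) := by
    intro i
    have := h.val_le_move hτ (hyv i)
    rwa [← hy i, ← play_succ', hy i, hy (i + 1)] at this
  have hy0 : y p = y 0 := by
    have := hy p
    rw [hc, ← play_zero (G := G) (σ := σ') (τ := τ) x, hy 0] at this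
    exact (Option.some.inj this).symm
  have hsame : ∀ i < p, G.move σ τ (some (y i)) = some (y (i + 1)) := by
    intro i hi
    have hm : G.move σ' τ (some (y i)) = some (y (i + 1)) := by rw [← hy i, ← play_succ', hy]
    rcases mem_verts.1 (hyv i) with hv | hv
    swap
    · rwa [move_min hv] at hm ⊢
    rw [move_max hv] at hm ⊢
    rcases h.2 _ hv with h' | h'
    · rw [← h', hm]
    exfalso
    rw [hm] at h'
    have hfin : ∀ j ≤ p, G.val σ (some (y j)) ≠ ⊤ := by
      intro j hj htop
      have hall : ∀ n, G.val σ (some (y (j + n))) = ⊤ := by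
        intro n
        induction n with
        | zero => exact htop
        | succ n ih =>
          have := hstep (j + n)
          rw [ih, top_le_iff, ereal_coe_add_eq_top] at this
          exact this
      have hall0 : ∀ n, G.val σ (some (y n)) = ⊤ := by
        have h0 : G.val σ (some (y 0)) = ⊤ := by
          rw [← hy0, show p = j + (p - j) by omega]; exact hall _
        intro n
        induction n with
        | zero => exact h0
        | succ n ih =>
          have := hstep n
          rw [ih, top_le_iff, ereal_coe_add_eq_top] at this
          exact this
      have h1 := hall0 i
      rw [val_max hv, ereal_coe_add_eq_top] at h1
      rw [h1] at h'
      exact absurd h' (not_lt.2 le_top)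
    have hbot : ∀ j, G.val σ (some (y j)) ≠ ⊥ := fun j => (hσ.2 _ (hyv j)).ne'
    have hb : ∀ j, ∃ b : ℝ, j ≤ p → G.val σ (some (y j)) = (b : EReal) := by
      intro j
      refine ⟨(G.val σ (some (y j))).toReal, fun hj => (EReal.coe_toReal (hfin j hj) (hbot j)).symm⟩
    choose b hb using hb
    have h1 : ∀ j < p, b j ≤ G.weight (y j) + b (j + 1) := by
      intro j hj
      have := hstep j
      rw [hb j hj.le, hb (j + 1) hj, ← EReal.coe_add, EReal.coe_le_coe_iff] at this
      exact this
    have h2 : b i < G.weight (y i) + b (i + 1) := by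
      rw [← ereal_coe_add_lt_iff (G.weight (y i)), ← val_max hv, hb i hi.le, hb (i + 1) hi,
        ← EReal.coe_add, EReal.coe_lt_coe_iff] at h'
      exact h'
    have h3 : ∑ j ∈ Finset.range p, (b j - b (j + 1)) <
        ∑ j ∈ Finset.range p, (G.weight (y j) : ℝ) :=
      Finset.sum_lt_sum (fun j hj => by linarith [h1 j (Finset.mem_range.1 hj)])
        ⟨i, Finset.mem_range.2 hi, by linarith⟩
    rw [Finset.sum_range_sub'] at h3
    have h4 : b p = b 0 := by
      have e1 := hb p le_rfl
      have e2 := hb 0 (Nat.zero_le _)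
      rw [hy0, e2] at e1
      exact (EReal.coe_injective e1).symm
    simp only [hy, weight'_some] at hs
    have : ((∑ j ∈ Finset.range p, G.weight (y j) : ℤ) : ℝ) ≤ 0 := by exact_mod_cast hs
    push_cast at this
    linarith
  have hx0 : x = some (y 0) := by rw [← hy 0, play_zero]
  have hplay : ∀ i ≤ p, G.play σ τ x i = some (y i) := by
    intro i
    induction i with
    | zero => intro _; rw [play_zero, hx0]
    | succ i ih => intro hi; rw [play_succ', ih (by omega), hsame i (by omega)]
  have hbot : G.valuation σ τ x = ⊥ := by
    rw [hx0]
    refine valuation_cycle_bot hp (by rw [← hx0, hplay p le_rfl, hy0, ← hx0]) ?_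
    rw [← hx0]
    refine le_of_eq_of_le (Finset.sum_congr rfl fun i hi => ?_) hs
    rw [hplay i (Finset.mem_range.1 hi).le, hy]
  have := (hσ.bot_lt hG hx).trans_le (val_le hτ x)
  rw [hbot] at this
  exact lt_irrefl _ this

/-- Along a play that reaches the sink the old valuation is a lower bound by induction from the end,
and a nonpositive cycle cannot arise. -/
theorem Improves.val_le_valuation (hG : G.MinMoves) (hσ : G.IsStart σ) (h : G.Improves σ σ')
    (hτ : G.IsMinStrategy τ) {x : Option ℕ} (hx : G.IsPos x) :
    G.val σ x ≤ G.valuation σ' τ x := by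
  by_cases hk : G.Sinks σ' τ x
  · obtain ⟨k, hk⟩ := hk
    induction k generalizing x with
    | zero =>
      rw [play_zero] at hk
      rw [hk, val_none hG, valuation_none]
    | succ k ih =>
      rcases x with _ | v
      · rw [val_none hG, valuation_none]
      rw [play_succ] at hk
      refine (h.val_le_move hτ (isPos_some.1 hx)).trans ?_
      rw [valuation_some, ereal_coe_add_le_iff]
      exact ih (isPos_move h.1 hτ hx) hk
  · rcases valuation_of_not_sinks hk with h' | h'
    · exfalso
      obtain ⟨k, p, hp, hc, hs⟩ := h'.2
      refine h.not_cycle hG hσ hτ (isPos_play h.1 hτ hx k) ?_ hp (by rw [← play_add, hc]) ?_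
      · rintro ⟨j, hj⟩
        exact hk ⟨k + j, by rw [play_add, hj]⟩
      · refine le_of_eq_of_le ?_ hs
        rw [Finset.sum_Ico_eq_sum_range]
        simp [← play_add]
    · rw [h'.1]; exact le_top

theorem Improves.val_mono (hG : G.MinMoves) (hσ : G.IsStart σ) (h : G.Improves σ σ')
    {x : Option ℕ} (hx : G.IsPos x) : G.val σ x ≤ G.val σ' x :=
  le_val fun _ hτ => h.val_le_valuation hG hσ hτ hx

theorem Improves.isStart (hG : G.MinMoves) (hσ : G.IsStart σ) (h : G.Improves σ σ') :
    G.IsStart σ' :=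
  ⟨h.1, fun _ hv => (hσ.2 _ hv).trans_le (h.val_mono hG hσ (isPos_some.2 hv))⟩

theorem isPos_max (hσ : G.IsMaxStrategy σ) {v : ℕ} (hv : v ∈ G.maxV) : G.IsPos (σ v) := by
  rcases (hσ v hv).2 with h | ⟨u, h, he⟩
  · rw [h]; exact isPos_none
  · rw [h]; exact isPos_some.2 (mem_verts_of_edge he).2

/-- Switching a profitable edge makes the valuation of its first vertex at least the value that
the edge promises. -/
theorem Improves.le_val (hG : G.MinMoves) (hσ : G.IsStart σ) (h : G.Improves σ σ') {v : ℕ}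
    (hv : v ∈ G.maxV) : ((G.weight v : ℝ) : EReal) + G.val σ (σ' v) ≤ G.val σ' (some v) := by
  rw [val_max hv, ereal_coe_add_le_iff]
  exact h.val_mono hG hσ (isPos_max h.1 hv)

/-! ### Removing the vertices of infinite valuation -/

theorem restrict_maxV (U : Finset ℕ) : (G.restrict U).maxV = G.maxV ∩ U := rfl
theorem restrict_minV (U : Finset ℕ) : (G.restrict U).minV = G.minV ∩ U := rfl

theorem mem_restrict_verts {U : Finset ℕ} {v : ℕ} :
    v ∈ (G.restrict U).verts ↔ v ∈ G.verts ∧ v ∈ U := by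
  simp only [mem_verts, restrict_maxV, restrict_minV, Finset.mem_inter]; tauto

theorem mem_restrict_edges {U : Finset ℕ} {v u : ℕ} :
    (v, u) ∈ (G.restrict U).edges ↔ (v, u) ∈ G.edges ∧ v ∈ U ∧ u ∈ U := by
  simp [restrict]

theorem restrict_restrict (U W : Finset ℕ) :
    (G.restrict U).restrict W = G.restrict (U ∩ W) := by
  unfold restrict
  simp only [Finset.inter_assoc, Finset.filter_filter, Finset.mem_inter, mk.injEq, true_and,
    and_true]
  ext e
  simp only [Finset.mem_filter]
  tauto

open Classical in
/-- The vertices at which `σ` has valuation `∞`. -/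
noncomputable def topSet (G : Arena) (σ : ℕ → Option ℕ) : Finset ℕ :=
  G.verts.filter fun v => G.val σ (some v) = ⊤

/-- The sub-game on the vertices at which `σ` does not have valuation `∞`. -/
noncomputable def rest (G : Arena) (σ : ℕ → Option ℕ) : Arena :=
  G.restrict (G.verts \ G.topSet σ)

theorem mem_topSet {v : ℕ} : v ∈ G.topSet σ ↔ v ∈ G.verts ∧ G.val σ (some v) = ⊤ := by
  simp [topSet]

theorem mem_rest_verts {v : ℕ} : v ∈ (G.rest σ).verts ↔ v ∈ G.verts ∧ v ∉ G.topSet σ := by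
  rw [rest, mem_restrict_verts, Finset.mem_sdiff]; tauto

theorem mem_rest_maxV {v : ℕ} : v ∈ (G.rest σ).maxV ↔ v ∈ G.maxV ∧ v ∉ G.topSet σ := by
  rw [rest, restrict_maxV, Finset.mem_inter, Finset.mem_sdiff, mem_verts]; tauto

theorem mem_rest_minV {v : ℕ} : v ∈ (G.rest σ).minV ↔ v ∈ G.minV ∧ v ∉ G.topSet σ := by
  rw [rest, restrict_minV, Finset.mem_inter, Finset.mem_sdiff, mem_verts]; tauto

theorem mem_rest_edges {v u : ℕ} : (v, u) ∈ (G.rest σ).edges ↔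
    (v, u) ∈ G.edges ∧ v ∉ G.topSet σ ∧ u ∉ G.topSet σ := by
  rw [rest, mem_restrict_edges, Finset.mem_sdiff, Finset.mem_sdiff]
  constructor
  · tauto
  · intro h
    have := mem_verts_of_edge h.1
    tauto

/-- The vertices of valuation `∞` are left neither by Max, who follows `σ`, nor by Min
(`topSet_min`). -/
theorem topSet_max (hG : G.MinMoves) (hσ : G.IsMaxStrategy σ) {v : ℕ} (hv : v ∈ G.maxV)
    (ht : v ∈ G.topSet σ) : ∃ u ∈ G.topSet σ, σ v = some u ∧ (v, u) ∈ G.edges := by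
  have h := (mem_topSet.1 ht).2
  rw [val_max hv, ereal_coe_add_eq_top] at h
  rcases (hσ v hv).2 with h' | ⟨u, h', he⟩
  · rw [h', val_none hG] at h; simp at h
  · exact ⟨u, mem_topSet.2 ⟨(mem_verts_of_edge he).2, by rwa [← h']⟩, h', he⟩

theorem topSet_min {v u : ℕ} (hv : v ∈ G.minV) (ht : v ∈ G.topSet σ) (he : (v, u) ∈ G.edges) :
    u ∈ G.topSet σ := by
  have h := val_min_le (σ := σ) hv he
  rw [(mem_topSet.1 ht).2, top_le_iff, ereal_coe_add_eq_top] at h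
  exact mem_topSet.2 ⟨(mem_verts_of_edge he).2, h⟩

theorem rest_max (hσ : G.IsMaxStrategy σ) : (G.rest σ).IsMaxStrategy σ := by
  intro v hv
  refine ⟨hv, ?_⟩
  obtain ⟨hv, ht⟩ := mem_rest_maxV.1 hv
  rcases (hσ v hv).2 with h | ⟨u, h, he⟩
  · exact Or.inl h
  · refine Or.inr ⟨u, h, mem_rest_edges.2 ⟨he, ht, fun hu => ht ?_⟩⟩
    refine mem_topSet.2 ⟨mem_verts.2 (Or.inl hv), ?_⟩
    rw [val_max hv, ereal_coe_add_eq_top, h]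
    exact (mem_topSet.1 hu).2

/-- At a Min vertex with valuation below `∞`, the move that attains the valuation does not lead to
valuation `∞`. -/
theorem rest_minMoves (hG : G.MinMoves) (hσ : G.IsMaxStrategy σ) : (G.rest σ).MinMoves := by
  intro v hv
  obtain ⟨hv, ht⟩ := mem_rest_minV.1 hv
  obtain ⟨u, he, h⟩ := exists_val_min_ge hG hσ hv
  refine ⟨u, mem_rest_edges.2 ⟨he, ht, fun hu => ht ?_⟩⟩
  rw [(mem_topSet.1 hu).2, (ereal_coe_add_eq_top _ _).2 rfl, top_le_iff] at h
  exact mem_topSet.2 ⟨mem_verts.2 (Or.inr hv), h⟩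

/-- A strategy that agrees with `σ` where `σ` has valuation `∞` has valuation `∞` there. -/
theorem valuation_eq_top_of_mem_topSet (hG : G.MinMoves) (hσ : G.IsMaxStrategy σ)
    (hσ' : ∀ v ∈ G.topSet σ, σ' v = σ v) (hτ : G.IsMinStrategy τ) {v : ℕ}
    (hv : v ∈ G.topSet σ) : G.valuation σ' τ (some v) = ⊤ := by
  have h1 : G.valuation σ' τ (some v) = G.valuation σ τ (some v) := by
    refine valuation_congr (fun y => ∃ u ∈ G.topSet σ, y = some u) ⟨v, hv, rfl⟩ ?_ ?_
      (fun _ _ => rfl)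
    · rintro y ⟨u, hu, rfl⟩
      rcases mem_verts.1 (mem_topSet.1 hu).1 with h | h
      · rw [move_max h]
        obtain ⟨z, hz, h', -⟩ := topSet_max hG hσ h hu
        exact ⟨z, hz, h'⟩
      · rw [move_min h]
        exact ⟨_, topSet_min h hu (hτ u h), rfl⟩
    · rintro y ⟨u, hu, rfl⟩
      simp only [move, hσ' u hu]
  rw [h1, ← top_le_iff]
  exact le_of_eq_of_le (mem_topSet.1 hv).2.symm (val_le hτ _)

theorem topSet_subset_of_eqOn (hG : G.MinMoves) (hσ : G.IsMaxStrategy σ)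
    (hσ' : ∀ v ∈ G.topSet σ, σ' v = σ v) : G.topSet σ ⊆ G.topSet σ' := by
  intro v hv
  refine mem_topSet.2 ⟨(mem_topSet.1 hv).1, top_le_iff.1 ?_⟩
  exact le_val fun τ hτ => (valuation_eq_top_of_mem_topSet hG hσ hσ' hτ hv).ge

/-- Removing the vertices of valuation `∞` does not change the other valuations: it would be
pointless for Min to enter the removed part, which cannot be left again. -/
theorem val_rest (hG : G.MinMoves) (hσ : G.IsMaxStrategy σ)
    (hσ' : ∀ v ∈ G.topSet σ, σ' v = σ v) (hm : (G.rest σ).IsMaxStrategy σ') {x : Option ℕ}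
    (hx : (G.rest σ).IsPos x) : (G.rest σ).val σ' x = G.val σ' x := by
  classical
  have hw : ∀ y, (G.rest σ).weight' y = G.weight' y := by
    intro y; cases y <;> rfl
  have hmove : ∀ (τ₁ τ₂ : ℕ → ℕ) (y : Option ℕ), (G.rest σ).IsPos y →
      (∀ v, y = some v → v ∈ G.minV → τ₁ v = τ₂ v) →
      G.move σ' τ₁ y = (G.rest σ).move σ' τ₂ y := by
    intro τ₁ τ₂ y hy h
    rcases y with _ | v
    · rfl
    have hv := mem_rest_verts.1 (isPos_some.1 hy)
    rcases mem_verts.1 hv.1 with h' | h'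
    · rw [move_max h', move_max (mem_rest_maxV.2 ⟨h', hv.2⟩)]
    · rw [move_min h', move_min (mem_rest_minV.2 ⟨h', hv.2⟩), h v rfl h']
  apply le_antisymm
  · refine le_val fun τ hτ => ?_
    by_cases hent : ∃ i, ∃ v ∈ G.topSet σ, G.play σ' τ x i = some v
    · obtain ⟨i, v, hv, hi⟩ := hent
      have : G.valuation σ' τ x = ⊤ := valuation_play_top (i := i) (by
        rw [hi]; exact valuation_eq_top_of_mem_topSet hG hσ hσ' hτ hv)
      rw [this]; exact le_top
    · push Not at hent
      obtain ⟨τ₀, hτ₀⟩ := (rest_minMoves hG hσ).exists_strategy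
      have hpos : ∀ i, (G.rest σ).IsPos (G.play σ' τ x i) := by
        intro i
        induction i with
        | zero => exact hx
        | succ i ih =>
          rw [play_succ']
          intro u hu
          rcases hi : G.play σ' τ x i with _ | v
          · rw [hi] at hu; simp [move] at hu
          rw [hi] at hu ih
          have hv := mem_rest_verts.1 (isPos_some.1 ih)
          have hut : u ∉ G.topSet σ := fun h' => hent (i + 1) u h' (by rw [play_succ', hi, hu])
          rcases mem_verts.1 hv.1 with h' | h'
          · rw [move_max h'] at hu
            have := isPos_max hm (mem_rest_maxV.2 ⟨h', hv.2⟩)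
            exact this u hu
          · rw [move_min h'] at hu
            have := hτ v h'
            rw [Option.some.inj hu] at this
            exact mem_rest_verts.2 ⟨(mem_verts_of_edge this).2, hut⟩
      let τ' : ℕ → ℕ := fun v => if τ v ∈ G.topSet σ then τ₀ v else τ v
      have hτ' : (G.rest σ).IsMinStrategy τ' := by
        intro v hv
        by_cases h' : τ v ∈ G.topSet σ
        · simpa [τ', h'] using hτ₀ v hv
        · have := mem_rest_minV.1 hv
          simpa [τ', h'] using mem_rest_edges.2 ⟨hτ v this.1, this.2, h'⟩
      refine (val_le hτ' x).trans_eq ?_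
      refine valuation_congr (fun y => ∃ i, y = G.play σ' τ x i) ⟨0, rfl⟩ ?_ ?_ (fun y _ => hw y)
      · rintro y ⟨i, rfl⟩
        exact ⟨i + 1, (play_succ' _ _).symm⟩
      · rintro y ⟨i, rfl⟩
        refine (hmove _ _ _ (hpos i) ?_).symm
        intro v hv h'
        have : τ v ∉ G.topSet σ := fun hh => hent (i + 1) _ hh (by rw [play_succ', hv, move_min h'])
        simp [τ', this]
  · refine le_val fun τ hτ => ?_
    obtain ⟨τ₀, hτ₀⟩ := hG.exists_strategy
    let τ' : ℕ → ℕ := fun v => if v ∈ G.topSet σ then τ₀ v else τ v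
    have hτ' : G.IsMinStrategy τ' := by
      intro v hv
      by_cases h' : v ∈ G.topSet σ
      · simpa [τ', h'] using hτ₀ v hv
      · simpa [τ', h'] using (mem_rest_edges.1 (hτ v (mem_rest_minV.2 ⟨hv, h'⟩))).1
    refine (val_le hτ' x).trans_eq ?_
    refine valuation_congr (G.rest σ).IsPos hx (fun y hy => isPos_move hm hτ hy) ?_
      (fun y _ => (hw y).symm)
    intro y hy
    refine hmove _ _ _ hy ?_
    intro v hv _
    have := (mem_rest_verts.1 (hy v hv)).2
    simp [τ', this]

end Arena

open Arena

/-! ### Strategy improvement on the remaining game -/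

theorem ImprovementRun.append {G : Arena} {σ ρ χ : ℕ → Option ℕ} {r s : List Event}
    (h₁ : ImprovementRun G σ r ρ) (h₂ : ImprovementRun G ρ s χ) :
    ImprovementRun G σ (r ++ s) χ := by
  induction h₁ with
  | nil σ => exact h₂
  | iteration F hne hprof hone _ ih =>
    rw [List.append_assoc, List.cons_append]
    exact .iteration F hne hprof hone (ih h₂)

/-- A strategy improvement run on the remaining game is one on the whole game, and does not touch
the strategy on the removed vertices. -/
theorem ImprovementRun.of_rest {G : Arena} {σ : ℕ → Option ℕ} (hG : G.MinMoves)
    (hσ : G.IsMaxStrategy σ) {χ ρ : ℕ → Option ℕ} {r : List Event}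
    (h : ImprovementRun (G.rest σ) χ r ρ) (hχ : (G.rest σ).IsStart χ)
    (heq : ∀ v ∉ (G.rest σ).maxV, χ v = σ v) :
    ImprovementRun G χ r ρ ∧ (G.rest σ).IsStart ρ ∧ ∀ v ∉ (G.rest σ).maxV, ρ v = σ v := by
  induction h with
  | nil χ => exact ⟨.nil χ, hχ, heq⟩
  | @iteration χ ρ r F hne hprof hone hrest ih =>
    have hHG := rest_minMoves hG hσ
    have heq' : ∀ v ∉ (G.rest σ).maxV, switchEdges χ F v = σ v := by
      intro v hv
      rcases switchEdges_eq (σ := χ) F v with h | h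
      · rw [h, heq v hv]
      · exact absurd (hprof _ h).1.1 hv
    obtain ⟨h1, h2, h3⟩ := ih ((improves_switchEdges hχ.1 hprof).isStart hHG hχ) heq'
    refine ⟨.iteration F hne (fun e he => ?_) hone h1, h2, h3⟩
    have htop : ∀ v ∈ G.topSet σ, χ v = σ v := fun v hv =>
      heq v fun hv' => (mem_rest_maxV.1 hv').2 hv
    obtain ⟨⟨hv, he'⟩, hne', hlt⟩ := hprof e he
    refine ⟨⟨(mem_rest_maxV.1 hv).1, ?_⟩, hne', ?_⟩
    · rcases he' with he' | ⟨u, hu, he'⟩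
      · exact Or.inl he'
      · exact Or.inr ⟨u, hu, (mem_rest_edges.1 he').1⟩
    · rwa [val_rest hG hσ htop hχ.1 (isPos_max hχ.1 hv), val_rest hG hσ htop hχ.1] at hlt
      rcases he' with he' | ⟨u, hu, he'⟩
      · rw [he']; exact isPos_none
      · rw [hu]; exact isPos_some.2 (mem_verts_of_edge he').2

end StratImp

namespace StratImp

/-! ### Payoffs of sequences with bounded sums and of periodic sequences -/

/-- The partial sums of `f` are bounded above. -/
def BddSums (f : ℕ → ℤ) : Prop := ∃ K : ℤ, ∀ n, ∑ i ∈ Finset.range n, f i ≤ K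

theorem bddSums_shift (f : ℕ → ℤ) (j : ℕ) : BddSums (fun i => f (j + i)) ↔ BddSums f := by
  have h : ∀ n, ∑ i ∈ Finset.range (j + n), f i =
      ∑ i ∈ Finset.range j, f i + ∑ i ∈ Finset.range n, f (j + i) := fun n =>
    Finset.sum_range_add f j n
  constructor
  · rintro ⟨K, hK⟩
    obtain ⟨L, hL⟩ := ((Finset.range (j + 1)).image fun n => ∑ i ∈ Finset.range n, f i).bddAbove
    refine ⟨max L (∑ i ∈ Finset.range j, f i + K), fun n => ?_⟩
    by_cases hn : n ≤ j
    · exact le_max_of_le_left (hL (Finset.mem_coe.2 (Finset.mem_image_of_mem _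
        (Finset.mem_range.2 (by omega)))))
    · refine le_max_of_le_right ?_
      rw [show n = j + (n - j) by omega, h]
      have : ∑ i ∈ Finset.range (n - j), f (j + i) ≤ K := hK (n - j)
      omega
  · rintro ⟨K, hK⟩
    refine ⟨K - ∑ i ∈ Finset.range j, f i, fun n => ?_⟩
    have := hK (j + n)
    rw [h] at this
    change ∑ i ∈ Finset.range n, f (j + i) ≤ _
    omega

theorem sum_period (f : ℕ → ℤ) (k p : ℕ) (hf : ∀ n, k ≤ n → f (n + p) = f n) (n : ℕ) :
    ∑ i ∈ Finset.range (k + n + p), f i =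
      ∑ i ∈ Finset.range (k + n), f i + ∑ i ∈ Finset.Ico k (k + p), f i := by
  induction n with
  | zero => rw [add_zero, Finset.range_eq_Ico, Finset.range_eq_Ico,
      Finset.sum_Ico_consecutive f (Nat.zero_le k) (by omega)]
  | succ n ih =>
    rw [show k + (n + 1) + p = k + n + p + 1 by omega, Finset.sum_range_succ, ih,
      ← add_assoc, Finset.sum_range_succ, hf _ (by omega)]
    ring

theorem bddSums_of_periodic (f : ℕ → ℤ) (k p : ℕ) (hp : 0 < p)
    (hf : ∀ n, k ≤ n → f (n + p) = f n) (hs : ∑ i ∈ Finset.Ico k (k + p), f i ≤ 0) :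
    BddSums f := by
  obtain ⟨L, hL⟩ := ((Finset.range (k + p)).image fun n => ∑ i ∈ Finset.range n, f i).bddAbove
  refine ⟨L, fun n => ?_⟩
  induction n using Nat.strong_induction_on with
  | _ n ih =>
    by_cases hn : n < k + p
    · exact hL (Finset.mem_coe.2 (Finset.mem_image_of_mem _ (Finset.mem_range.2 hn)))
    · rw [show n = k + (n - k - p) + p by omega, sum_period f k p hf]
      have := ih (k + (n - k - p)) (by omega)
      omega

namespace Arena

variable {G : Arena} {σ : ℕ → Option ℕ} {τ : ℕ → ℕ}

theorem exists_abs_weight_le (G : Arena) {y : ℕ → ℕ} (hy : ∀ n, y n ∈ G.verts) :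
    ∃ L : ℝ, ∀ n, |(G.weight (y n) : ℝ)| ≤ L := by
  obtain ⟨L, hL⟩ := (G.verts.image fun v => |(G.weight v : ℝ)|).bddAbove
  exact ⟨L, fun n => hL (Finset.mem_coe.2 (Finset.mem_image_of_mem _ (hy n)))⟩

/-- The averages that define the payoff are bounded. -/
theorem exists_abs_average_le (G : Arena) {y : ℕ → ℕ} (hy : ∀ n, y n ∈ G.verts) :
    ∃ L : ℝ, ∀ n : ℕ, |(1 / (n : ℝ)) * ∑ i ∈ Finset.range (n + 1), (G.weight (y i) : ℝ)| ≤ L := by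
  obtain ⟨L, hL⟩ := G.exists_abs_weight_le hy
  have hL0 : 0 ≤ L := (abs_nonneg _).trans (hL 0)
  refine ⟨2 * L, fun n => ?_⟩
  rcases Nat.eq_zero_or_pos n with rfl | hn
  · simpa using hL0
  have hn' : (1 : ℝ) ≤ n := by exact_mod_cast hn
  have h1 : |∑ i ∈ Finset.range (n + 1), (G.weight (y i) : ℝ)| ≤ (n + 1) * L := by
    refine (Finset.abs_sum_le_sum_abs _ _).trans ((Finset.sum_le_sum fun i _ => hL i).trans_eq ?_)
    simp
  rw [abs_mul, abs_of_nonneg (by positivity), one_div, inv_mul_le_iff₀ (by positivity)]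
  nlinarith

/-- Partial sums that are bounded above make the averages nonpositive in the limit. -/
theorem payoff_nonpos {y : ℕ → ℕ} (hy : ∀ n, y n ∈ G.verts)
    (hb : BddSums fun i => G.weight (y i)) : G.payoff y ≤ 0 := by
  obtain ⟨K, hK⟩ := hb
  obtain ⟨L, hL⟩ := G.exists_abs_average_le hy
  have hlim : Tendsto (fun n : ℕ => (K : ℝ) / n) atTop (nhds 0) :=
    tendsto_const_div_atTop_nhds_zero_nat _
  rw [payoff, ← hlim.liminf_eq]
  refine liminf_le_liminf (Eventually.of_forall fun n => ?_) ?_ ?_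
  · rw [one_div, div_eq_inv_mul]
    refine mul_le_mul_of_nonneg_left ?_ (by positivity)
    exact_mod_cast hK (n + 1)
  · exact isBoundedUnder_of ⟨-L, fun n => (abs_le.1 (hL n)).1⟩
  · exact hlim.isBoundedUnder_le.isCoboundedUnder_ge

/-- A sequence that repeats a cycle of positive weight has positive payoff: its sums grow at least
as fast as `n / p`. -/
theorem payoff_pos {y : ℕ → ℕ} (hy : ∀ n, y n ∈ G.verts) (k p : ℕ) (hp : 0 < p)
    (hf : ∀ n, k ≤ n → y (n + p) = y n)
    (hs : 0 < ∑ i ∈ Finset.Ico k (k + p), G.weight (y i)) : 0 < G.payoff y := by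
  obtain ⟨L, hL⟩ := G.exists_abs_average_le hy
  obtain ⟨K, hK⟩ := ((Finset.range (k + p)).image fun n : ℕ =>
    (n : ℝ) / p - ∑ i ∈ Finset.range n, (G.weight (y i) : ℝ)).bddAbove
  have hp' : (0 : ℝ) < p := by exact_mod_cast hp
  have hsum : ∀ n : ℕ, (n : ℝ) / p - K ≤ ∑ i ∈ Finset.range n, (G.weight (y i) : ℝ) := by
    intro n
    induction n using Nat.strong_induction_on with
    | _ n ih =>
      by_cases hn : n < k + p
      · have := hK (Finset.mem_coe.2 (Finset.mem_image_of_mem _ (Finset.mem_range.2 hn)))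
        linarith
      · have h1 := sum_period (fun i => G.weight (y i)) k p (fun n hn => by simp only [hf n hn])
          (n - k - p)
        have h2 := ih (k + (n - k - p)) (by omega)
        rw [show k + (n - k - p) + p = n by omega] at h1
        have h3 : ∑ i ∈ Finset.range (k + (n - k - p)), G.weight (y i) + 1 ≤
          ∑ i ∈ Finset.range n, G.weight (y i) := by omega
        have h4 : ∑ i ∈ Finset.range (k + (n - k - p)), (G.weight (y i) : ℝ) + 1 ≤
          ∑ i ∈ Finset.range n, (G.weight (y i) : ℝ) := by exact_mod_cast h3
        have h5 : (n : ℝ) / p = ((k + (n - k - p) : ℕ) : ℝ) / p + 1 := by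
          have : (n : ℝ) = ((k + (n - k - p) : ℕ) : ℝ) + p := by
            rw [← Nat.cast_add]; congr 1; omega
          rw [this]; field_simp
        linarith
  have hlim : Tendsto (fun n : ℕ => 1 / (p : ℝ) - |K| / n) atTop (nhds (1 / (p : ℝ))) := by
    simpa using tendsto_const_nhds.sub (tendsto_const_div_atTop_nhds_zero_nat |K|)
  have h0 : 0 < 1 / (p : ℝ) := by positivity
  refine h0.trans_le ?_
  rw [payoff, ← hlim.liminf_eq]
  refine liminf_le_liminf ?_ hlim.isBoundedUnder_ge ?_
  · filter_upwards [eventually_gt_atTop 0] with n hn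
    have hn' : (0 : ℝ) < n := by exact_mod_cast hn
    have h1 := hsum (n + 1)
    have h2 := le_abs_self K
    have h3 : (n : ℝ) / p ≤ ((n + 1 : ℕ) : ℝ) / p := by gcongr; omega
    calc 1 / (p : ℝ) - |K| / n = 1 / (n : ℝ) * (n / p - |K|) := by field_simp
      _ ≤ _ := by gcongr; linarith
  · refine IsBoundedUnder.isCoboundedUnder_ge (isBoundedUnder_of ⟨L, fun n => (abs_le.1 (hL n)).2⟩)

/-! ### Hopeless vertices -/

theorem IsMeanPayoffGame.minMoves (hG : G.IsMeanPayoffGame) : G.MinMoves :=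
  fun v hv => hG.2 v (mem_verts.2 (Or.inr hv))

theorem not_hopeless_of_max (hG : G.MinMoves) {v : ℕ} (hv : v ∈ G.maxV) : ¬ G.Hopeless v := by
  intro h
  have := h (fun _ => none) fun u hu => ⟨hu, Or.inl rfl⟩
  rw [val_max hv, ereal_coe_add_eq_bot, val_none hG] at this
  simp at this

theorem Hopeless.of_edge {v u : ℕ} (hv : v ∈ G.minV) (he : (v, u) ∈ G.edges)
    (hu : G.Hopeless u) : G.Hopeless v := by
  intro σ hσ
  have := val_min_le (σ := σ) hv he
  rwa [hu σ hσ, EReal.add_bot, le_bot_iff] at this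

theorem mem_core_verts {v : ℕ} : v ∈ G.core.verts ↔ v ∈ G.verts ∧ ¬ G.Hopeless v := by
  classical
  rw [core, mem_restrict_verts, Finset.mem_filter]; tauto

theorem mem_core_maxV (hG : G.MinMoves) {v : ℕ} : v ∈ G.core.maxV ↔ v ∈ G.maxV := by
  classical
  rw [core, restrict_maxV, Finset.mem_inter, Finset.mem_filter, mem_verts]
  have := fun h => not_hopeless_of_max (v := v) hG h
  tauto

theorem mem_core_minV {v : ℕ} : v ∈ G.core.minV ↔ v ∈ G.minV ∧ ¬ G.Hopeless v := by
  classical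
  rw [core, restrict_minV, Finset.mem_inter, Finset.mem_filter, mem_verts]; tauto

theorem mem_core_edges {v u : ℕ} :
    (v, u) ∈ G.core.edges ↔ (v, u) ∈ G.edges ∧ ¬ G.Hopeless v ∧ ¬ G.Hopeless u := by
  classical
  rw [core, mem_restrict_edges, Finset.mem_filter, Finset.mem_filter]
  constructor
  · tauto
  · intro h
    have := mem_verts_of_edge h.1
    tauto

theorem mem_core_edges_of_min {v u : ℕ} (hv : v ∈ G.core.minV) (he : (v, u) ∈ G.edges) :
    (v, u) ∈ G.core.edges := by
  rw [mem_core_minV] at hv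
  exact mem_core_edges.2 ⟨he, hv.2, fun hu => hv.2 (hu.of_edge hv.1 he)⟩

theorem core_minMoves (hG : G.MinMoves) : G.core.MinMoves := by
  intro v hv
  obtain ⟨u, hu⟩ := hG v (mem_core_minV.1 hv).1
  exact ⟨u, mem_core_edges_of_min hv hu⟩

/-- From a hopeless vertex, some Min strategy leads to a nonpositive cycle without passing through
a Max vertex. -/
theorem Hopeless.exists_strategy (hG : G.MinMoves) {v : ℕ} (hv : v ∈ G.verts) (h : G.Hopeless v) :
    ∃ τ, G.IsMinStrategy τ ∧ (∀ i, τ^[i] v ∈ G.minV) ∧ ∃ k p, 0 < p ∧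
      τ^[k + p] v = τ^[k] v ∧ ∑ i ∈ Finset.Ico k (k + p), G.weight (τ^[i] v) ≤ 0 := by
  have hσ : G.IsMaxStrategy fun _ => none := fun u hu => ⟨hu, Or.inl rfl⟩
  obtain ⟨τ, hτ, hval⟩ := exists_valuation_eq_val hG hσ (isPos_some.2 hv)
  rw [h _ hσ, valuation_eq_bot] at hval
  obtain ⟨hns, k, p, hp, hc, hs⟩ := hval
  have hplay : ∀ i, G.play (fun _ => none) τ (some v) i = some (τ^[i] v) ∧ τ^[i] v ∈ G.minV := by
    have key : ∀ i, G.play (fun _ => none) τ (some v) i = some (τ^[i] v) → τ^[i] v ∈ G.minV := by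
      intro i hi
      have hpos := isPos_play hσ hτ (isPos_some.2 hv) i
      rw [hi, isPos_some] at hpos
      refine (mem_verts.1 hpos).resolve_left fun hmax => hns ⟨i + 1, ?_⟩
      rw [play_succ', hi, move_max hmax]
    intro i
    induction i with
    | zero => exact ⟨rfl, key 0 rfl⟩
    | succ i ih =>
      have : G.play (fun _ => none) τ (some v) (i + 1) = some (τ^[i + 1] v) := by
        rw [play_succ', ih.1, move_min ih.2, Function.iterate_succ_apply']
      exact ⟨this, key _ this⟩
  refine ⟨τ, hτ, fun i => (hplay i).2, k, p, hp, ?_, ?_⟩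
  · rw [(hplay _).1, (hplay _).1] at hc
    exact Option.some.inj hc
  · simpa only [(hplay _).1, weight'_some] using hs

/-- One Min strategy serves for all hopeless vertices: at each vertex, follow the individual
strategy of the least vertex whose play passes through it. The least vertex does not increase along
a play, so that in the end a single individual strategy is followed. -/
theorem exists_strategy_hopeless (hG : G.MinMoves) : ∃ (τ : ℕ → ℕ) (O : Set ℕ),
    (∀ v ∈ G.verts, G.Hopeless v → v ∈ O) ∧
    ∀ v ∈ O, v ∈ G.minV ∧ (v, τ v) ∈ G.edges ∧ τ v ∈ O ∧
      BddSums fun i => G.weight (τ^[i] v) := by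
  classical
  have hex : ∀ v, ∃ τ : ℕ → ℕ, v ∈ G.verts → G.Hopeless v →
      G.IsMinStrategy τ ∧ (∀ i, τ^[i] v ∈ G.minV) ∧ ∃ k p, 0 < p ∧
      τ^[k + p] v = τ^[k] v ∧ ∑ i ∈ Finset.Ico k (k + p), G.weight (τ^[i] v) ≤ 0 := by
    intro v
    by_cases h : v ∈ G.verts ∧ G.Hopeless v
    · obtain ⟨τ, h'⟩ := h.2.exists_strategy hG h.1
      exact ⟨τ, fun _ _ => h'⟩
    · exact ⟨id, fun h1 h2 => absurd ⟨h1, h2⟩ h⟩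
  choose s hs using hex
  let P : ℕ → ℕ → Prop := fun x v => (v ∈ G.verts ∧ G.Hopeless v) ∧ ∃ i, (s v)^[i] v = x
  let j : ℕ → ℕ := fun x => if h : ∃ v, P x v then Nat.find h else 0
  have hj : ∀ x, (∃ v, P x v) → P x (j x) := by
    intro x h
    simp only [j, dif_pos h]
    exact Nat.find_spec h
  have hjmin : ∀ x v, P x v → j x ≤ v := by
    intro x v h
    have h' : ∃ v, P x v := ⟨v, h⟩
    simp only [j, dif_pos h']
    exact Nat.find_min' h' h
  have hnext : ∀ x, (∃ v, P x v) → P (s (j x) x) (j x) := by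
    intro x h
    obtain ⟨h1, i, hi⟩ := hj x h
    exact ⟨h1, i + 1, by rw [Function.iterate_succ_apply', hi]⟩
  refine ⟨fun x => s (j x) x, {x | ∃ v, P x v}, fun v hv h => ⟨v, ⟨hv, h⟩, 0, rfl⟩, ?_⟩
  intro x hx
  have hmin : x ∈ G.minV := by
    obtain ⟨h1, i, hi⟩ := hj x hx
    rw [← hi]
    exact (hs _ h1.1 h1.2).2.1 i
  refine ⟨hmin, ?_, ⟨_, hnext x hx⟩, ?_⟩
  · obtain ⟨h1, -⟩ := hj x hx
    exact (hs _ h1.1 h1.2).1 x hmin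
  set t : ℕ → ℕ := fun x => s (j x) x with ht
  have hO : ∀ i, ∃ v, P (t^[i] x) v := by
    intro i
    induction i with
    | zero => exact hx
    | succ i ih =>
      rw [Function.iterate_succ_apply']
      exact ⟨_, hnext _ ih⟩
  have hanti : Antitone fun i => j (t^[i] x) := by
    refine antitone_nat_of_succ_le fun i => ?_
    rw [Function.iterate_succ_apply']
    exact hjmin _ _ (hnext _ (hO i))
  -- the index is constant from some time on
  obtain ⟨n, hn⟩ : ∃ n, ∀ i, n ≤ i → j (t^[i] x) = j (t^[n] x) := by
    have hwf := WellFounded.min_mem (r := (· < · : ℕ → ℕ → Prop)) wellFounded_lt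
      (Set.range fun i => j (t^[i] x)) ⟨_, 0, rfl⟩
    obtain ⟨n, hn⟩ := hwf
    refine ⟨n, fun i hi => le_antisymm (hanti hi) ?_⟩
    have := WellFounded.not_lt_min (r := (· < · : ℕ → ℕ → Prop)) wellFounded_lt
      (Set.range fun i => j (t^[i] x)) ⟨i, rfl⟩
    simp only at hn
    rw [hn]
    exact not_lt.1 this
  set a := j (t^[n] x) with ha
  obtain ⟨h1, l, hl⟩ := hj _ (hO n)
  rw [← ha] at h1 hl
  have heq : ∀ i, t^[n + i] x = (s a)^[l + i] a := by
    intro i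
    induction i with
    | zero => exact hl.symm
    | succ i ih =>
      rw [← add_assoc, ← add_assoc, Function.iterate_succ_apply', Function.iterate_succ_apply',
        ← ih]
      simp only [ht]
      rw [← ht, hn (n + i) (by omega)]
  obtain ⟨-, -, k, p, hp, hc, hsum⟩ := hs a h1.1 h1.2
  rw [← bddSums_shift _ n]
  simp only [heq]
  rw [bddSums_shift (fun i => G.weight ((s a)^[i] a)) l]
  refine bddSums_of_periodic _ k p hp (fun i hi => ?_) hsum
  rw [show i + p = (i - k) + (k + p) by omega, Function.iterate_add_apply, hc,
    ← Function.iterate_add_apply, show i - k + k = i by omega]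

/-! ### Potentials from an optimal strategy -/

/-- If no strategy has valuation `∞` anywhere, then the valuation of the best starting strategy is a
potential that bounds the weights of all plays, if Min moves suitably. -/
theorem exists_potential (hG : G.MinMoves) (hσ : G.IsStart σ)
    (hfin : ∀ χ, G.IsMaxStrategy χ → ∀ v ∈ G.verts, G.val χ (some v) < ⊤) : ∃ φ : ℕ → ℝ,
    (∀ v ∈ G.maxV, ∀ u, (v, u) ∈ G.edges → G.weight v + φ u ≤ φ v) ∧
    ∀ v ∈ G.minV, ∃ u, (v, u) ∈ G.edges ∧ G.weight v + φ u ≤ φ v := by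
  classical
  let S : Set (ℕ → Option ℕ) := {χ | G.IsStart χ ∧ ∀ v ∉ G.maxV, χ v = none}
  have hS : S.Finite := by
    refine Set.Finite.of_finite_image (f := fun (χ : ℕ → Option ℕ) (v : G.maxV) => χ v) ?_ ?_
    · refine (Set.Finite.pi (t := fun _ : G.maxV =>
        (((insert none (G.verts.image some) : Finset (Option ℕ))) : Set (Option ℕ)))
        (fun _ => Finset.finite_toSet _)).subset ?_
      rintro _ ⟨χ, hχ, rfl⟩ v -
      have := isPos_max hχ.1.1 v.2
      simp only [Finset.coe_insert, Finset.coe_image, Set.mem_insert_iff, Set.mem_image,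
        Finset.mem_coe]
      cases h : χ v with
      | none => exact Or.inl rfl
      | some u => exact Or.inr ⟨u, this u h, rfl⟩
    · intro χ hχ χ' hχ' h
      funext v
      by_cases hv : v ∈ G.maxV
      · exact congrFun h ⟨v, hv⟩
      · rw [hχ.2 v hv, hχ'.2 v hv]
  have hne : S.Nonempty := by
    refine ⟨fun v => if v ∈ G.maxV then σ v else none, ?_, fun v hv => if_neg hv⟩
    refine Improves.isStart hG hσ ⟨fun v hv => ?_, fun v hv => Or.inl (if_pos hv)⟩
    simp only [if_pos hv]
    exact hσ.1 v hv
  obtain ⟨χ, hχ, hmax⟩ := Set.exists_max_image S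
    (fun χ => ∑ v ∈ G.verts, (G.val χ (some v)).toReal) hS hne
  have hreal : ∀ v ∈ G.verts, ((G.val χ (some v)).toReal : EReal) = G.val χ (some v) := fun v hv =>
    EReal.coe_toReal (hfin χ hχ.1.1 v hv).ne (hχ.1.2 v hv).ne'
  refine ⟨fun v => (G.val χ (some v)).toReal, ?_, ?_⟩
  · intro v hv u he
    have huv := mem_verts_of_edge he
    rw [← EReal.coe_le_coe_iff, EReal.coe_add, hreal v huv.1, hreal u huv.2, val_max hv,
      ereal_coe_add_le_iff]
    by_contra hlt
    rw [not_le] at hlt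
    have himp : G.Improves χ (Function.update χ v (some u)) := by
      refine ⟨fun x hx => ?_, fun x hx => ?_⟩ <;> by_cases hxv : x = v
      · subst hxv; rw [Function.update_self]; exact ⟨hx, Or.inr ⟨u, rfl, he⟩⟩
      · rw [Function.update_of_ne hxv]; exact hχ.1.1 x hx
      · subst hxv; rw [Function.update_self]; exact Or.inr hlt
      · rw [Function.update_of_ne hxv]; exact Or.inl rfl
    have hst := himp.isStart hG hχ.1
    have hle := hmax (Function.update χ v (some u)) ⟨hst, fun x hx => by
      rw [Function.update_of_ne (fun h => hx (by rw [h]; exact hv))]; exact hχ.2 x hx⟩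
    refine absurd hle (not_le.2 (Finset.sum_lt_sum (fun x hx => ?_) ⟨v, huv.1, ?_⟩))
    · exact EReal.toReal_le_toReal (himp.val_mono hG hχ.1 (isPos_some.2 hx)) (hχ.1.2 x hx).ne'
        (hfin _ hst.1 x hx).ne
    · rw [← EReal.coe_lt_coe_iff, hreal v huv.1,
        EReal.coe_toReal (hfin _ hst.1 v huv.1).ne (hst.2 v huv.1).ne']
      refine lt_of_lt_of_le ?_ (himp.le_val hG hχ.1 hv)
      rw [val_max hv, ereal_coe_add_lt_iff, Function.update_self]
      exact hlt
  · intro v hv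
    obtain ⟨u, he, h⟩ := exists_val_min_ge hG hχ.1.1 hv
    have huv := mem_verts_of_edge he
    refine ⟨u, he, ?_⟩
    rw [← EReal.coe_le_coe_iff, EReal.coe_add, hreal v huv.1, hreal u huv.2]
    exact h

/-! ### The 0-mean partition -/

/-- No vertex can be added to those of valuation `∞` under `σ`. -/
def Final (G : Arena) (σ : ℕ → Option ℕ) : Prop :=
  (∀ v ∈ (G.rest σ).maxV, ∀ u ∈ G.topSet σ, (v, u) ∉ G.edges) ∧
  ∀ χ, (G.rest σ).IsMaxStrategy χ → ∀ v ∈ (G.rest σ).verts, (G.rest σ).val χ (some v) < ⊤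

theorem rest_isStart (hG : G.MinMoves) (hσ : G.IsStart σ) : (G.rest σ).IsStart σ := by
  refine ⟨rest_max hσ.1, fun v hv => ?_⟩
  rw [val_rest hG hσ.1 (fun _ _ => rfl) (rest_max hσ.1) (isPos_some.2 hv)]
  exact hσ.2 v (mem_rest_verts.1 hv).1

theorem gamePlay_succ (s t : ℕ → ℕ) (v i : ℕ) : G.gamePlay s t v (i + 1) =
    if G.gamePlay s t v i ∈ G.maxV then s (G.gamePlay s t v i) else t (G.gamePlay s t v i) :=
  Function.iterate_succ_apply' _ _ _

theorem gamePlay_mem {s t : ℕ → ℕ} (hs : G.IsGameMaxStrategy s) (ht : G.IsMinStrategy t) {v : ℕ}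
    (hv : v ∈ G.verts) (i : ℕ) : (G.gamePlay s t v i, G.gamePlay s t v (i + 1)) ∈ G.edges ∧
      G.gamePlay s t v i ∈ G.verts := by
  have key : ∀ i, G.gamePlay s t v i ∈ G.verts →
      (G.gamePlay s t v i, G.gamePlay s t v (i + 1)) ∈ G.edges := by
    intro i hi
    rw [gamePlay_succ]
    rcases mem_verts.1 hi with h | h
    · rw [if_pos h]; exact hs _ h
    · rw [if_neg (not_mem_maxV h)]; exact ht _ h
  induction i with
  | zero => exact ⟨key 0 hv, hv⟩
  | succ i ih =>
    have := (mem_verts_of_edge ih.1).2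
    exact ⟨key _ this, this⟩

/-- Max follows `σ` from the vertices of valuation `∞`. Plays against a positional strategy of Min
stay among these vertices, and hence repeat a positive cycle. -/
theorem exists_maxWinning (hG : G.IsMeanPayoffGame) (hσ : G.core.IsStart σ) :
    ∃ s, G.MaxWinning s (G.core.topSet σ) := by
  classical
  have hm := hG.minMoves
  have hcm := core_minMoves hm
  have hex : ∀ v, ∃ u, (v ∈ G.maxV → (v, u) ∈ G.edges) ∧
      (v ∈ G.maxV → v ∈ G.core.topSet σ → σ v = some u ∧ u ∈ G.core.topSet σ) := by
    intro v
    by_cases hv : v ∈ G.maxV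
    · by_cases ht : v ∈ G.core.topSet σ
      · obtain ⟨u, hu, h, he⟩ := topSet_max hcm hσ.1 ((mem_core_maxV hm).2 hv) ht
        exact ⟨u, fun _ => (mem_core_edges.1 he).1, fun _ _ => ⟨h, hu⟩⟩
      · obtain ⟨u, hu⟩ := hG.2 v (mem_verts.2 (Or.inl hv))
        exact ⟨u, fun _ => hu, fun _ h => absurd h ht⟩
    · exact ⟨0, fun h => absurd h hv, fun h => absurd h hv⟩
  choose s hs using hex
  refine ⟨s, fun v hv => (hs v).1 hv, fun τ hτ v hv => ?_⟩
  have hτc : G.core.IsMinStrategy τ := fun x hx =>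
    mem_core_edges_of_min hx (hτ x (mem_core_minV.1 hx).1)
  have hplay : ∀ i, G.core.play σ τ (some v) i = some (G.gamePlay s τ v i) ∧
      G.gamePlay s τ v i ∈ G.core.topSet σ := by
    intro i
    induction i with
    | zero => exact ⟨rfl, hv⟩
    | succ i ih =>
      rw [play_succ', ih.1, gamePlay_succ]
      have h1 := (mem_core_verts.1 (mem_topSet.1 ih.2).1)
      rcases mem_verts.1 h1.1 with h | h
      · obtain ⟨h2, h3⟩ := (hs _).2 h ih.2
        rw [if_pos h, move_max ((mem_core_maxV hm).2 h)]
        exact ⟨h2, h3⟩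
      · have h' : G.gamePlay s τ v i ∈ G.core.minV := mem_core_minV.2 ⟨h, h1.2⟩
        rw [if_neg (not_mem_maxV h), move_min h']
        exact ⟨rfl, topSet_min h' ih.2 (hτc _ h')⟩
  have hverts : ∀ i, G.gamePlay s τ v i ∈ G.verts := fun i =>
    (mem_core_verts.1 (mem_topSet.1 (hplay i).2).1).1
  have htop := valuation_eq_top_of_mem_topSet hcm hσ.1 (fun _ _ => rfl) hτc hv
  rw [valuation_eq_top] at htop
  obtain ⟨k, l, hkl, h⟩ : ∃ k l, k ≠ l ∧ G.gamePlay s τ v k = G.gamePlay s τ v l := by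
    obtain ⟨k, l, hkl, h⟩ := Finite.exists_ne_map_eq_of_infinite
      (fun i => (⟨G.gamePlay s τ v i, hverts i⟩ : G.verts))
    exact ⟨k, l, hkl, congrArg Subtype.val h⟩
  wlog hlt : k < l generalizing k l
  · exact this l k hkl.symm h.symm (by omega)
  have hper : G.gamePlay s τ v (k + (l - k)) = G.gamePlay s τ v k := by
    rw [show k + (l - k) = l by omega, h]
  refine payoff_pos hverts k (l - k) (by omega) ?_ ?_
  · intro n hn
    obtain ⟨n, rfl⟩ := Nat.exists_eq_add_of_le hn
    clear hn
    induction n with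
    | zero => exact hper
    | succ n ih =>
      rw [show k + (n + 1) + (l - k) = k + n + (l - k) + 1 by omega, gamePlay_succ, ih,
        ← add_assoc, gamePlay_succ]
  · by_contra hneg
    refine htop.2 ⟨k, l - k, by omega, ?_, ?_⟩
    · rw [(hplay _).1, (hplay _).1, hper]
    · simp only [(hplay _).1, weight'_some]
      exact not_lt.1 hneg

/-- On the hopeless vertices Min follows a strategy that is good for all of them, elsewhere the
moves along which the potential bounds the weights. Plays cannot move on to a vertex of valuation
`∞`, since `σ` is final. -/
theorem exists_minWinning (hG : G.IsMeanPayoffGame) (hσ : G.core.IsStart σ)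
    (hfin : G.core.Final σ) : ∃ t, G.MinWinning t (G.verts \ G.core.topSet σ) := by
  classical
  have hm := hG.minMoves
  have hcm := core_minMoves hm
  obtain ⟨t₁, O, hO, ht₁⟩ := exists_strategy_hopeless hm
  obtain ⟨φ, hmax, hmin⟩ := exists_potential (rest_minMoves hcm hσ.1) (rest_isStart hcm hσ) hfin.2
  choose! t₂ ht₂ using hmin
  obtain ⟨t₃, ht₃⟩ := hm.exists_strategy
  let t : ℕ → ℕ := fun v =>
    if v ∈ O then t₁ v else if v ∈ (G.core.rest σ).minV then t₂ v else t₃ v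
  have ht : G.IsMinStrategy t := by
    intro v hv
    by_cases h : v ∈ O
    · simpa [t, h] using (ht₁ v h).2.1
    · by_cases h' : v ∈ (G.core.rest σ).minV
      · simpa [t, h, h'] using (mem_core_edges.1 (mem_rest_edges.1 (ht₂ v h').1).1).1
      · simpa [t, h, h'] using ht₃ v hv
  refine ⟨t, ht, fun s hs v hv => ?_⟩
  obtain ⟨hv, hvt⟩ := Finset.mem_sdiff.1 hv
  set y := G.gamePlay s t v with hy
  have hmem := gamePlay_mem hs ht hv
  refine payoff_nonpos (fun n => (hmem n).2) ?_
  by_cases hent : ∃ n, y n ∈ O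
  · obtain ⟨n, hn⟩ := hent
    have h : ∀ i, y (n + i) = t₁^[i] (y n) ∧ y (n + i) ∈ O := by
      intro i
      induction i with
      | zero => exact ⟨rfl, hn⟩
      | succ i ih =>
        have h1 := ht₁ _ ih.2
        have h2 : y (n + (i + 1)) = t₁ (y (n + i)) := by
          rw [hy, ← add_assoc, gamePlay_succ, if_neg (not_mem_maxV h1.1)]
          exact if_pos ih.2
        rw [h2, Function.iterate_succ_apply', ← ih.1]
        exact ⟨rfl, h1.2.2.1⟩
    rw [← bddSums_shift _ n]
    simp only [(h _).1]
    exact (ht₁ _ hn).2.2.2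
  · push Not at hent
    have hstay : ∀ i, y i ∈ (G.core.rest σ).verts ∧
        (y i ∈ (G.core.rest σ).verts → (y i, y (i + 1)) ∈ (G.core.rest σ).edges ∧
          G.weight (y i) + φ (y (i + 1)) ≤ φ (y i)) := by
      have key : ∀ i, y i ∈ (G.core.rest σ).verts → (y i, y (i + 1)) ∈ (G.core.rest σ).edges ∧
          G.weight (y i) + φ (y (i + 1)) ≤ φ (y i) := by
        intro i hi
        rcases mem_verts.1 hi with h | h
        · have h1 := mem_rest_maxV.1 h
          have he : (y i, y (i + 1)) ∈ G.core.edges := mem_core_edges.2 ⟨(hmem i).1,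
            fun h' => hent i (hO _ (hmem i).2 h'), fun h' => hent _ (hO _ (hmem _).2 h')⟩
          have he' : (y i, y (i + 1)) ∈ (G.core.rest σ).edges :=
            mem_rest_edges.2 ⟨he, h1.2, fun h' => hfin.1 _ h _ h' he⟩
          exact ⟨he', hmax _ h _ he'⟩
        · have h1 := mem_core_minV.1 (mem_rest_minV.1 h).1
          have h2 : y (i + 1) = t₂ (y i) := by
            rw [hy, gamePlay_succ, if_neg (not_mem_maxV h1.1)]
            simp only [t]
            rw [if_neg (hent i), if_pos h]
          rw [h2]
          exact ht₂ _ h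
      intro i
      refine ⟨?_, key i⟩
      induction i with
      | zero =>
        refine mem_rest_verts.2 ⟨mem_core_verts.2 ⟨hv, fun h' => hent 0 (hO _ hv h')⟩, hvt⟩
      | succ i ih => exact (mem_verts_of_edge (key i ih).1).2
    obtain ⟨L, hL⟩ := ((G.core.rest σ).verts.image fun v => φ (y 0) - φ v).bddAbove
    refine ⟨⌈L⌉, fun n => ?_⟩
    have h1 : ((∑ i ∈ Finset.range n, G.weight (y i) : ℤ) : ℝ) ≤
        ∑ i ∈ Finset.range n, (φ (y i) - φ (y (i + 1))) := by
      push_cast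
      exact Finset.sum_le_sum fun i _ => by linarith [((hstay i).2 (hstay i).1).2]
    rw [Finset.sum_range_sub'] at h1
    have h2 := hL (Finset.mem_coe.2 (Finset.mem_image_of_mem _ (hstay n).1))
    have h3 : ((∑ i ∈ Finset.range n, G.weight (y i) : ℤ) : ℝ) ≤ (⌈L⌉ : ℝ) :=
      (h1.trans h2).trans (Int.le_ceil L)
    exact_mod_cast h3

/-- When a strategy cannot be extended to further vertices of valuation `∞`, these vertices are the
winning region of Max. -/
theorem isZeroMeanPartition_of_final (hG : G.IsMeanPayoffGame) (hσ : G.core.IsStart σ)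
    (hfin : G.core.Final σ) :
    G.IsZeroMeanPartition (G.core.topSet σ) (G.verts \ G.core.topSet σ) := by
  refine ⟨Finset.union_sdiff_of_subset fun v hv => (mem_core_verts.1 (mem_topSet.1 hv).1).1,
    Finset.disjoint_sdiff, exists_maxWinning hG hσ, exists_minWinning hG hσ hfin⟩

/-! ### Vertices of infinite valuation cannot reach the sink -/

/-- The moves from vertex to vertex when Max plays `σ`. -/
def Step (G : Arena) (σ : ℕ → Option ℕ) (v u : ℕ) : Prop :=
  (v, u) ∈ G.edges ∧ (v ∈ G.minV ∨ σ v = some u)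

/-- Some play of `σ` from `v` reaches the sink. -/
def Escapes (G : Arena) (σ : ℕ → Option ℕ) (v : ℕ) : Prop :=
  ∃ s ∈ G.maxV, σ s = none ∧ Relation.ReflTransGen (G.Step σ) v s

/-- A play that stays away from the sink has valuation `∞` against a starting strategy, since `-∞`
is excluded. So the vertices of valuation `∞` can be found by a graph search. -/
theorem mem_topSet_iff_not_escapes (hG : G.MinMoves) (hσ : G.IsStart σ) {v : ℕ}
    (hv : v ∈ G.verts) : v ∈ G.topSet σ ↔ ¬ G.Escapes σ v := by
  constructor
  · rintro ht ⟨s, hs, hns, hr⟩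
    have : ∀ y, Relation.ReflTransGen (G.Step σ) v y → y ∈ G.topSet σ := by
      intro y hr
      induction hr with
      | refl => exact ht
      | tail _ hst ih =>
        have h1 := mem_verts_of_edge hst.1
        rcases mem_verts.1 h1.1 with h | h
        · obtain ⟨u, hu, h', -⟩ := topSet_max hG hσ.1 h ih
          rcases hst.2 with h2 | h2
          · exact absurd h2 (not_mem_minV h)
          · rw [h2] at h'; rwa [Option.some.inj h']
        · exact topSet_min h ih hst.1
    have h1 := this s hr
    obtain ⟨u, -, h', -⟩ := topSet_max hG hσ.1 hs h1
    rw [hns] at h'; simp at h'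
  · intro hesc
    obtain ⟨τ, hτ, hval⟩ := exists_valuation_eq_val hG hσ.1 (isPos_some.2 hv)
    refine mem_topSet.2 ⟨hv, ?_⟩
    have hns : ¬ G.Sinks σ τ (some v) := by
      rintro ⟨k, hk⟩
      have : ∀ k x, x ∈ G.verts → G.play σ τ (some x) k = none → G.Escapes σ x := by
        intro k
        induction k with
        | zero => intro x _ h; simp [play_zero] at h
        | succ k ih =>
          intro x hx h
          rw [play_succ] at h
          rcases hmv : G.move σ τ (some x) with _ | u
          · rcases mem_verts.1 hx with h' | h'
            · rw [move_max h'] at hmv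
              exact ⟨x, h', hmv, .refl⟩
            · rw [move_min h'] at hmv; simp at hmv
          · rw [hmv] at h
            have hu : u ∈ G.verts := isPos_move hσ.1 hτ (isPos_some.2 hx) u hmv
            obtain ⟨s, hs, hns, hr⟩ := ih u hu h
            refine ⟨s, hs, hns, .head ⟨?_, ?_⟩ hr⟩
            · rcases mem_verts.1 hx with h' | h'
              · rw [move_max h'] at hmv
                rcases (hσ.1 x h').2 with h2 | ⟨z, h2, he⟩
                · rw [hmv] at h2; simp at h2
                · rw [hmv] at h2; rwa [Option.some.inj h2]
              · rw [move_min h'] at hmv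
                rw [← Option.some.inj hmv]; exact hτ x h'
            · rcases mem_verts.1 hx with h' | h'
              · rw [move_max h'] at hmv; exact Or.inr hmv
              · exact Or.inl h'
      exact hesc (this k v hv hk)
    rw [← hval]
    rcases valuation_of_not_sinks hns with h | h
    · have := hσ.2 v hv
      rw [← hval, h.1] at this
      exact absurd this (lt_irrefl _)
    · exact h.1

/-- The vertices of the preprocessed game from which the sink is reached may be determined in the
whole game. -/
theorem core_escapes_iff (hG : G.MinMoves) (hσ : G.core.IsMaxStrategy σ) {v : ℕ}
    (hv : v ∈ G.core.verts) : G.core.Escapes σ v ↔ G.Escapes σ v := by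
  have hstep : ∀ x u, x ∈ G.core.verts → (G.core.Step σ x u ↔ G.Step σ x u) := by
    intro x u hx
    have hx' := mem_core_verts.1 hx
    constructor
    · rintro ⟨h1, h2⟩
      exact ⟨(mem_core_edges.1 h1).1, h2.imp_left fun h => (mem_core_minV.1 h).1⟩
    · rintro ⟨h1, h2⟩
      rcases mem_verts.1 hx with h | h
      · have h2 := h2.resolve_left (not_mem_minV ((mem_core_maxV hG).1 h))
        refine ⟨?_, Or.inr h2⟩
        rcases (hσ x h).2 with h3 | ⟨z, h3, he⟩
        · rw [h2] at h3; simp at h3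
        · rw [h2] at h3; rwa [Option.some.inj h3]
      · exact ⟨mem_core_edges_of_min h h1, Or.inl h⟩
  constructor
  · rintro ⟨s, hs, hns, hr⟩
    refine ⟨s, (mem_core_maxV hG).1 hs, hns, Relation.ReflTransGen.mono (fun x u h => ?_) _ _ hr⟩
    exact (hstep x u (mem_verts_of_edge h.1).1).1 h
  · rintro ⟨s, hs, hns, hr⟩
    refine ⟨s, (mem_core_maxV hG).2 hs, hns, ?_⟩
    induction hr using Relation.ReflTransGen.head_induction_on with
    | refl => exact .refl
    | head h _ ih =>
      have h' := (hstep _ _ hv).2 h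
      exact .head h' (ih (mem_verts_of_edge h'.1).2)

end Arena
end StratImp

namespace StratImp
namespace Arena

variable {G : Arena} {σ ρ : ℕ → Option ℕ} {τ : ℕ → ℕ}

/-! ### Rounds of the algorithm -/

theorem Final.of_topSet_eq (h : G.Final σ) (he : G.topSet ρ = G.topSet σ) : G.Final ρ := by
  unfold Final rest at *
  rw [he]
  exact h

/-- A round in which the given algorithm runs on the remaining game. -/
theorem round_rest (hG : G.MinMoves) (hσ : G.IsStart σ) {r : List Event}
    (hrun : ImprovementRun (G.rest σ) σ r ρ)
    (hno : ∀ v ∈ (G.rest σ).maxV, ∀ u ∈ G.topSet σ, (v, u) ∉ G.edges)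
    (halt : (∃ v ∈ (G.rest σ).verts, (G.rest σ).val ρ (some v) = ⊤) ∨
      ∀ χ, (G.rest σ).IsMaxStrategy χ → ∀ v ∈ (G.rest σ).verts, (G.rest σ).val χ (some v) < ⊤) :
    ImprovementRun G σ r ρ ∧ G.IsStart ρ ∧ (∀ v ∉ (G.rest σ).maxV, ρ v = σ v) ∧
      ((G.topSet σ).card < (G.topSet ρ).card ∨ G.Final ρ) ∧ (G.Final σ → G.Final ρ) := by
  obtain ⟨h1, h2, h3⟩ := hrun.of_rest hG hσ.1 (rest_isStart hG hσ) (fun _ _ => rfl)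
  have htop : ∀ v ∈ G.topSet σ, ρ v = σ v := fun v hv => h3 v fun hv' => (mem_rest_maxV.1 hv').2 hv
  have hsub := topSet_subset_of_eqOn hG hσ.1 htop
  have hval : ∀ v ∈ (G.rest σ).verts, (G.rest σ).val ρ (some v) = G.val ρ (some v) := fun v hv =>
    val_rest hG hσ.1 htop h2.1 (isPos_some.2 hv)
  have hmax : G.IsMaxStrategy ρ := by
    intro v hv
    by_cases ht : v ∈ G.topSet σ
    · rw [htop v ht]; exact hσ.1 v hv
    · refine ⟨hv, ?_⟩
      rcases (h2.1 v (mem_rest_maxV.2 ⟨hv, ht⟩)).2 with h | ⟨u, h, he⟩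
      · exact Or.inl h
      · exact Or.inr ⟨u, h, (mem_rest_edges.1 he).1⟩
  have hstart : G.IsStart ρ := by
    refine ⟨hmax, fun v hv => ?_⟩
    by_cases ht : v ∈ G.topSet σ
    · rw [(mem_topSet.1 (hsub ht)).2]; simp
    · have hv' := mem_rest_verts.2 ⟨hv, ht⟩
      rw [← hval v hv']; exact h2.2 v hv'
  have hfin : (∀ χ, (G.rest σ).IsMaxStrategy χ → ∀ v ∈ (G.rest σ).verts,
      (G.rest σ).val χ (some v) < ⊤) → G.Final ρ := by
    intro h
    refine Final.of_topSet_eq ⟨hno, h⟩ (Finset.Subset.antisymm (fun v hv => ?_) hsub)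
    by_contra ht
    have hv' := mem_rest_verts.2 ⟨(mem_topSet.1 hv).1, ht⟩
    have := h ρ h2.1 v hv'
    rw [hval v hv', (mem_topSet.1 hv).2] at this
    exact lt_irrefl _ this
  refine ⟨h1, hstart, h3, ?_, fun h => hfin h.2⟩
  rcases halt with ⟨v, hv, h⟩ | h
  · left
    refine Finset.card_lt_card ⟨hsub, fun h' => ?_⟩
    have hv' := mem_rest_verts.1 hv
    exact hv'.2 (h' (mem_topSet.2 ⟨hv'.1, by rw [← hval v hv, h]⟩))
  · exact Or.inr (hfin h)

/-- A round in which a single edge to a vertex of valuation `∞` is switched. -/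
theorem round_switch (hG : G.MinMoves) (hσ : G.IsStart σ) {v u : ℕ} (hv : v ∈ (G.rest σ).maxV)
    (hu : u ∈ G.topSet σ) (he : (v, u) ∈ G.edges) :
    ImprovementRun G σ [Event.switch v u, Event.commit] (switchEdges σ [(v, some u)]) ∧
      G.IsStart (switchEdges σ [(v, some u)]) ∧
      (G.topSet σ).card < (G.topSet (switchEdges σ [(v, some u)])).card ∧ ¬ G.Final σ := by
  have hv' := mem_rest_maxV.1 hv
  have hvv : v ∈ G.verts := mem_verts.2 (Or.inl hv'.1)
  have hvt : ∀ w ∈ G.topSet σ, σ v ≠ some w := by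
    intro w hw h
    refine hv'.2 (mem_topSet.2 ⟨hvv, ?_⟩)
    rw [val_max hv'.1, h, (mem_topSet.1 hw).2]; simp
  have hprof : ∀ e ∈ [(v, some u)], G.Profitable σ e.1 e.2 := by
    intro e he'
    rw [List.mem_singleton] at he'
    subst he'
    refine ⟨⟨hv'.1, Or.inr ⟨u, rfl, he⟩⟩, (hvt u hu).symm, ?_⟩
    simp only
    rw [(mem_topSet.1 hu).2, lt_top_iff_ne_top]
    intro h
    refine hv'.2 (mem_topSet.2 ⟨hvv, ?_⟩)
    rw [val_max hv'.1, h]; simp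
  have himp := improves_switchEdges hσ.1 hprof
  refine ⟨.iteration [(v, some u)] (by simp) hprof (by simp) (.nil _), himp.isStart hG hσ, ?_,
    fun h => h.1 v hv u hu he⟩
  refine Finset.card_lt_card ⟨fun x hx => ?_, fun h' => hv'.2 (h' (mem_topSet.2 ⟨hvv, ?_⟩))⟩
  · have hx' := mem_topSet.1 hx
    refine mem_topSet.2 ⟨hx'.1, top_le_iff.1 ?_⟩
    exact le_of_eq_of_le hx'.2.symm (himp.val_mono hG hσ (isPos_some.2 hx'.1))
  · have := himp.le_val hG hσ hv'.1
    have hs : switchEdges σ [(v, some u)] v = some u := by simp [switchEdges]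
    rw [hs, (mem_topSet.1 hu).2, (ereal_coe_add_eq_top _ _).2 rfl] at this
    exact top_le_iff.1 this

/-! ### Detecting hopeless vertices by shortest walks -/

/-- A walk of length `k` whose vertices belong to Min. -/
def MinWalk (G : Arena) (p : ℕ → ℕ) (k : ℕ) : Prop :=
  ∀ i < k, p i ∈ G.minV ∧ p (i + 1) ∈ G.minV ∧ (p i, p (i + 1)) ∈ G.edges

/-- The scaled weights, under which a simple cycle is negative if and only if its weight is not
positive. -/
def scaled (G : Arena) (v : ℕ) : ℤ := (G.verts.card + 1) * G.weight v - 1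

/-- All entries of `d` are scaled weights of walks. -/
def DistSound (G : Arena) (d : ℕ → ℤ) : Prop :=
  ∀ v ∈ G.verts, ∃ p k, p 0 = v ∧ G.MinWalk p k ∧ d v = ∑ i ∈ Finset.range k, G.scaled (p i)

/-- The entry of `d` at `v` is at most the scaled weights of the walks from `v` of length up to
`r`. -/
def DistBelow (G : Arena) (r : ℕ) (d : ℕ → ℤ) (v : ℕ) : Prop :=
  ∀ p k, k ≤ r → p 0 = v → G.MinWalk p k → d v ≤ ∑ i ∈ Finset.range k, G.scaled (p i)

/-- Some edge from `v` shows that `d` is too large at `v`. -/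
def Relaxable (G : Arena) (d : ℕ → ℤ) (v : ℕ) : Prop :=
  v ∈ G.minV ∧ ∃ u ∈ G.minV, (v, u) ∈ G.edges ∧ G.scaled v + d u < d v

/-- A move of Min. -/
def MinStep (G : Arena) (v u : ℕ) : Prop := (v, u) ∈ G.edges ∧ v ∈ G.minV

theorem sum_scaled (s : Finset ℕ) (p : ℕ → ℕ) : ∑ i ∈ s, G.scaled (p i) =
    (G.verts.card + 1) * ∑ i ∈ s, G.weight (p i) - s.card := by
  simp [scaled, Finset.sum_sub_distrib, Finset.mul_sum]

/-- On a cycle of negative scaled weight some edge can be relaxed, whatever `d` is. -/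
theorem Hopeless.exists_relaxable (hG : G.MinMoves) {v : ℕ} (hv : v ∈ G.verts) (h : G.Hopeless v)
    (d : ℕ → ℤ) : ∃ u, G.Relaxable d u ∧ Relation.ReflTransGen G.MinStep v u := by
  obtain ⟨τ, hτ, hmin, k, p, hp, hc, hs⟩ := h.exists_strategy hG hv
  have hreach : ∀ i, Relation.ReflTransGen G.MinStep v (τ^[i] v) := by
    intro i
    induction i with
    | zero => exact .refl
    | succ i ih =>
      rw [Function.iterate_succ_apply']
      exact ih.tail ⟨hτ _ (hmin i), hmin i⟩
  by_contra hcon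
  push Not at hcon
  have hle : ∀ i, d (τ^[i] v) - d (τ^[i + 1] v) ≤ G.scaled (τ^[i] v) := by
    intro i
    have := fun h => hcon (τ^[i] v) h (hreach i)
    simp only [Relaxable, not_and, not_exists, not_lt, imp_false] at this
    have := this (hmin i) (τ^[i + 1] v) (hmin _)
      (by rw [Function.iterate_succ_apply']; exact hτ _ (hmin i))
    omega
  have h1 : ∑ i ∈ Finset.range p, (d (τ^[k + i] v) - d (τ^[k + (i + 1)] v)) ≤
      ∑ i ∈ Finset.range p, G.scaled (τ^[k + i] v) := Finset.sum_le_sum fun i _ => hle _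
  rw [Finset.sum_range_sub' (fun i => d (τ^[k + i] v)), sum_scaled, Finset.card_range, hc] at h1
  rw [Finset.sum_Ico_eq_sum_range, Nat.add_sub_cancel_left] at hs
  simp only [add_zero, sub_self] at h1
  have : (0 : ℤ) ≤ G.verts.card + 1 := by positivity
  nlinarith

/-- A simple nonpositive cycle of Min vertices makes its vertices hopeless. -/
theorem hopeless_of_cycle (hG : G.MinMoves) {p : ℕ → ℕ} {i j : ℕ} (hij : i < j)
    (hw : G.MinWalk p j) (hc : p j = p i)
    (hinj : ∀ a b, i ≤ a → a < b → b < j → p a ≠ p b)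
    (hs : ∑ l ∈ Finset.Ico i j, G.weight (p l) ≤ 0) : G.Hopeless (p i) := by
  classical
  intro σ hσ
  obtain ⟨τ₀, hτ₀⟩ := hG.exists_strategy
  have hex : ∀ x, ∃ y, (x ∈ G.minV → (x, y) ∈ G.edges) ∧
      ∀ l, i ≤ l → l < j → p l = x → y = p (l + 1) := by
    intro x
    by_cases h : ∃ l, i ≤ l ∧ l < j ∧ p l = x
    · obtain ⟨l, h1, h2, rfl⟩ := h
      refine ⟨p (l + 1), fun _ => (hw l h2).2.2, fun l' h3 h4 h5 => ?_⟩
      rcases lt_trichotomy l l' with h | h | h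
      · exact absurd h5.symm (hinj _ _ h1 h h4)
      · rw [h]
      · exact absurd h5 (hinj _ _ h3 h h2)
    · exact ⟨τ₀ x, hτ₀ x, fun l h1 h2 h3 => absurd ⟨l, h1, h2, h3⟩ h⟩
  choose τ hτ using hex
  have hplay : ∀ l, l ≤ j - i → G.play σ τ (some (p i)) l = some (p (i + l)) := by
    intro l
    induction l with
    | zero => intro _; rfl
    | succ l ih =>
      intro hl
      rw [play_succ', ih (by omega), move_min (hw _ (by omega)).1,
        (hτ _).2 (i + l) (by omega) (by omega) rfl, add_assoc]
  have hbot : G.valuation σ τ (some (p i)) = ⊥ := by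
    refine valuation_cycle_bot (p := j - i) (by omega) ?_ ?_
    · rw [hplay _ le_rfl, show i + (j - i) = j by omega, hc]
    · rw [Finset.sum_Ico_eq_sum_range] at hs
      refine le_of_eq_of_le (Finset.sum_congr rfl fun l hl => ?_) hs
      rw [hplay _ (Finset.mem_range.1 hl).le, weight'_some]
  exact le_bot_iff.1 ((val_le (fun x hx => (hτ x).1 hx) _).trans_eq hbot)

/-- From a vertex that is not hopeless, walks can be shortened by leaving out simple cycles, which
have positive scaled weight. -/
theorem MinWalk.shorten (hG : G.MinMoves) {p : ℕ → ℕ} {k : ℕ} (hw : G.MinWalk p k)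
    (hp : ¬ G.Hopeless (p 0)) : ∃ p' k', k' ≤ G.verts.card ∧ p' 0 = p 0 ∧ G.MinWalk p' k' ∧
      ∑ i ∈ Finset.range k', G.scaled (p' i) ≤ ∑ i ∈ Finset.range k, G.scaled (p i) := by
  classical
  induction k using Nat.strong_induction_on generalizing p with
  | _ k ih =>
  by_cases hk : k ≤ G.verts.card
  · exact ⟨p, k, hk, rfl, hw, le_rfl⟩
  push Not at hk
  have hmem : ∀ i < k, p i ∈ G.verts := fun i hi => mem_verts.2 (Or.inr (hw i hi).1)
  have hrep : ∃ j, j ≤ G.verts.card ∧ ∃ i < j, p i = p j := by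
    have hcard : G.verts.card < (Finset.range (G.verts.card + 1)).card := by simp
    obtain ⟨a, ha, b, hb, hab, h⟩ := Finset.exists_ne_map_eq_of_card_lt_of_maps_to hcard
      (f := p) (fun i hi => hmem i (by have := Finset.mem_range.1 hi; omega))
    rw [Finset.mem_range] at ha hb
    rcases lt_or_gt_of_ne hab with h' | h'
    · exact ⟨b, by omega, a, h', h⟩
    · exact ⟨a, by omega, b, h', h.symm⟩
  obtain ⟨hj, i, hij, hpij⟩ := Nat.find_spec hrep
  have hfirst := fun m (hm : m < Nat.find hrep) => Nat.find_min hrep hm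
  set j := Nat.find hrep
  have hnot : ∀ l ≤ i, ¬ G.Hopeless (p l) := by
    intro l
    induction l with
    | zero => intro _; exact hp
    | succ l ih =>
      intro hl h
      have := hw l (by omega)
      exact ih (by omega) (h.of_edge this.1 this.2.2)
  have hpos : 0 < ∑ l ∈ Finset.Ico i j, G.weight (p l) := by
    by_contra h
    refine hnot i le_rfl (hopeless_of_cycle hG hij (fun l hl => hw l (by omega)) hpij.symm ?_
      (not_lt.1 h))
    intro a b _ hab hb h'
    exact hfirst b hb ⟨by omega, a, hab, h'⟩
  have hpos' : 0 < ∑ l ∈ Finset.Ico i j, G.scaled (p l) := by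
    rw [sum_scaled, Nat.card_Ico]
    have h1 : ((j - i : ℕ) : ℤ) ≤ G.verts.card := by exact_mod_cast (by omega)
    have : (0 : ℤ) ≤ G.verts.card + 1 := by positivity
    nlinarith
  let q : ℕ → ℕ := fun l => if l ≤ i then p l else p (l + (j - i))
  have hq1 : ∀ l, l ≤ i → q l = p l := fun l hl => if_pos hl
  have hq2 : ∀ l, i ≤ l → q l = p (l + (j - i)) := by
    intro l hl
    rcases hl.eq_or_lt with rfl | hl
    · rw [hq1 _ le_rfl, hpij]; congr 1; omega
    · exact if_neg (by omega)
  have hqw : G.MinWalk q (k - (j - i)) := by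
    intro l hl
    rcases Nat.lt_or_ge l i with h | h
    · rw [hq1 l h.le, hq1 (l + 1) h]; exact hw l (by omega)
    · rw [hq2 l h, hq2 (l + 1) (by omega), show l + 1 + (j - i) = l + (j - i) + 1 by omega]
      exact hw _ (by omega)
  have hqs : ∑ l ∈ Finset.range (k - (j - i)), G.scaled (q l) +
      ∑ l ∈ Finset.Ico i j, G.scaled (p l) =
      ∑ l ∈ Finset.range k, G.scaled (p l) := by
    have e1 : ∑ l ∈ Finset.range (k - (j - i)), G.scaled (q l) =
        ∑ l ∈ Finset.range i, G.scaled (p l) + ∑ l ∈ Finset.Ico j k, G.scaled (p l) := by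
      rw [show k - (j - i) = i + (k - j) by omega, Finset.sum_range_add,
        Finset.sum_Ico_eq_sum_range]
      congr 1
      · exact Finset.sum_congr rfl fun l hl => by rw [hq1 l (Finset.mem_range.1 hl).le]
      · exact Finset.sum_congr rfl fun l hl => by
          rw [hq2 _ (by omega), show i + l + (j - i) = j + l by omega]
    rw [e1, Finset.range_eq_Ico, Finset.range_eq_Ico,
      ← Finset.sum_Ico_consecutive _ (Nat.zero_le j) (show j ≤ k by omega),
      ← Finset.sum_Ico_consecutive _ (Nat.zero_le i) hij.le]
    ring
  obtain ⟨p', k', h1, h2, h3, h4⟩ := ih (k - (j - i)) (by omega) hqw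
    (by rw [hq1 0 (Nat.zero_le _)]; exact hp)
  exact ⟨p', k', h1, by rw [h2, hq1 0 (Nat.zero_le _)], h3, by omega⟩

theorem MinWalk.cons {p : ℕ → ℕ} {k v : ℕ} (hw : G.MinWalk p k) (hv : v ∈ G.minV)
    (hu : p 0 ∈ G.minV) (he : (v, p 0) ∈ G.edges) :
    G.MinWalk (fun i => Nat.casesOn i v p) (k + 1) := by
  intro i hi
  cases i with
  | zero => exact ⟨hv, hu, he⟩
  | succ i => exact hw i (by omega)

theorem sum_scaled_cons (p : ℕ → ℕ) (k v : ℕ) :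
    ∑ i ∈ Finset.range (k + 1), G.scaled (Nat.casesOn i v p) =
      G.scaled v + ∑ i ∈ Finset.range k, G.scaled (p i) := by
  rw [Finset.sum_range_succ', add_comm]
  rfl

/-- After `|V|` rounds only the walks that go through a nonpositive cycle can still be improved. -/
theorem Relaxable.hopeless (hG : G.MinMoves) {d : ℕ → ℤ} (hd : G.DistSound d)
    (hd' : ∀ v ∈ G.verts, G.DistBelow G.verts.card d v) {v : ℕ} (h : G.Relaxable d v) :
    G.Hopeless v := by
  by_contra hv
  obtain ⟨hmin, u, hu, he, hlt⟩ := h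
  obtain ⟨p, k, rfl, hw, hsum⟩ := hd u (mem_verts.2 (Or.inr hu))
  obtain ⟨p', k', h1, h2, h3, h4⟩ := (hw.cons hmin hu he).shorten hG hv
  have h5 := hd' v (mem_verts.2 (Or.inr hmin)) p' k' h1 h2 h3
  rw [sum_scaled_cons] at h4
  omega

/-- After `|V|` rounds of relaxations, the hopeless vertices are those from which Min can reach a
relaxable vertex. -/
theorem hopeless_iff (hG : G.MinMoves) {d : ℕ → ℤ} (hd : G.DistSound d)
    (hd' : ∀ v ∈ G.verts, G.DistBelow G.verts.card d v) {v : ℕ} (hv : v ∈ G.verts) :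
    G.Hopeless v ↔ ∃ u, G.Relaxable d u ∧ Relation.ReflTransGen G.MinStep v u := by
  refine ⟨fun h => h.exists_relaxable hG hv d, ?_⟩
  rintro ⟨u, hu, hr⟩
  induction hr using Relation.ReflTransGen.head_induction_on with
  | refl => exact hu.hopeless hG hd hd'
  | head h _ ih => exact (ih (mem_verts_of_edge h.1).2).of_edge h.2 h.1

/-- Initially, all distances are those of empty walks. -/
theorem distSound_zero {d : ℕ → ℤ} (hd : ∀ v ∈ G.verts, d v = 0) : G.DistSound d :=
  fun v hv => ⟨fun _ => v, 0, rfl, fun i hi => absurd hi (Nat.not_lt_zero i), by simp [hd v hv]⟩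

theorem distBelow_zero {d : ℕ → ℤ} (hd : ∀ v ∈ G.verts, d v = 0) {v : ℕ} (hv : v ∈ G.verts) :
    G.DistBelow 0 d v := by
  intro p k hk _ _
  obtain rfl : k = 0 := by omega
  simp [hd v hv]

theorem DistSound.relax {d d' : ℕ → ℤ} (hd : G.DistSound d) {v u : ℕ} (hv : v ∈ G.minV)
    (hu : u ∈ G.minV) (he : (v, u) ∈ G.edges)
    (h : ∀ x ∈ G.verts, d' x = if x = v then G.scaled v + d u else d x) : G.DistSound d' := by
  intro x hx
  rw [h x hx]
  by_cases hxv : x = v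
  · subst hxv
    obtain ⟨p, k, rfl, hw, hsum⟩ := hd u (mem_verts.2 (Or.inr hu))
    exact ⟨_, _, rfl, hw.cons hv hu he, by rw [if_pos rfl, sum_scaled_cons, hsum]⟩
  · rw [if_neg hxv]; exact hd x hx

theorem DistBelow.mono {r : ℕ} {d d' : ℕ → ℤ} {v : ℕ} (h : G.DistBelow r d v) (hd : d' v ≤ d v) :
    G.DistBelow r d' v := fun p k hk hp hw => hd.trans (h p k hk hp hw)

/-- After a round in which all edges are relaxed, longer walks have been taken into account. -/
theorem DistBelow.succ {r : ℕ} {d : ℕ → ℤ} {v : ℕ} (h : G.DistBelow r d v)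
    (he : ∀ u ∈ G.minV, v ∈ G.minV → (v, u) ∈ G.edges → ∀ p k, k ≤ r → p 0 = u → G.MinWalk p k →
      d v ≤ G.scaled v + ∑ i ∈ Finset.range k, G.scaled (p i)) : G.DistBelow (r + 1) d v := by
  intro p k hk hp hw
  cases k with
  | zero => exact h p 0 (by omega) hp hw
  | succ k =>
    have h0 := hw 0 (by omega)
    rw [Finset.sum_range_succ', hp, add_comm]
    rw [hp] at h0
    exact he (p 1) h0.2.1 h0.1 h0.2.2 (fun i => p (i + 1)) k (by omega) rfl
      fun i hi => hw (i + 1) (by omega)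

end Arena
end StratImp

namespace StratImp

/-! ### Reasoning about programs -/

namespace Memory

theorem set_self (m : Memory) (a : ℕ) (i z : ℤ) : m.set a i z a = Function.update (m a) i z := by
  simp [Memory.set]

theorem set_of_ne (m : Memory) {a b : ℕ} (h : b ≠ a) (i z : ℤ) : m.set a i z b = m b := by
  simp [Memory.set, h]

end Memory

namespace Cmd

/-- The arrays to which a program may write. -/
def writes : Cmd → List ℕ
  | .skip => []
  | .assign a _ _ => [a]
  | .switch _ _ => []
  | .commit => []
  | .seq c d => c.writes ++ d.writes
  | .ite _ _ c d => c.writes ++ d.writes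
  | .loop _ _ c => c.writes

/-- Programs without loops and reports. -/
def Simple : Cmd → Prop
  | .skip => True
  | .assign _ _ _ => True
  | .switch _ _ => False
  | .commit => False
  | .seq c d => c.Simple ∧ d.Simple
  | .ite _ _ c d => c.Simple ∧ d.Simple
  | .loop _ _ _ => False

/-- The effect of a simple program. -/
def apply : Cmd → Memory → Memory
  | .assign a i e, m => m.set a (i.eval m) (e.eval m)
  | .seq c d, m => d.apply (c.apply m)
  | .ite e f c d, m => if e.eval m ≤ f.eval m then c.apply m else d.apply m
  | _, m => m

/-- A bound on the running time of a simple program. -/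
def cost : Cmd → ℕ
  | .seq c d => c.cost + d.cost
  | .ite _ _ c d => c.cost + d.cost + 1
  | _ => 1

end Cmd

theorem Exec.frame {c : Cmd} {m m' : Memory} {r : List Event} {t : ℕ} (h : Exec c m r t m') {a : ℕ}
    (ha : a ∉ c.writes) : m' a = m a := by
  induction h with
  | skip | switch | commit | loop_done => rfl
  | assign m b i e =>
    simp only [Cmd.writes, List.mem_singleton] at ha
    exact Memory.set_of_ne _ ha _ _
  | seq _ _ ih1 ih2 =>
    simp only [Cmd.writes, List.mem_append, not_or] at ha
    rw [ih2 ha.2, ih1 ha.1]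
  | ite_true _ _ ih =>
    simp only [Cmd.writes, List.mem_append, not_or] at ha
    exact ih ha.1
  | ite_false _ _ ih =>
    simp only [Cmd.writes, List.mem_append, not_or] at ha
    exact ih ha.2
  | loop_step _ _ _ ih1 ih2 =>
    rw [ih2 ha, ih1 ha]

/-- Started in the memory `m`, the program `c` halts within `T` steps; its reports and the final
memory satisfy `Q`. -/
def Halts (c : Cmd) (m : Memory) (T : ℕ) (Q : List Event → Memory → Prop) : Prop :=
  ∃ r t m', Exec c m r t m' ∧ t ≤ T ∧ Q r m'

/-- Started in the memory `m`, the program `c` halts within `T` steps without reports in a memory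
that satisfies `Q`. -/
def Ends (c : Cmd) (m : Memory) (T : ℕ) (Q : Memory → Prop) : Prop :=
  Halts c m T fun r m' => r = [] ∧ Q m'

variable {c d : Cmd} {m : Memory} {T T' : ℕ}

theorem Halts.mono {Q Q' : List Event → Memory → Prop} (h : Halts c m T Q) (hT : T ≤ T')
    (hQ : ∀ r m', Q r m' → Q' r m') : Halts c m T' Q' := by
  obtain ⟨r, t, m', h1, h2, h3⟩ := h
  exact ⟨r, t, m', h1, h2.trans hT, hQ _ _ h3⟩

theorem Halts.frame {Q : List Event → Memory → Prop} (h : Halts c m T Q) :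
    Halts c m T fun r m' => Q r m' ∧ ∀ a ∉ c.writes, m' a = m a := by
  obtain ⟨r, t, m', h1, h2, h3⟩ := h
  exact ⟨r, t, m', h1, h2, h3, fun a ha => h1.frame ha⟩

theorem Halts.seq {Q Q' : List Event → Memory → Prop} (h : Halts c m T Q)
    (hd : ∀ r m', Q r m' → Halts d m' T' fun s m'' => Q' (r ++ s) m'') :
    Halts (.seq c d) m (T + T') Q' := by
  obtain ⟨r, t, m', h1, h2, h3⟩ := h
  obtain ⟨s, u, m'', h4, h5, h6⟩ := hd r m' h3
  exact ⟨_, _, _, h1.seq h4, by omega, h6⟩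

theorem Ends.mono {Q Q' : Memory → Prop} (h : Ends c m T Q) (hT : T ≤ T')
    (hQ : ∀ m', Q m' → Q' m') : Ends c m T' Q' :=
  Halts.mono h hT fun _ _ h => ⟨h.1, hQ _ h.2⟩

theorem Ends.frame {Q : Memory → Prop} (h : Ends c m T Q) :
    Ends c m T fun m' => Q m' ∧ ∀ a ∉ c.writes, m' a = m a :=
  (Halts.frame h).mono le_rfl fun _ _ h => ⟨h.1.1, h.1.2, h.2⟩

theorem Ends.seq {Q Q' : Memory → Prop} (h : Ends c m T Q)
    (hd : ∀ m', Q m' → (∀ a ∉ c.writes, m' a = m a) → Ends d m' T' Q') :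
    Ends (.seq c d) m (T + T') Q' :=
  Halts.seq (Halts.frame h) fun r m' h => Halts.mono (hd m' h.1.2 h.2) le_rfl fun s m'' h' => by
    simp [h.1.1, h'.1, h'.2]

theorem Ends.of_simple {Q : Memory → Prop} (hc : c.Simple) (hQ : Q (c.apply m)) :
    Ends c m c.cost Q := by
  have : ∃ t, Exec c m [] t (c.apply m) ∧ t ≤ c.cost := by
    clear hQ
    induction c generalizing m with
    | skip => exact ⟨1, .skip m, le_rfl⟩
    | assign a i e => exact ⟨1, .assign m a i e, le_rfl⟩
    | switch => exact hc.elim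
    | commit => exact hc.elim
    | loop => exact hc.elim
    | seq c d ih1 ih2 =>
      obtain ⟨t, h1, h2⟩ := ih1 (m := m) hc.1
      obtain ⟨u, h3, h4⟩ := ih2 (m := c.apply m) hc.2
      exact ⟨t + u, h1.seq h3, by simp only [Cmd.cost]; omega⟩
    | ite e f c d ih1 ih2 =>
      by_cases h : e.eval m ≤ f.eval m
      · obtain ⟨t, h1, h2⟩ := ih1 (m := m) hc.1
        refine ⟨t + 1, ?_, by simp only [Cmd.cost]; omega⟩
        simp only [Cmd.apply, if_pos h]
        exact .ite_true h h1
      · obtain ⟨t, h1, h2⟩ := ih2 (m := m) hc.2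
        refine ⟨t + 1, ?_, by simp only [Cmd.cost]; omega⟩
        simp only [Cmd.apply, if_neg h]
        exact .ite_false h h1
  obtain ⟨t, h1, h2⟩ := this
  exact ⟨[], t, _, h1, h2, rfl, hQ⟩

/-- A loop halts if every iteration decreases a measure. -/
theorem Ends.loop {e f : Expr} (I : ℕ → Memory → Prop)
    (hstep : ∀ k m', I k m' → e.eval m' ≤ f.eval m' → Ends c m' T fun m'' => ∃ k' < k, I k' m'')
    {k : ℕ} (h0 : I k m) : Ends (.loop e f c) m (k * (T + 1) + 1)
      fun m' => (∃ k', I k' m') ∧ ¬ e.eval m' ≤ f.eval m' := by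
  induction k using Nat.strong_induction_on generalizing m with
  | _ k ih =>
    by_cases h : e.eval m ≤ f.eval m
    · obtain ⟨r, t, m', h1, h2, rfl, k', h3, h4⟩ := hstep k m h0 h
      obtain ⟨s, u, m'', h5, h6, rfl, h7⟩ := ih k' h3 h4
      refine ⟨_, _, _, .loop_step h h1 h5, ?_, rfl, h7⟩
      have : (k' + 1) * (T + 1) ≤ k * (T + 1) := Nat.mul_le_mul_right _ h3
      rw [Nat.succ_mul] at this
      omega
    · exact ⟨[], 1, m, .loop_done h, by omega, rfl, ⟨k, h0⟩, h⟩

/-- The content of the scalar variable `a`. -/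
abbrev Expr.var (a : ℕ) : Expr := .read a (.const 0)

/-- `for k = 0, …, n - 1 do c`, where `n` is the content of the variable `N`. -/
def forRange (k N : ℕ) (c : Cmd) : Cmd :=
  .seq (.assign k (.const 0) (.const 0))
    (.loop (.add (.var k) (.const 1)) (.var N)
      (.seq c (.assign k (.const 0) (.add (.var k) (.const 1)))))

/-- The rule for counting loops: `I i s m` holds after `i` rounds with the reports `s`. It must not
depend on the counter. -/
theorem Halts.forRange {k N n : ℕ} (hk : k ∉ c.writes) (hN : N ∉ c.writes) (hkN : N ≠ k)
    (hn : m N 0 = n) (I : ℕ → List Event → Memory → Prop)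
    (hset : ∀ i s m z, I i s m → I i s (m.set k 0 z)) (h0 : I 0 [] m)
    (hstep : ∀ i : ℕ, i < n → ∀ s m', (∀ a ∉ k :: c.writes, m' a = m a) → m' k 0 = (i : ℤ) →
      I i s m' →
      Halts c m' T fun r m'' => I (i + 1) (s ++ r) m'') :
    Halts (forRange k N c) m (n * (T + 2) + 2) (I n) := by
  set body := Cmd.seq c (.assign k (.const 0) (.add (.var k) (.const 1)))
  have key : ∀ (j i : ℕ) (s : List Event) (m' : Memory), i + j = n →
      (∀ a ∉ k :: c.writes, m' a = m a) → m' k 0 = (i : ℤ) → I i s m' →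
      ∃ r t m'', Exec (.loop (.add (.var k) (.const 1)) (.var N) body) m' r t m'' ∧
        t ≤ j * (T + 2) + 1 ∧ I n (s ++ r) m'' := by
    intro j
    induction j with
    | zero =>
      intro i s m' hij hfr hki hI
      refine ⟨[], 1, m', .loop_done ?_, by omega, ?_⟩
      · have : m' N 0 = n := by rw [hfr N (by simp [hN, hkN]), hn]
        simp only [Expr.eval, this, hki]
        omega
      · obtain rfl : i = n := by omega
        simpa using hI
    | succ j ih =>
      intro i s m' hij hfr hki hI
      have hlt : (Expr.add (.var k) (.const 1)).eval m' ≤ (Expr.var N).eval m' := by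
        have : m' N 0 = n := by rw [hfr N (by simp [hN, hkN]), hn]
        simp only [Expr.eval, this, hki]
        omega
      obtain ⟨r, t, m1, h1, h2, h3⟩ := hstep i (by omega) s m' hfr hki hI
      have h4 := Exec.assign m1 k (.const 0) (.add (.var k) (.const 1))
      have hk1 : m1 k 0 = i := by rw [h1.frame hk, hki]
      have hm : m1.set k ((Expr.const 0).eval m1) ((Expr.add (.var k) (.const 1)).eval m1) =
          m1.set k 0 ((i + 1 : ℕ) : ℤ) := by
        simp [Expr.eval, hk1]
      rw [hm] at h4
      have hfr' : ∀ a ∉ k :: c.writes, m1.set k 0 ((i + 1 : ℕ) : ℤ) a = m a := by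
        intro a ha
        have ha' : a ≠ k ∧ a ∉ c.writes := by simpa using ha
        rw [Memory.set_of_ne _ ha'.1, h1.frame ha'.2, hfr a ha]
      obtain ⟨r', t', m2, h5, h6, h7⟩ := ih (i + 1) (s ++ r) (m1.set k 0 ((i + 1 : ℕ) : ℤ))
        (by omega) hfr' (by simp [Memory.set_self]) (hset _ _ _ _ h3)
      refine ⟨_, _, m2, .loop_step hlt (h1.seq h4) h5, ?_, ?_⟩
      · rw [Nat.succ_mul]; omega
      · simpa [List.append_assoc] using h7
  obtain ⟨r, t, m', h1, h2, h3⟩ := key n 0 [] (m.set k 0 0) (by omega)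
    (fun a ha => Memory.set_of_ne _ (by simp at ha; exact ha.1) _ _) (by simp [Memory.set_self])
    (hset _ _ _ _ h0)
  exact ⟨_, _, m', (Exec.assign m k (.const 0) (.const 0)).seq h1, by omega, by simpa using h3⟩

theorem Ends.forRange {k N n : ℕ} (hk : k ∉ c.writes) (hN : N ∉ c.writes) (hkN : N ≠ k)
    (hn : m N 0 = n) (I : ℕ → Memory → Prop) (hset : ∀ i m z, I i m → I i (m.set k 0 z))
    (h0 : I 0 m)
    (hstep : ∀ i : ℕ, i < n → ∀ m', (∀ a ∉ k :: c.writes, m' a = m a) → m' k 0 = (i : ℤ) → I i m' →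
      Ends c m' T (I (i + 1))) :
    Ends (StratImp.forRange k N c) m (n * (T + 2) + 2) (I n) := by
  refine Halts.forRange hk hN hkN hn (fun i s m => s = [] ∧ I i m)
    (fun i s m z h => ⟨h.1, hset _ _ _ h.2⟩) ⟨rfl, h0⟩ ?_
  rintro i hi s m' hfr hki ⟨rfl, hI⟩
  exact (hstep i hi m' hfr hki hI).mono le_rfl fun m'' h => h

/-- The array `a` begins with the list `l`. -/
def HoldsList (a : ℤ → ℤ) (l : List ℕ) : Prop := ∀ (i : ℕ) (h : i < l.length), a i = l[i]

/-- `for x in V do c`: the list in the array `V` has length `N`, the position is counted in the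
variable `k`. -/
def forList (k N x V : ℕ) (c : Cmd) : Cmd :=
  forRange k N (.seq (.assign x (.const 0) (.read V (.var k))) c)

/-- The rule for loops over a list: `I l` holds when the elements of the initial part `l` have been
treated. -/
theorem Ends.forList {k N x V : ℕ} {l : List ℕ} (hk : k ∉ x :: c.writes) (hN : N ∉ x :: c.writes)
    (hV : V ∉ k :: x :: c.writes) (hkN : N ≠ k) (hn : m N 0 = l.length) (hl : HoldsList (m V) l)
    (I : List ℕ → Memory → Prop)
    (hset : ∀ l m a z, a = k ∨ a = x → I l m → I l (m.set a 0 z)) (h0 : I [] m)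
    (hstep : ∀ (l₁ : List ℕ) (v : ℕ) (l₂ : List ℕ), l = l₁ ++ v :: l₂ →
      ∀ m', (∀ a ∉ k :: x :: c.writes, m' a = m a) →
      m' x 0 = (v : ℤ) → I l₁ m' → Ends c m' T (I (l₁ ++ [v]))) :
    Ends (StratImp.forList k N x V c) m (l.length * (T + 3) + 2) (I l) := by
  have h := Ends.forRange (c := .seq (.assign x (.const 0) (.read V (.var k))) c) (m := m)
    (T := 1 + T) hk hN hkN hn (fun i m => I (l.take i) m)
    (fun i m z h => hset _ _ _ _ (Or.inl rfl) h) (by simpa using h0) ?_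
  · refine h.mono (Nat.add_le_add_right (Nat.mul_le_mul_left _ (by omega)) _) fun m' hm => ?_
    simpa using hm
  intro i hi m' hfr hki hI
  refine Ends.seq (Q := fun m'' => m'' = m'.set x 0 (l[i])) ?_ ?_
  · refine Ends.of_simple (c := .assign x (.const 0) (.read V (.var k))) trivial ?_
    have : m' V i = l[i] := by rw [hfr V (by simpa [Cmd.writes] using hV)]; exact hl i hi
    simp [Cmd.apply, Expr.eval, hki, this]
  · rintro m'' rfl -
    have := hstep (l.take i) l[i] (l.drop (i + 1)) (by simp) (m'.set x 0 l[i]) ?_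
      (by simp [Memory.set_self]) (hset _ _ _ _ (Or.inr rfl) hI)
    · rwa [← List.take_succ_eq_append_getElem hi] at this
    · intro a ha
      rw [Memory.set_of_ne _ (by simp at ha; tauto)]
      exact hfr a (by simpa [Cmd.writes] using ha)

/-- The arrays `a` and `b` begin with the sources and the targets of a list of edges. -/
def HoldsEdges (a b : ℤ → ℤ) (l : List (ℕ × ℕ)) : Prop :=
  ∀ (i : ℕ) (h : i < l.length), a i = l[i].1 ∧ b i = l[i].2

/-- `for (v, u) in (A, B) do c`: the list of edges in the arrays `A` and `B` has length `N`, the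
position is counted in the variable `k`. -/
def forEdges (k N v u A B : ℕ) (c : Cmd) : Cmd :=
  forRange k N (.seq (.assign v (.const 0) (.read A (.var k)))
    (.seq (.assign u (.const 0) (.read B (.var k))) c))

theorem Ends.forEdges {k N v u A B : ℕ} {l : List (ℕ × ℕ)} (hk : k ∉ v :: u :: c.writes)
    (hN : N ∉ v :: u :: c.writes) (hA : A ∉ k :: v :: u :: c.writes)
    (hB : B ∉ k :: v :: u :: c.writes) (hkN : N ≠ k) (hvu : v ≠ u) (hn : m N 0 = l.length)
    (hl : HoldsEdges (m A) (m B) l) (I : List (ℕ × ℕ) → Memory → Prop)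
    (hset : ∀ l m a z, a = k ∨ a = v ∨ a = u → I l m → I l (m.set a 0 z)) (h0 : I [] m)
    (hstep : ∀ (l₁ : List (ℕ × ℕ)) (x y : ℕ) (l₂ : List (ℕ × ℕ)), l = l₁ ++ (x, y) :: l₂ → ∀ m',
      (∀ a ∉ k :: v :: u :: c.writes, m' a = m a) → m' k 0 = (l₁.length : ℤ) →
      m' v 0 = (x : ℤ) → m' u 0 = (y : ℤ) →
      I l₁ m' → Ends c m' T (I (l₁ ++ [(x, y)]))) :
    Ends (StratImp.forEdges k N v u A B c) m (l.length * (T + 4) + 2) (I l) := by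
  have h := Ends.forRange (c := .seq (.assign v (.const 0) (.read A (.var k)))
    (.seq (.assign u (.const 0) (.read B (.var k))) c)) (m := m)
    (T := 1 + (1 + T)) hk hN hkN hn (fun i m => I (l.take i) m)
    (fun i m z h => hset _ _ _ _ (Or.inl rfl) h) (by simpa using h0) ?_
  · refine h.mono (Nat.add_le_add_right (Nat.mul_le_mul_left _ (by omega)) _) fun m' hm => ?_
    simpa using hm
  intro i hi m' hfr hki hI
  have hA' : m' A i = l[i].1 := by rw [hfr A (by simpa [Cmd.writes] using hA)]; exact (hl i hi).1
  have hB' : m' B i = l[i].2 := by rw [hfr B (by simpa [Cmd.writes] using hB)]; exact (hl i hi).2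
  have hkv : k ≠ v := by simp at hk; tauto
  have hku : k ≠ u := by simp at hk; tauto
  have hBv : B ≠ v := by simp at hB; tauto
  refine Ends.seq (Q := fun m'' => m'' = m'.set v 0 l[i].1) ?_ ?_
  · refine Ends.of_simple (c := .assign v (.const 0) (.read A (.var k))) trivial ?_
    simp [Cmd.apply, Expr.eval, hki, hA']
  rintro m'' rfl -
  refine Ends.seq (Q := fun m'' => m'' = (m'.set v 0 l[i].1).set u 0 l[i].2) ?_ ?_
  · refine Ends.of_simple (c := .assign u (.const 0) (.read B (.var k))) trivial ?_
    simp [Cmd.apply, Expr.eval, Memory.set_of_ne _ hkv, Memory.set_of_ne _ hBv, hki, hB']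
  rintro m'' rfl -
  have := hstep (l.take i) l[i].1 l[i].2 (l.drop (i + 1)) (by simp)
    ((m'.set v 0 l[i].1).set u 0 l[i].2) ?_ ?_ ?_ ?_
    (hset _ _ _ _ (Or.inr (Or.inr rfl)) (hset _ _ _ _ (Or.inr (Or.inl rfl)) hI))
  · rwa [← List.take_succ_eq_append_getElem hi] at this
  · intro a ha
    rw [Memory.set_of_ne _ (by simp at ha; tauto), Memory.set_of_ne _ (by simp at ha; tauto)]
    exact hfr a (by simpa [Cmd.writes] using ha)
  · rw [Memory.set_of_ne _ hku, Memory.set_of_ne _ hkv, hki]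
    simp [hi.le]
  · rw [Memory.set_of_ne _ hvu, Memory.set_self, Function.update_self]
  · rw [Memory.set_self, Function.update_self]

/-- A loop over distinct vertices that computes the entries of the array `A` independently. -/
theorem Ends.mapList {k N x V A : ℕ} {l : List ℕ} (hnd : l.Nodup)
    (hc : c.Simple) (hw : ∀ a ∈ c.writes, a = A) (hAx : A ≠ x) (hAk : A ≠ k) (hAN : A ≠ N)
    (hAV : A ≠ V) (hkx : k ≠ x) (hNx : N ≠ x) (hVx : V ≠ x) (hVk : V ≠ k) (hNk : N ≠ k)
    (hn : m N 0 = l.length) (hl : HoldsList (m V) l) (g : ℕ → ℤ)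
    (hstep : ∀ v ∈ l, ∀ m' : Memory, (∀ a, a ≠ A → a ≠ k → a ≠ x → m' a = m a) →
      m' A v = m A v → m' x 0 = (v : ℤ) →
      c.apply m' A v = g v ∧ ∀ j, j ≠ (v : ℤ) → c.apply m' A j = m' A j) :
    Ends (StratImp.forList k N x V c) m (l.length * (c.cost + 3) + 2)
      fun m' => ∀ v ∈ l, m' A v = g v := by
  have hmem : ∀ a, a ≠ x → a ≠ A → a ∉ x :: c.writes := fun a h1 h2 h3 =>
    (List.mem_cons.1 h3).elim h1 fun h => h2 (hw a h)
  have h := Ends.forList (m := m) (T := c.cost) (c := c) (hmem k hkx hAk.symm)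
    (hmem N hNx hAN.symm) (fun h => (List.mem_cons.1 h).elim hVk (hmem V hVx hAV.symm)) hNk hn hl
    (fun l₁ m' => (∀ v ∈ l₁, m' A v = g v) ∧ ∀ j, (∀ v ∈ l₁, j ≠ (v : ℤ)) → m' A j = m A j) ?_
    (by simp) ?_
  · exact h.mono le_rfl fun m' h => h.1
  · rintro l₁ m' a z ha hI
    have : A ≠ a := by rintro rfl; exact ha.elim hAk hAx
    rwa [Memory.set_of_ne _ this]
  · rintro l₁ v l₂ rfl m' hfr hx ⟨h1, h2⟩
    have hv : ∀ w ∈ l₁, (w : ℤ) ≠ v := by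
      intro w hw' h
      have h' : w = v := by exact_mod_cast h
      rw [List.nodup_append] at hnd
      exact hnd.2.2 w hw' v (by simp) h'
    obtain ⟨h3, h4⟩ := hstep v (by simp) m' (fun a ha hak hax => hfr a fun h =>
      (List.mem_cons.1 h).elim hak (hmem a hax ha)) (h2 v fun w hw' => (hv w hw').symm) hx
    refine Ends.of_simple hc ⟨fun w hw' => ?_, fun j hj => ?_⟩
    · rcases List.mem_append.1 hw' with h | h
      · rw [h4 w (hv w h), h1 w h]
      · rw [List.mem_singleton.1 h, h3]
    · rw [h4 j (hj v (by simp)), h2 j fun w hw' => hj w (by simp [hw'])]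

/-- A loop over edges that computes the entries of the array `D` independently. -/
theorem Ends.mapEdges {k N v u A B D : ℕ} {l : List (ℕ × ℕ)}
    (hc : c.Simple) (hw : ∀ a ∈ c.writes, a = D) (hk : k ∉ [v, u, D]) (hN : N ∉ [v, u, D])
    (hA : A ∉ [k, v, u, D]) (hB : B ∉ [k, v, u, D]) (hkN : N ≠ k) (hvu : v ≠ u) (hDv : D ≠ v)
    (hDu : D ≠ u)
    (hn : m N 0 = l.length) (hl : HoldsEdges (m A) (m B) l) (g : ℕ × ℕ → ℤ)
    (hstep : ∀ e ∈ l, ∀ m' : Memory, ∀ i : ℕ,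
      (∀ a, a ≠ D → a ≠ k → a ≠ v → a ≠ u → m' a = m a) → m' k 0 = (i : ℤ) →
      m' v 0 = (e.1 : ℤ) → m' u 0 = (e.2 : ℤ) →
      c.apply m' D i = g e ∧ ∀ j, j ≠ (i : ℤ) → c.apply m' D j = m' D j) :
    Ends (StratImp.forEdges k N v u A B c) m (l.length * (c.cost + 4) + 2)
      fun m' => ∀ (i : ℕ) (h : i < l.length), m' D i = g l[i] := by
  have hmem : ∀ a (L : List ℕ), a ∉ L ++ [D] → a ∉ L ++ c.writes := by
    intro a L h1 h2
    rcases List.mem_append.1 h2 with h | h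
    · exact h1 (by simp [h])
    · exact h1 (by simp [hw a h])
  have h := Ends.forEdges (m := m) (T := c.cost) (c := c) (hmem k [v, u] hk) (hmem N [v, u] hN)
    (hmem A [k, v, u] hA) (hmem B [k, v, u] hB) hkN hvu hn hl
    (fun l₁ m' => ∀ (i : ℕ) (h : i < l₁.length), m' D i = g l₁[i]) ?_ (by simp) ?_
  · exact h
  · rintro l₁ m' a z ha hI
    have : D ≠ a := by
      rintro rfl
      rcases ha with h | h | h
      · simp [← h] at hk
      · exact hDv h
      · exact hDu h
    rwa [Memory.set_of_ne _ this]
  · rintro l₁ x y l₂ rfl m' hfr hki hx hy hI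
    obtain ⟨h1, h2⟩ := hstep (x, y) (by simp) m' l₁.length (fun a h1 h2 h3 h4 => hfr a
      (hmem a [k, v, u] (by simp [h1, h2, h3, h4]))) hki hx hy
    refine Ends.of_simple hc fun i hi => ?_
    rcases Nat.lt_or_ge i l₁.length with h | h
    · rw [h2 i (by exact_mod_cast h.ne), hI i h, List.getElem_append_left h]
    · obtain rfl : i = l₁.length := by simp at hi; omega
      rw [h1]; simp

end StratImp

namespace StratImp

/-! ### Memory layout

The program for the whole game exchanges data with the given program through the arrays 0 to 6, and
keeps its own data in the array 7 and in arrays from a number `B` on that exceeds all arrays of the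
given program. The names `sv…` stand for scalar variables, kept in cell 0 of an array, the names
`ar…` for arrays, all relative to `B`. They are notations for numerals, so that arrays can be told
apart by evaluation.

* `svN`, `svM`, `svT`: `|V|`, `|E|` and `|V| + 1`.
* `arVert`, `arOwn`, `arWt`: the list of vertices, their owners and weights.
* `arSrc`, `arTgt`: the sources and targets in the list of edges.
* `arStr`: the current strategy.
* `arCore`, `arIn`: the sets of the vertices that are not hopeless, and of those among them at which
  the current strategy has a finite valuation.
* `arHead`, `arNext`: linked lists of the edges into each vertex.
* `arMark`, `arEn`, `arStack`, `svS`, `svP`: the marked vertices, the enabled edges, the stack and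
  its height, and the pending edge of a graph search.
* `arScl`, `arDist`: scaled weights, and the weights of the lightest walks found so far.
* `svK`, `svX`: position and vertex in a loop over the vertices.
* `svE`, `svV`, `svU`: position, source and target in a loop over the edges.
* `svR`, `svF`, `svC`: a counter of rounds, the position of an edge to be switched, and the length
  of a list under construction. -/

notation "svN" => 8
notation "svM" => 9
notation "arVert" => 10
notation "arOwn" => 11
notation "arWt" => 12
notation "arSrc" => 13
notation "arTgt" => 14
notation "arStr" => 15
notation "arCore" => 16
notation "arHead" => 17
notation "arNext" => 18
notation "arMark" => 19
notation "arStack" => 20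
notation "arEn" => 21
notation "arScl" => 22
notation "arDist" => 23
notation "arIn" => 24
notation "svK" => 25
notation "svX" => 26
notation "svE" => 27
notation "svV" => 28
notation "svU" => 29
notation "svS" => 30
notation "svP" => 31
notation "svR" => 32
notation "svF" => 33
notation "svC" => 34
notation "svT" => 35

/-- The lists of vertices and edges are stored in the arrays from `B` on. -/
structure Stored (B : ℕ) (G : Arena) (vs : List ℕ) (es : List (ℕ × ℕ)) (m : Memory) : Prop where
  nodup : vs.Nodup
  verts : vs.toFinset = G.verts
  enodup : es.Nodup
  edges : es.toFinset = G.edges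
  lengthV : m (B + svN) 0 = vs.length
  lengthE : m (B + svM) 0 = es.length
  holdsV : HoldsList (m (B + arVert)) vs
  holdsE : HoldsEdges (m (B + arSrc)) (m (B + arTgt)) es

/-- The owners and the weights of the vertices are stored in the arrays from `B` on. -/
structure StoredAttr (B : ℕ) (G : Arena) (m : Memory) : Prop where
  ownMax : ∀ v ∈ G.maxV, m (B + arOwn) v = 1
  ownMin : ∀ v ∈ G.minV, m (B + arOwn) v = 0
  wt : ∀ v ∈ G.verts, m (B + arWt) v = G.weight v

/-- A loop over the vertices. -/
def forV (B : ℕ) (c : Cmd) : Cmd := forList (B + svK) (B + svN) (B + svX) (B + arVert) c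

/-- A loop over the edges. -/
def forE (B : ℕ) (c : Cmd) : Cmd :=
  forEdges (B + svE) (B + svM) (B + svV) (B + svU) (B + arSrc) (B + arTgt) c

theorem writes_forV (B : ℕ) (c : Cmd) :
    (forV B c).writes = (B + svK) :: (B + svX) :: (c.writes ++ [B + svK]) := by
  simp [forV, forList, forRange, Cmd.writes]

theorem writes_forE (B : ℕ) (c : Cmd) :
    (forE B c).writes = (B + svE) :: (B + svV) :: (B + svU) :: (c.writes ++ [B + svE]) := by
  simp [forE, forEdges, forRange, Cmd.writes]

theorem writes_forRange (k N : ℕ) (c : Cmd) : (forRange k N c).writes = k :: (c.writes ++ [k]) := by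
  simp [forRange, Cmd.writes]

section

variable {B : ℕ} {G : Arena} {vs : List ℕ} {es : List (ℕ × ℕ)} {m m' : Memory} {c : Cmd}

theorem Stored.congr (h : Stored B G vs es m)
    (hm : ∀ a ∈ [B + svN, B + svM, B + arVert, B + arSrc, B + arTgt], m' a = m a) :
    Stored B G vs es m' where
  nodup := h.nodup
  verts := h.verts
  enodup := h.enodup
  edges := h.edges
  lengthV := by rw [hm _ (by simp), h.lengthV]
  lengthE := by rw [hm _ (by simp), h.lengthE]
  holdsV := by rw [hm _ (by simp)]; exact h.holdsV
  holdsE := by rw [hm _ (by simp), hm (B + arTgt) (by simp)]; exact h.holdsE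

theorem StoredAttr.congr (h : StoredAttr B G m) (hm : ∀ a ∈ [B + arOwn, B + arWt], m' a = m a) :
    StoredAttr B G m' where
  ownMax := by rw [hm _ (by simp)]; exact h.ownMax
  ownMin := by rw [hm _ (by simp)]; exact h.ownMin
  wt := by rw [hm (B + arWt) (by simp)]; exact h.wt

theorem Stored.mem_vs (h : Stored B G vs es m) {v : ℕ} : v ∈ vs ↔ v ∈ G.verts := by
  rw [← h.verts, List.mem_toFinset]

theorem Stored.mem_es (h : Stored B G vs es m) {e : ℕ × ℕ} : e ∈ es ↔ e ∈ G.edges := by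
  rw [← h.edges, List.mem_toFinset]

theorem Stored.length_vs (h : Stored B G vs es m) : vs.length = G.verts.card := by
  rw [← h.verts, List.toFinset_card_of_nodup h.nodup]

theorem Stored.length_es (h : Stored B G vs es m) : es.length = G.edges.card := by
  rw [← h.edges, List.toFinset_card_of_nodup h.enodup]

/-- A loop over the vertices that computes the entries of an array independently. -/
theorem Stored.mapV (h : Stored B G vs es m) (A : ℕ) (hc : c.Simple) (hw : ∀ a ∈ c.writes, a = A)
    (hA : A ∉ [B + svK, B + svX, B + svN, B + arVert]) (g : ℕ → ℤ)
    (hstep : ∀ v ∈ G.verts, ∀ m' : Memory,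
      (∀ a, a ≠ A → a ≠ B + svK → a ≠ B + svX → m' a = m a) →
      m' A v = m A v → m' (B + svX) 0 = (v : ℤ) →
      c.apply m' A v = g v ∧ ∀ j, j ≠ (v : ℤ) → c.apply m' A j = m' A j) :
    Ends (forV B c) m (vs.length * (c.cost + 3) + 2) fun m' => ∀ v ∈ G.verts, m' A v = g v := by
  simp only [List.mem_cons, not_or, List.not_mem_nil, not_false_eq_true, and_true] at hA
  exact (Ends.mapList h.nodup hc hw hA.2.1 hA.1 hA.2.2.1 hA.2.2.2 (by simp) (by simp) (by simp)
    (by simp) (by simp) h.lengthV h.holdsV g fun v hv => hstep v (h.mem_vs.1 hv)).mono le_rfl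
    fun m' hm v hv => hm v (h.mem_vs.2 hv)

/-- A loop over the edges that computes the entries of an array independently. -/
theorem Stored.mapE (h : Stored B G vs es m) (D : ℕ) (hc : c.Simple) (hw : ∀ a ∈ c.writes, a = D)
    (hD : D ∉ [B + svE, B + svV, B + svU, B + svM, B + arSrc, B + arTgt]) (g : ℕ × ℕ → ℤ)
    (hstep : ∀ e ∈ G.edges, ∀ m' : Memory, ∀ i : ℕ,
      (∀ a, a ≠ D → a ≠ B + svE → a ≠ B + svV → a ≠ B + svU → m' a = m a) →
      m' (B + svE) 0 = (i : ℤ) → m' (B + svV) 0 = (e.1 : ℤ) → m' (B + svU) 0 = (e.2 : ℤ) →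
      c.apply m' D i = g e ∧ ∀ j, j ≠ (i : ℤ) → c.apply m' D j = m' D j) :
    Ends (forE B c) m (es.length * (c.cost + 4) + 2)
      fun m' => ∀ (i : ℕ) (h : i < es.length), m' D i = g es[i] := by
  simp only [List.mem_cons, not_or, List.not_mem_nil, not_false_eq_true, and_true] at hD
  obtain ⟨h1, h2, h3, h4, h5, h6⟩ := hD
  exact Ends.mapEdges hc hw (by simp [Ne.symm h1]) (by simp [Ne.symm h4]) (by simp [Ne.symm h5])
    (by simp [Ne.symm h6]) (by simp) (by simp) h2 h3 h.lengthE h.holdsE g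
    fun e he => hstep e (h.mem_es.1 he)

end

/-! ### Copying the input -/

/-- Copy the input to the arrays from `B` on. -/
def copyCmd (B : ℕ) : Cmd :=
  .seq (.assign (B + svN) (.const 0) (.read 0 (.const 0)))
  (.seq (.assign (B + svM) (.const 0) (.read 0 (.const 1)))
  (.seq (.assign (B + svT) (.const 0) (.add (.var (B + svN)) (.const 1)))
  (.seq (forRange (B + svK) (B + svN)
    (.assign (B + arVert) (.var (B + svK)) (.read 1 (.var (B + svK)))))
  (.seq (forRange (B + svE) (B + svM)
    (.seq (.assign (B + arSrc) (.var (B + svE)) (.read 4 (.var (B + svE))))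
      (.assign (B + arTgt) (.var (B + svE)) (.read 5 (.var (B + svE))))))
  (.seq (forV B (.assign (B + arOwn) (.var (B + svX)) (.read 2 (.var (B + svX)))))
  (.seq (forV B (.assign (B + arWt) (.var (B + svX)) (.read 3 (.var (B + svX)))))
    (forV B (.assign (B + arStr) (.var (B + svX)) (.read 6 (.var (B + svX)))))))))))

/-- The strategy `σ` is stored in the arrays from `B` on. -/
def StoredStr (B : ℕ) (G : Arena) (σ : ℕ → Option ℕ) (m : Memory) : Prop :=
  ∀ v ∈ G.maxV, m (B + arStr) v = code (σ v)

theorem ends_assign {m : Memory} {a : ℕ} {i e : Expr} {Q : Memory → Prop}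
    (h : Q (m.set a (i.eval m) (e.eval m))) : Ends (.assign a i e) m 1 Q :=
  Ends.of_simple (c := .assign a i e) trivial h

theorem copyCmd_spec (B : ℕ) {G : Arena} {σ : ℕ → Option ℕ} {m : Memory} (h : Encodes m G σ) :
    ∃ vs es, Ends (copyCmd B) m (15 * vs.length + 4 * es.length + 13) fun m' =>
      Stored B G vs es m' ∧ StoredAttr B G m' ∧ StoredStr B G σ m' ∧
        m' (B + svT) 0 = (vs.length + 1 : ℕ) := by
  obtain ⟨h0, h1, ⟨vs, hvn, hvs, hv⟩, hmax, hmin, hwt, ⟨es, hen, hes, he⟩, hstr⟩ := h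
  refine ⟨vs, es, ?_⟩
  have hn : m 0 0 = vs.length := by rw [h0, ← hvs, List.toFinset_card_of_nodup hvn]
  have hm : m 0 1 = es.length := by rw [h1, ← hes, List.toFinset_card_of_nodup hen]
  refine Ends.mono (T := 1 + (1 + (1 + ((vs.length * (1 + 2) + 2) + ((es.length * (2 + 2) + 2) +
    ((vs.length * (1 + 3) + 2) + ((vs.length * (1 + 3) + 2) + (vs.length * (1 + 3) + 2)))))))) ?_
    (by omega) (fun _ h => h)
  refine Ends.seq (ends_assign (Q := fun m' => m' (B + svN) 0 = vs.length) ?_) fun m1 q1 f1 => ?_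
  · simp [Expr.eval, Memory.set_self, hn]
  simp only [Cmd.writes, List.mem_singleton] at f1
  refine Ends.seq (ends_assign (Q := fun m' => m' (B + svM) 0 = es.length) ?_) fun m2 q2 f2 => ?_
  · simp [Expr.eval, Memory.set_self, f1, hm]
  simp only [Cmd.writes, List.mem_singleton] at f2
  refine Ends.seq (ends_assign (Q := fun m' => m' (B + svT) 0 = (vs.length + 1 : ℕ)) ?_)
    fun m3 q3 f3 => ?_
  · simp [Expr.eval, Memory.set_self, f2, q1]
  simp only [Cmd.writes, List.mem_singleton] at f3
  refine Ends.seq (Q := fun m' => HoldsList (m' (B + arVert)) vs) ?_ fun m4 q4 f4 => ?_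
  · refine (Ends.forRange (n := vs.length) (T := 1) (by simp [Cmd.writes]) (by simp [Cmd.writes])
      (by simp) (by simp [f3, f2, q1]) (fun i m' => ∀ j : ℕ, j < i → m' (B + arVert) j = m 1 j) ?_
      (by simp) ?_).mono le_rfl fun m' h i hi => by rw [h i hi, hv i hi]
    · intro i m' z h
      rwa [Memory.set_of_ne _ (by simp)]
    · intro i hi m' hfr hk hI
      refine ends_assign fun j hj => ?_
      have e1 : m' 1 = m 1 := by
        rw [hfr 1 (by simp [Cmd.writes]), f3 1 (by simp), f2 1 (by simp), f1 1 (by simp)]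
      simp only [Expr.eval, hk, Memory.set_self, e1]
      rcases Nat.lt_succ_iff_lt_or_eq.1 hj with h | rfl
      · rw [Function.update_of_ne (by exact_mod_cast h.ne), hI j h]
      · rw [Function.update_self]
  simp only [Cmd.writes, writes_forRange, List.cons_append, List.nil_append, List.mem_cons, not_or,
    List.not_mem_nil, not_false_eq_true, and_true, and_imp] at f4
  refine Ends.seq (Q := fun m' => HoldsEdges (m' (B + arSrc)) (m' (B + arTgt)) es) ?_
    fun m5 q5 f5 => ?_
  · refine (Ends.forRange (n := es.length) (T := 2) (by simp [Cmd.writes]) (by simp [Cmd.writes])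
      (by simp) (by simp [f4, f3, q2]) (fun i m' => ∀ j : ℕ, j < i → m' (B + arSrc) j = m 4 j ∧
        m' (B + arTgt) j = m 5 j) ?_
      (by simp) ?_).mono le_rfl fun m' h i hi => by
        rw [(h i hi).1, (h i hi).2]; exact he i hi
    · intro i m' z h
      rwa [Memory.set_of_ne _ (by simp), Memory.set_of_ne _ (by simp)]
    · intro i hi m' hfr hk hI
      refine Ends.of_simple
        (c := .seq (.assign (B + arSrc) (.var (B + svE)) (.read 4 (.var (B + svE))))
        (.assign (B + arTgt) (.var (B + svE)) (.read 5 (.var (B + svE))))) ⟨trivial, trivial⟩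
        fun j hj => ?_
      have e1 : m' 4 = m 4 := by
        rw [hfr 4 (by simp [Cmd.writes]), f4 4 (by simp) (by simp) (by simp), f3 4 (by simp),
          f2 4 (by simp), f1 4 (by simp)]
      have e2 : m' 5 = m 5 := by
        rw [hfr 5 (by simp [Cmd.writes]), f4 5 (by simp) (by simp) (by simp), f3 5 (by simp),
          f2 5 (by simp), f1 5 (by simp)]
      simp [Cmd.apply, Expr.eval, hk, Memory.set_self, Memory.set_of_ne, e1, e2]
      rcases Nat.lt_succ_iff_lt_or_eq.1 hj with h | rfl
      · rw [Function.update_of_ne (by exact_mod_cast h.ne), Function.update_of_ne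
          (by exact_mod_cast h.ne)]
        exact hI j h
      · rw [Function.update_self, Function.update_self]
        exact ⟨rfl, rfl⟩
  simp only [Cmd.writes, writes_forRange, List.cons_append, List.nil_append, List.mem_cons, not_or,
    List.not_mem_nil, not_false_eq_true, and_true, and_imp] at f5
  have s5 : Stored B G vs es m5 := by
    refine ⟨hvn, hvs, hen, hes, ?_, ?_, ?_, q5⟩
    · simp [f5, f4, f3, f2, q1]
    · simp [f5, f4, f3, q2]
    · rw [f5 _ (by simp) (by simp) (by simp) (by simp)]; exact q4
  refine Ends.seq (s5.mapV (B + arOwn) (by simp [Cmd.Simple]) (by simp [Cmd.writes]) (by simp)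
    (fun v => m 2 v) ?_)
    fun m6 q6 f6 => ?_
  · intro v hv m' hfr _ hx
    have e1 : m' 2 = m 2 := by simp [hfr, f5, f4, f3, f2, f1]
    simp +contextual [Cmd.apply, Expr.eval, hx, Memory.set_self, e1]
  simp only [Cmd.writes, writes_forV, List.cons_append, List.nil_append, List.mem_cons, not_or,
    List.not_mem_nil, not_false_eq_true, and_true, and_imp] at f6
  have s6 : Stored B G vs es m6 := s5.congr (by simp [f6])
  refine Ends.seq (s6.mapV (B + arWt) (by simp [Cmd.Simple]) (by simp [Cmd.writes]) (by simp)
    (fun v => m 3 v) ?_)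
    fun m7 q7 f7 => ?_
  · intro v hv m' hfr _ hx
    have e1 : m' 3 = m 3 := by simp [hfr, f6, f5, f4, f3, f2, f1]
    simp +contextual [Cmd.apply, Expr.eval, hx, Memory.set_self, e1]
  simp only [Cmd.writes, writes_forV, List.cons_append, List.nil_append, List.mem_cons, not_or,
    List.not_mem_nil, not_false_eq_true, and_true, and_imp] at f7
  have s7 : Stored B G vs es m7 := s6.congr (by simp [f7])
  refine (s7.mapV (B + arStr) (by simp [Cmd.Simple]) (by simp [Cmd.writes]) (by simp)
    (fun v => m 6 v) ?_).frame.mono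
    le_rfl fun m8 ⟨q8, f8⟩ => ?_
  · intro v hv m' hfr _ hx
    have e1 : m' 6 = m 6 := by simp [hfr, f7, f6, f5, f4, f3, f2, f1]
    simp +contextual [Cmd.apply, Expr.eval, hx, Memory.set_self, e1]
  simp only [Cmd.writes, writes_forV, List.cons_append, List.nil_append, List.mem_cons, not_or,
    List.not_mem_nil, not_false_eq_true, and_true, and_imp] at f8
  have hmx : ∀ v ∈ G.maxV, v ∈ G.verts := fun v hv => Arena.mem_verts.2 (Or.inl hv)
  have hmn : ∀ v ∈ G.minV, v ∈ G.verts := fun v hv => Arena.mem_verts.2 (Or.inr hv)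
  refine ⟨s7.congr (by simp [f8]), ⟨fun v hv => ?_, fun v hv => ?_, fun v hv => ?_⟩,
    fun v hv => ?_, ?_⟩
  · simp [f8, f7, q6 v (hmx v hv), hmax v hv]
  · simp [f8, f7, q6 v (hmn v hv), hmin v hv]
  · simp [f8, q7 v hv, hwt v hv]
  · rw [q8 v (hmx v hv), hstr v hv]
  · simp [f8, f7, f6, f5, f4, q3]

end StratImp

namespace StratImp

/-! ### Finding relaxable vertices -/

namespace Arena

variable {G : Arena}

/-- The edge `(x, y)` shows that `d` is too large at `x`. -/
def RelaxEdge (G : Arena) (d : ℕ → ℤ) (x y : ℕ) : Prop :=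
  x ∈ G.minV ∧ y ∈ G.minV ∧ G.scaled x + d y < d x

/-- The state of a round of relaxations after the edges in `l`: walks of length up to `r`, and walks
of length up to `r + 1` that begin with an edge in `l`, have been taken into account. -/
structure RelaxRound (G : Arena) (r : ℕ) (l : List (ℕ × ℕ)) (d : ℕ → ℤ) : Prop where
  sound : G.DistSound d
  below : ∀ v ∈ G.verts, G.DistBelow r d v
  edge : ∀ x y, (x, y) ∈ l → x ∈ G.minV → y ∈ G.minV → ∀ p k, k ≤ r → p 0 = y → G.MinWalk p k →
    d x ≤ G.scaled x + ∑ i ∈ Finset.range k, G.scaled (p i)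

open Classical in
theorem RelaxRound.step {r : ℕ} {l : List (ℕ × ℕ)} {d d' : ℕ → ℤ} (h : G.RelaxRound r l d)
    {x y : ℕ} (he : (x, y) ∈ G.edges)
    (hd : ∀ v ∈ G.verts, d' v = if v = x ∧ G.RelaxEdge d x y then G.scaled x + d y else d v) :
    G.RelaxRound r (l ++ [(x, y)]) d' := by
  have hxy := mem_verts_of_edge he
  have hle : ∀ v ∈ G.verts, d' v ≤ d v := by
    intro v hv
    rw [hd v hv]
    split_ifs with h'
    · obtain ⟨rfl, h1⟩ := h'
      exact h1.2.2.le
    · exact le_rfl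
  refine ⟨?_, fun v hv => (h.below v hv).mono (hle v hv), ?_⟩
  · by_cases hr : G.RelaxEdge d x y
    · exact h.sound.relax hr.1 hr.2.1 he fun v hv => by rw [hd v hv]; simp [hr]
    · intro v hv
      rw [hd v hv]
      simpa [hr] using h.sound v hv
  · intro a b hab ha hb p k hk hp hw
    rcases List.mem_append.1 hab with h' | h'
    · exact (hle a (mem_verts.2 (Or.inr ha))).trans (h.edge a b h' ha hb p k hk hp hw)
    · obtain ⟨rfl, rfl⟩ := Prod.mk.inj (List.mem_singleton.1 h')
      have h1 := h.below _ hxy.2 p k hk hp hw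
      by_cases hr : G.RelaxEdge d a b
      · rw [hd a hxy.1, if_pos ⟨rfl, hr⟩]; omega
      · have h2 := hle a hxy.1
        have h3 : d a ≤ G.scaled a + d b := by
          by_contra h3
          exact hr ⟨ha, hb, not_le.1 h3⟩
        omega

theorem RelaxRound.next {r : ℕ} {l : List (ℕ × ℕ)} {d : ℕ → ℤ} (h : G.RelaxRound r l d)
    (hl : ∀ e ∈ G.edges, e ∈ l) : G.RelaxRound (r + 1) [] d where
  sound := h.sound
  below v hv := (h.below v hv).succ fun u hu hv he p k hk hp hw =>
    h.edge v u (hl _ he) hv hu p k hk hp hw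
  edge x y hl := by simp at hl

theorem relaxRound_zero {d : ℕ → ℤ} (hd : ∀ v ∈ G.verts, d v = 0) : G.RelaxRound 0 [] d where
  sound := distSound_zero hd
  below _ hv := distBelow_zero hd hv
  edge x y hl := by simp at hl

end Arena

open Arena

variable {B : ℕ} {G : Arena} {vs : List ℕ} {es : List (ℕ × ℕ)} {m m' : Memory} {c : Cmd}

/-- Compute the scaled weights. -/
def scaleCmd (B : ℕ) : Cmd :=
  .seq (forV B (.assign (B + arScl) (.var (B + svX)) (.const (-1))))
    (forRange (B + svR) (B + svT) (forV B (.assign (B + arScl) (.var (B + svX))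
      (.add (.read (B + arScl) (.var (B + svX))) (.read (B + arWt) (.var (B + svX)))))))

theorem scaleCmd_spec (h : Stored B G vs es m) (ha : StoredAttr B G m)
    (ht : m (B + svT) 0 = (vs.length + 1 : ℕ)) :
    Ends (scaleCmd B) m ((vs.length * 4 + 2) + ((vs.length + 1) * (vs.length * 4 + 4) + 2))
      fun m' => ∀ v ∈ G.verts, m' (B + arScl) v = G.scaled v := by
  refine Ends.seq (h.mapV (B + arScl) (by simp [Cmd.Simple]) (by simp [Cmd.writes]) (by simp)
    (fun v => -1) ?_) fun m1 q1 f1 => ?_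
  · intro v hv m' hfr _ hx
    simp +contextual [Cmd.apply, Expr.eval, hx, Memory.set_self]
  simp only [writes_forV, Cmd.writes, List.cons_append, List.nil_append] at f1
  have h1 : Stored B G vs es m1 := h.congr (by simp [f1])
  refine (Ends.forRange (n := vs.length + 1) (T := vs.length * 4 + 2)
    (by simp [writes_forV, Cmd.writes]) (by simp [writes_forV, Cmd.writes]) (by simp)
    (by simp [f1, ht]) (fun i m' => ∀ v ∈ G.verts, m' (B + arScl) v = i * G.weight v - 1) ?_
    (by simpa using q1) ?_).mono (le_of_eq (by ring)) fun m' hm v hv => ?_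
  · intro i m' z hm
    simpa [Memory.set_of_ne] using hm
  · intro i hi m' hfr _ hI
    have h' : Stored B G vs es m' := h1.congr (by simp [hfr, writes_forV, Cmd.writes])
    refine (h'.mapV (B + arScl) (by simp [Cmd.Simple]) (by simp [Cmd.writes]) (by simp)
      (fun v => (i + 1 : ℕ) * G.weight v - 1) ?_)
    intro v hv m'' hfr' hs hx
    have hw : m'' (B + arWt) v = G.weight v := by
      rw [hfr' _ (by simp) (by simp) (by simp), hfr _ (by simp [writes_forV, Cmd.writes]),
        f1 _ (by simp), ha.wt v hv]
    simp +contextual [Cmd.apply, Expr.eval, hx, Memory.set_self, hs, hI v hv, hw]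
    ring
  · rw [hm v hv, scaled, h.length_vs]
    push_cast
    ring

/-- Do `c` if the current edge can be relaxed. -/
def ifRelax (B : ℕ) (c : Cmd) : Cmd :=
  .ite (.add (.read (B + arOwn) (.var (B + svV))) (.read (B + arOwn) (.var (B + svU)))) (.const 0)
    (.ite (.add (.add (.read (B + arScl) (.var (B + svV))) (.read (B + arDist) (.var (B + svU))))
      (.const 1)) (.read (B + arDist) (.var (B + svV))) c .skip) .skip

open Classical in
/-- The scaled weights are integers, so that the test with an added 1 is a strict inequality. -/
theorem apply_ifRelax (ha : StoredAttr B G m)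
    (hs : ∀ v ∈ G.verts, m (B + arScl) v = G.scaled v) {x y : ℕ} (he : (x, y) ∈ G.edges)
    (hx : m (B + svV) 0 = (x : ℤ)) (hy : m (B + svU) 0 = (y : ℤ)) : (ifRelax B c).apply m =
      if G.RelaxEdge (fun v => m (B + arDist) v) x y then c.apply m else m := by
  have hxy := mem_verts_of_edge he
  simp only [ifRelax, Cmd.apply, Expr.eval, hx, hy, hs x hxy.1]
  rcases mem_verts.1 hxy.1 with h1 | h1
  · have : ¬ G.RelaxEdge (fun v => m (B + arDist) v) x y := fun h => not_mem_minV h1 h.1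
    rw [if_neg this, if_neg]
    rw [ha.ownMax x h1]
    rcases mem_verts.1 hxy.2 with h2 | h2
    · rw [ha.ownMax y h2]; norm_num
    · rw [ha.ownMin y h2]; norm_num
  rcases mem_verts.1 hxy.2 with h2 | h2
  · have : ¬ G.RelaxEdge (fun v => m (B + arDist) v) x y := fun h => not_mem_minV h2 h.2.1
    rw [if_neg this, if_neg]
    rw [ha.ownMin x h1, ha.ownMax y h2]; norm_num
  · rw [ha.ownMin x h1, ha.ownMin y h2, if_pos (by norm_num)]
    refine if_congr ?_ rfl rfl
    simp [RelaxEdge, h1, h2]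

/-- Compute shortest walks by rounds of relaxations. -/
def relaxCmd (B : ℕ) : Cmd :=
  .seq (forV B (.assign (B + arDist) (.var (B + svX)) (.const 0)))
    (forRange (B + svR) (B + svN) (forE B (ifRelax B (.assign (B + arDist) (.var (B + svV))
      (.add (.read (B + arScl) (.var (B + svV))) (.read (B + arDist) (.var (B + svU))))))))

theorem relaxCmd_spec (h : Stored B G vs es m) (ha : StoredAttr B G m)
    (hs : ∀ v ∈ G.verts, m (B + arScl) v = G.scaled v) :
    Ends (relaxCmd B) m ((vs.length * 4 + 2) + (vs.length * (es.length * 9 + 4) + 2))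
      fun m' => G.RelaxRound vs.length [] fun v => m' (B + arDist) v := by
  refine Ends.seq (h.mapV (B + arDist) (by simp [Cmd.Simple]) (by simp [Cmd.writes]) (by simp)
    (fun v => 0) ?_) fun m1 q1 f1 => ?_
  · intro v hv m' hfr _ hx
    simp +contextual [Cmd.apply, Expr.eval, hx, Memory.set_self]
  simp only [writes_forV, Cmd.writes, List.cons_append, List.nil_append] at f1
  have h1 : Stored B G vs es m1 := h.congr (by simp [f1])
  refine (Ends.forRange (n := vs.length) (T := es.length * 9 + 2)
    (by simp [writes_forE, Cmd.writes, ifRelax]) (by simp [writes_forE, Cmd.writes, ifRelax])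
    (by simp) (by simp [f1, h.lengthV])
    (fun i m' => G.RelaxRound i [] fun v => m' (B + arDist) v) ?_
    (relaxRound_zero q1) ?_).mono (le_of_eq (by ring)) fun m' hm => hm
  · intro i m' z hm
    simpa [Memory.set_of_ne] using hm
  intro i hi m' hfr _ hI
  simp only [writes_forE, Cmd.writes, ifRelax, List.cons_append, List.nil_append,
    List.append_nil] at hfr
  have h' : Stored B G vs es m' := h1.congr (by simp [hfr])
  refine (Ends.forEdges (T := 5) (by simp [Cmd.writes, ifRelax]) (by simp [Cmd.writes, ifRelax])
    (by simp [Cmd.writes, ifRelax]) (by simp [Cmd.writes, ifRelax]) (by simp) (by simp)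
    h'.lengthE h'.holdsE (fun l m' => G.RelaxRound i l fun v => m' (B + arDist) v)
    ?_ hI ?_).mono (by omega) fun m'' hm => hm.next fun e he => h.mem_es.2 he
  · rintro l m' a z (rfl | rfl | rfl) hm <;> simpa [Memory.set_of_ne] using hm
  rintro l₁ x y l₂ hl m'' hfr'' hk hx hy hI''
  simp only [Cmd.writes, ifRelax, List.append_nil] at hfr''
  have he : (x, y) ∈ G.edges := h.mem_es.1 (by simp [hl])
  have ha'' : StoredAttr B G m'' := ha.congr (by simp [hfr'', hfr, f1])
  have hs'' : ∀ v ∈ G.verts, m'' (B + arScl) v = G.scaled v := by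
    simpa [hfr'', hfr, f1] using hs
  refine (Ends.of_simple (c := ifRelax B _) (by simp [ifRelax, Cmd.Simple]) ?_).mono
    (by simp [ifRelax, Cmd.cost]) fun _ h => h
  refine hI''.step he fun v hv => ?_
  rw [apply_ifRelax ha'' hs'' he hx hy]
  by_cases hr : G.RelaxEdge (fun v => m'' (B + arDist) v) x y
  · rw [if_pos hr]
    by_cases hvx : v = x
    · subst hvx
      simp [Cmd.apply, Expr.eval, hx, hy, hr, Memory.set_self, hs'' v hv]
    · simp [Cmd.apply, Expr.eval, hx, hy, hr, Memory.set_self, hvx]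
  · simp [hr]

/-- Mark the relaxable vertices. -/
def markRelaxCmd (B : ℕ) : Cmd :=
  .seq (forV B (.assign (B + arMark) (.var (B + svX)) (.const 0)))
    (forE B (ifRelax B (.assign (B + arMark) (.var (B + svV)) (.const 1))))

open Classical in
theorem markRelaxCmd_spec (h : Stored B G vs es m) (ha : StoredAttr B G m)
    (hs : ∀ v ∈ G.verts, m (B + arScl) v = G.scaled v) :
    Ends (markRelaxCmd B) m ((vs.length * 4 + 2) + (es.length * 9 + 2))
      fun m' => ∀ v ∈ G.verts, m' (B + arMark) v =
        if G.Relaxable (fun v => m (B + arDist) v) v then 1 else 0 := by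
  refine Ends.seq (h.mapV (B + arMark) (by simp [Cmd.Simple]) (by simp [Cmd.writes]) (by simp)
    (fun v => 0) ?_) fun m1 q1 f1 => ?_
  · intro v hv m' hfr _ hx
    simp +contextual [Cmd.apply, Expr.eval, hx, Memory.set_self]
  simp only [writes_forV, Cmd.writes, List.cons_append, List.nil_append] at f1
  have h1 : Stored B G vs es m1 := h.congr (by simp [f1])
  refine (Ends.forEdges (T := 5) (by simp [Cmd.writes, ifRelax]) (by simp [Cmd.writes, ifRelax])
    (by simp [Cmd.writes, ifRelax]) (by simp [Cmd.writes, ifRelax]) (by simp) (by simp)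
    h1.lengthE h1.holdsE (fun l m' => ∀ v ∈ G.verts, m' (B + arMark) v =
        if ∃ u, (v, u) ∈ l ∧ G.RelaxEdge (fun v => m (B + arDist) v) v u then 1 else 0)
    ?_ (by simpa using q1) ?_).mono (by omega) fun m'' hm v hv => ?_
  · rintro l m' a z (rfl | rfl | rfl) hm <;> simpa [Memory.set_of_ne] using hm
  · rintro l₁ x y l₂ hl m'' hfr'' hk hx hy hI''
    simp only [Cmd.writes, ifRelax, List.append_nil] at hfr''
    have he : (x, y) ∈ G.edges := h.mem_es.1 (by simp [hl])
    have ha'' : StoredAttr B G m'' := ha.congr (by simp [hfr'', f1])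
    have hs'' : ∀ v ∈ G.verts, m'' (B + arScl) v = G.scaled v := by
      simpa [hfr'', f1] using hs
    refine (Ends.of_simple (c := ifRelax B _) (by simp [ifRelax, Cmd.Simple]) ?_).mono
      (by simp [ifRelax, Cmd.cost]) fun _ h => h
    intro v hv
    have hd : m'' (B + arDist) = m (B + arDist) := by simp [hfr'', f1]
    rw [apply_ifRelax ha'' hs'' he hx hy, hd]
    have hlist : (∃ u, (v, u) ∈ l₁ ++ [(x, y)] ∧ G.RelaxEdge (fun v => m (B + arDist) v) v u) ↔
        (∃ u, (v, u) ∈ l₁ ∧ G.RelaxEdge (fun v => m (B + arDist) v) v u) ∨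
          (v = x ∧ G.RelaxEdge (fun v => m (B + arDist) v) x y) := by
      simp only [List.mem_append, List.mem_singleton, Prod.mk.injEq]
      constructor
      · rintro ⟨u, h1 | ⟨rfl, rfl⟩, h2⟩
        · exact Or.inl ⟨u, h1, h2⟩
        · exact Or.inr ⟨rfl, h2⟩
      · rintro (⟨u, h1, h2⟩ | ⟨rfl, h2⟩)
        · exact ⟨u, Or.inl h1, h2⟩
        · exact ⟨y, Or.inr ⟨rfl, rfl⟩, h2⟩
    by_cases hr : G.RelaxEdge (fun v => m (B + arDist) v) x y
    · rw [if_pos hr]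
      by_cases hvx : v = x
      · rw [if_pos (hlist.2 (Or.inr ⟨hvx, hr⟩))]
        simp [Cmd.apply, Expr.eval, hx, Memory.set_self, hvx]
      · rw [if_congr (hlist.trans (or_iff_left fun h => hvx h.1)) rfl rfl, ← hI'' v hv]
        simp [Cmd.apply, Expr.eval, hx, Memory.set_self, hvx]
    · rw [if_neg hr, if_congr (hlist.trans (or_iff_left fun h => hr h.2)) rfl rfl, ← hI'' v hv]
  · rw [hm v hv]
    refine if_congr ⟨?_, ?_⟩ rfl rfl
    · rintro ⟨u, hu, hr⟩
      exact ⟨hr.1, u, hr.2.1, h.mem_es.1 hu, hr.2.2⟩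
    · rintro ⟨h1, u, h2, h3, h4⟩
      exact ⟨u, h.mem_es.2 h3, h1, h2, h4⟩

end StratImp

namespace StratImp

open Arena

variable {B : ℕ} {G : Arena} {vs : List ℕ} {es : List (ℕ × ℕ)} {m m' : Memory} {c : Cmd}

/-! ### Lists of incoming edges -/

/-- The linked list with links `nx` that starts at `e` has the entries `l`; its end is `-1`. -/
def Chain (nx : ℤ → ℤ) : ℤ → List ℕ → Prop
  | e, [] => e = -1
  | e, i :: l => e = i ∧ Chain nx (nx i) l

/-- The positions, among the first `k` edges, of the edges into `x`. -/
def inEdges (es : List (ℕ × ℕ)) (x : ℕ) : ℕ → List ℕ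
  | 0 => []
  | k + 1 => if (es[k]?).map Prod.snd = some x then k :: inEdges es x k else inEdges es x k

theorem mem_inEdges {x k i : ℕ} :
    i ∈ inEdges es x k ↔ i < k ∧ (es[i]?).map Prod.snd = some x := by
  induction k with
  | zero => simp [inEdges]
  | succ k ih =>
    rw [inEdges]
    split_ifs with h
    · rw [List.mem_cons, ih]
      constructor
      · rintro (rfl | h')
        · exact ⟨by omega, h⟩
        · exact ⟨by omega, h'.2⟩
      · rintro ⟨h1, h2⟩
        rcases Nat.lt_succ_iff_lt_or_eq.1 h1 with h' | h'
        · exact Or.inr ⟨h', h2⟩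
        · exact Or.inl h'
    · rw [ih]
      constructor
      · rintro ⟨h1, h2⟩
        exact ⟨by omega, h2⟩
      · rintro ⟨h1, h2⟩
        refine ⟨?_, h2⟩
        rcases Nat.lt_succ_iff_lt_or_eq.1 h1 with h' | h'
        · exact h'
        · subst h'; exact absurd h2 h

/-- Every edge is in only one of the lists. This is what makes the search linear in the size of the
graph. -/
theorem sum_length_inEdges_le (s : Finset ℕ) (k : ℕ) :
    ∑ x ∈ s, (inEdges es x k).length ≤ k := by
  induction k with
  | zero => simp [inEdges]
  | succ k ih =>
    have h1 : ∀ x, (inEdges es x (k + 1)).length =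
        (inEdges es x k).length + if (es[k]?).map Prod.snd = some x then 1 else 0 := by
      intro x
      rw [inEdges]
      split_ifs <;> simp
    simp only [h1, Finset.sum_add_distrib]
    have h2 : ∑ x ∈ s, (if (es[k]?).map Prod.snd = some x then 1 else 0) ≤ 1 := by
      rw [Finset.sum_boole, Nat.cast_id, Finset.card_le_one]
      intro a ha b hb
      simp only [Finset.mem_filter] at ha hb
      exact Option.some.inj (ha.2.symm.trans hb.2)
    omega

theorem Chain.update {nx : ℤ → ℤ} {e : ℤ} {l : List ℕ} (h : Chain nx e l) {k : ℕ} (z : ℤ)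
    (hl : ∀ i ∈ l, i < k) : Chain (Function.update nx k z) e l := by
  induction l generalizing e with
  | nil => exact h
  | cons i l ih =>
    have hi : (i : ℤ) ≠ k := by exact_mod_cast (hl i (by simp)).ne
    refine ⟨h.1, ?_⟩
    rw [Function.update_of_ne hi]
    exact ih h.2 fun j hj => hl j (by simp [hj])

/-- The linked lists of the edges into each vertex are stored in the arrays from `B` on. -/
def Linked (B : ℕ) (G : Arena) (es : List (ℕ × ℕ)) (m : Memory) : Prop :=
  ∀ x ∈ G.verts, Chain (m (B + arNext)) (m (B + arHead) x) (inEdges es x es.length)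

/-- Link the edges into each vertex. -/
def linkCmd (B : ℕ) : Cmd :=
  .seq (forV B (.assign (B + arHead) (.var (B + svX)) (.const (-1))))
    (forE B (.seq (.assign (B + arNext) (.var (B + svE)) (.read (B + arHead) (.var (B + svU))))
      (.assign (B + arHead) (.var (B + svU)) (.var (B + svE)))))

theorem linkCmd_spec (h : Stored B G vs es m) :
    Ends (linkCmd B) m ((vs.length * 4 + 2) + (es.length * 6 + 2)) (Linked B G es) := by
  refine Ends.seq (h.mapV (B + arHead) (by simp [Cmd.Simple]) (by simp [Cmd.writes]) (by simp)
    (fun v => -1) ?_) fun m1 q1 f1 => ?_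
  · intro v hv m' hfr _ hx
    simp +contextual [Cmd.apply, Expr.eval, hx, Memory.set_self]
  simp only [writes_forV, Cmd.writes, List.cons_append, List.nil_append] at f1
  have h1 : Stored B G vs es m1 := h.congr (by simp [f1])
  refine (Ends.forEdges (T := 2) (by simp [Cmd.writes]) (by simp [Cmd.writes])
    (by simp [Cmd.writes]) (by simp [Cmd.writes]) (by simp) (by simp)
    h1.lengthE h1.holdsE (fun l m' => ∀ x ∈ G.verts,
      Chain (m' (B + arNext)) (m' (B + arHead) x) (inEdges es x l.length))
    ?_ (by simpa [inEdges, Chain] using q1) ?_).mono le_rfl fun m'' hm => hm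
  · rintro l m' a z (rfl | rfl | rfl) hm <;> simpa [Memory.set_of_ne] using hm
  · rintro l₁ x y l₂ hl m' hfr hk hx hy hI
    refine Ends.of_simple (c := .seq (.assign (B + arNext) (.var (B + svE))
      (.read (B + arHead) (.var (B + svU)))) (.assign (B + arHead) (.var (B + svU))
      (.var (B + svE)))) (by simp [Cmd.Simple]) fun v hv => ?_
    have hk' : es[l₁.length]? = some (x, y) := by simp [hl]
    have hlt : ∀ i ∈ inEdges es v l₁.length, i < l₁.length := fun i hi => (mem_inEdges.1 hi).1
    simp only [Cmd.apply, Expr.eval, hk, hy, Memory.set_self, Memory.set_of_ne, ne_eq,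
      Nat.add_right_inj, Nat.reduceEqDiff, not_false_eq_true, List.length_append,
      List.length_singleton, inEdges, hk', Option.map_some, Option.some.injEq]
    by_cases hvy : y = v
    · subst hvy
      rw [if_pos rfl, Function.update_self]
      refine ⟨rfl, ?_⟩
      rw [Function.update_self]
      exact (hI y hv).update _ hlt
    · rw [if_neg hvy, Function.update_of_ne (by exact_mod_cast Ne.symm hvy)]
      exact (hI v hv).update _ hlt

/-! ### Graph search -/

/-- The part of a step of the search that follows an edge backward: its source is marked, and put
on the stack, if this has not been done yet and if the edge is enabled. -/
def followCmd (B : ℕ) : Cmd :=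
  .seq (.ite (.const 2) (.add (.read (B + arEn) (.var (B + svP)))
      (.sub (.const 1) (.read (B + arMark) (.read (B + arSrc) (.var (B + svP))))))
    (.seq (.assign (B + arMark) (.read (B + arSrc) (.var (B + svP))) (.const 1))
      (.seq (.assign (B + arStack) (.var (B + svS)) (.read (B + arSrc) (.var (B + svP))))
        (.assign (B + svS) (.const 0) (.add (.var (B + svS)) (.const 1)))))
    .skip)
  (.assign (B + svP) (.const 0) (.read (B + arNext) (.var (B + svP))))

/-- The part of a step of the search that takes a vertex from the stack. -/
def popCmd (B : ℕ) : Cmd :=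
  .seq (.assign (B + svS) (.const 0) (.sub (.var (B + svS)) (.const 1)))
    (.assign (B + svP) (.const 0)
      (.read (B + arHead) (.read (B + arStack) (.var (B + svS)))))

/-- Put the marked vertices on the stack. -/
def pushCmd (B : ℕ) : Cmd :=
  .seq (.assign (B + svS) (.const 0) (.const 0))
    (forV B (.ite (.const 1) (.read (B + arMark) (.var (B + svX)))
      (.seq (.assign (B + arStack) (.var (B + svS)) (.var (B + svX)))
        (.assign (B + svS) (.const 0) (.add (.var (B + svS)) (.const 1)))) .skip))

/-- Mark all vertices from which a marked vertex can be reached along enabled edges. -/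
def searchCmd (B : ℕ) : Cmd :=
  .seq (pushCmd B) (.seq (.assign (B + svP) (.const 0) (.const (-1)))
    (.loop (.const 0) (.add (.var (B + svP)) (.var (B + svS)))
      (.ite (.const 0) (.var (B + svP)) (followCmd B) (popCmd B))))

theorem HoldsList.push {a : ℤ → ℤ} {l : List ℕ} (h : HoldsList a l) (x : ℕ) :
    HoldsList (Function.update a l.length x) (l ++ [x]) := by
  intro i hi
  rcases Nat.lt_or_ge i l.length with h' | h'
  · rw [Function.update_of_ne (by exact_mod_cast h'.ne), List.getElem_append_left h', h i h']
  · obtain rfl : i = l.length := by simp at hi; omega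
    simp

theorem HoldsList.init {a : ℤ → ℤ} {l : List ℕ} {x : ℕ} (h : HoldsList a (l ++ [x])) :
    HoldsList a l ∧ a l.length = x := by
  refine ⟨fun i hi => ?_, ?_⟩
  · rw [h i (by simp; omega), List.getElem_append_left hi]
  · rw [h l.length (by simp)]; simp

open Classical in
theorem pushCmd_spec (h : Stored B G vs es m) {P : ℕ → Prop}
    (hm : ∀ v ∈ G.verts, m (B + arMark) v = if P v then 1 else 0) :
    Ends (pushCmd B) m (1 + (vs.length * 7 + 2)) fun m' => ∃ stk : List ℕ, stk.Nodup ∧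
      (∀ v, v ∈ stk ↔ v ∈ G.verts ∧ P v) ∧ HoldsList (m' (B + arStack)) stk ∧
      m' (B + svS) 0 = stk.length := by
  refine Ends.seq (ends_assign (Q := fun m' => m' (B + svS) 0 = 0) ?_) fun m1 q1 f1 => ?_
  · simp [Expr.eval, Memory.set_self]
  simp only [Cmd.writes] at f1
  have h1 : Stored B G vs es m1 := h.congr (by simp [f1])
  refine (Ends.forList (T := 4) (by simp [Cmd.writes]) (by simp [Cmd.writes]) (by simp [Cmd.writes])
    (by simp) h1.lengthV h1.holdsV (fun l m' =>
      HoldsList (m' (B + arStack)) (l.filter (fun x => P x)) ∧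
      m' (B + svS) 0 = (l.filter (fun x => P x)).length) ?_ ?_ ?_).mono le_rfl fun m' hI => ?_
  · rintro l m' a z (rfl | rfl) hm <;> simpa [Memory.set_of_ne] using hm
  · exact ⟨fun i hi => by simp at hi, by simpa using q1⟩
  · rintro l₁ v l₂ hl m' hfr hx ⟨hI1, hI2⟩
    refine Ends.of_simple (c := .ite (.const 1) (.read (B + arMark) (.var (B + svX)))
      (.seq (.assign (B + arStack) (.var (B + svS)) (.var (B + svX)))
        (.assign (B + svS) (.const 0) (.add (.var (B + svS)) (.const 1)))) .skip)
      (by simp [Cmd.Simple]) ?_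
    have hv : v ∈ G.verts := h.mem_vs.1 (by simp [hl])
    have hmk : m' (B + arMark) v = if P v then 1 else 0 := by
      rw [hfr _ (by simp [Cmd.writes]), f1 _ (by simp), hm v hv]
    by_cases hP : P v
    · rw [if_pos hP] at hmk
      have := hI1.push v
      simp only [List.filter_append]
      simpa [Cmd.apply, Expr.eval, hx, hmk, Memory.set_self, Memory.set_of_ne, hI2, hP] using this
    · rw [if_neg hP] at hmk
      simp only [List.filter_append]
      simpa [Cmd.apply, Expr.eval, hx, hmk, hP] using ⟨hI1, hI2⟩
  · refine ⟨_, h.nodup.filter _, fun v => ?_, hI.1, hI.2⟩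
    simp [List.mem_filter, h.mem_vs]

/-- The state of the search: `D` contains the vertices that have been taken from the stack `stk`,
and `pend` the positions of the edges into the last of them that are yet to be followed. The number
`k` bounds the number of steps to come. -/
structure SearchState (B : ℕ) (G : Arena) (es : List (ℕ × ℕ)) (P : ℕ × ℕ → Prop) (S : ℕ → Prop)
    (k : ℕ) (D : Finset ℕ) (stk pend : List ℕ) (m : Memory) : Prop where
  nodup : stk.Nodup
  disj : ∀ v ∈ stk, v ∈ G.verts ∧ v ∉ D
  sub : D ⊆ G.verts
  holds : HoldsList (m (B + arStack)) stk
  len : m (B + svS) 0 = stk.length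
  chain : Chain (m (B + arNext)) (m (B + svP) 0) pend
  pend_tgt : ∀ i ∈ pend, ∃ h : i < es.length, es[i].2 ∈ D
  mark : ∀ v ∈ G.verts, (v ∈ D ∨ v ∈ stk → m (B + arMark) v = 1) ∧
    (¬ (v ∈ D ∨ v ∈ stk) → m (B + arMark) v = 0)
  sound : ∀ v, v ∈ D ∨ v ∈ stk → ∃ s, S s ∧
    Relation.ReflTransGen (fun v u => (v, u) ∈ G.edges ∧ P (v, u)) v s
  base : ∀ v ∈ G.verts, S v → v ∈ D ∨ v ∈ stk
  closed : ∀ (i : ℕ) (h : i < es.length), P es[i] → es[i].2 ∈ D →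
    (es[i].1 ∈ D ∨ es[i].1 ∈ stk) ∨ i ∈ pend
  measure : pend.length + ∑ x ∈ G.verts \ D, (1 + (inEdges es x es.length).length) = k

variable {P : ℕ × ℕ → Prop} {S : ℕ → Prop} {k : ℕ} {D : Finset ℕ} {stk pend : List ℕ}

/-- Following the next pending edge preserves the state and uses up one step. -/
theorem SearchState.follow {i : ℕ} (hs : SearchState B G es P S k D stk (i :: pend) m)
    (h : Stored B G vs es m)
    (hen : ∀ (i : ℕ) (h : i < es.length), (P es[i] → m (B + arEn) i = 1) ∧
      (¬ P es[i] → m (B + arEn) i = 0)) :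
    m (B + svP) 0 = i ∧
    ∃ stk', SearchState B G es P S (k - 1) D stk' pend ((followCmd B).apply m) := by
  have hP : m (B + svP) 0 = i := hs.chain.1
  refine ⟨hP, ?_⟩
  obtain ⟨hi, htgt⟩ := hs.pend_tgt i (by simp)
  have hsrc : m (B + arSrc) i = es[i].1 := (h.holdsE i hi).1
  have hx : es[i].1 ∈ G.verts := (mem_verts_of_edge (h.mem_es.1 (List.getElem_mem hi))).1
  have hmeas : pend.length + ∑ x ∈ G.verts \ D, (1 + (inEdges es x es.length).length) = k - 1 := by
    have := hs.measure
    simp only [List.length_cons] at this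
    omega
  by_cases hnew : P es[i] ∧ ¬ (es[i].1 ∈ D ∨ es[i].1 ∈ stk)
  · have hmk := (hs.mark _ hx).2 hnew.2
    have hap : (followCmd B).apply m = (((m.set (B + arMark) es[i].1 1).set (B + arStack) stk.length
        es[i].1).set (B + svS) 0 (stk.length + 1)).set (B + svP) 0 (m (B + arNext) i) := by
      simp [followCmd, Cmd.apply, Expr.eval, hP, hsrc, hmk, (hen i hi).1 hnew.1, Memory.set_of_ne,
        hs.len]
    rw [hap]
    have hnot := not_or.1 hnew.2
    refine ⟨stk ++ [es[i].1], ?_, ?_, hs.sub, ?_, ?_, ?_, fun j hj => hs.pend_tgt j (by simp [hj]),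
      ?_, ?_, ?_, ?_, hmeas⟩
    · rw [List.nodup_append]
      refine ⟨hs.nodup, by simp, ?_⟩
      rintro a ha b hb rfl
      exact hnot.2 (by rwa [← List.mem_singleton.1 hb])
    · intro v hv
      rcases List.mem_append.1 hv with h' | h'
      · exact hs.disj v h'
      · rw [List.mem_singleton.1 h']; exact ⟨hx, hnot.1⟩
    · simpa [Memory.set_of_ne, Memory.set_self] using hs.holds.push es[i].1
    · simp [Memory.set_of_ne, Memory.set_self]
    · simpa [Memory.set_of_ne, Memory.set_self] using hs.chain.2
    · intro v hv
      by_cases hvx : v = es[i].1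
      · simp [Memory.set_of_ne, Memory.set_self, hvx]
      · have := hs.mark v hv
        simpa [Memory.set_of_ne, Memory.set_self, hvx] using this
    · intro v hv
      by_cases hvx : v = es[i].1
      · obtain ⟨s, hs1, hs2⟩ := hs.sound _ (Or.inl htgt)
        exact ⟨s, hs1, .head ⟨by rw [hvx]; exact h.mem_es.1 (List.getElem_mem hi),
          by rw [hvx]; exact hnew.1⟩ hs2⟩
      · exact hs.sound v (by simpa [hvx] using hv)
    · intro v hv hS
      rcases hs.base v hv hS with h' | h'
      · exact Or.inl h'
      · exact Or.inr (by simp [h'])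
    · intro j hj hPj hD
      rcases hs.closed j hj hPj hD with (h' | h') | h'
      · exact Or.inl (Or.inl h')
      · exact Or.inl (Or.inr (by simp [h']))
      · rcases List.mem_cons.1 h' with rfl | h'
        · exact Or.inl (Or.inr (by simp))
        · exact Or.inr h'
  · have hap : (followCmd B).apply m = m.set (B + svP) 0 (m (B + arNext) i) := by
      have : ¬ (2 : ℤ) ≤ m (B + arEn) i + (1 - m (B + arMark) es[i].1) := by
        by_cases hPi : P es[i]
        · have h1 := (hs.mark _ hx).1 (by_contra fun h' => hnew ⟨hPi, h'⟩)
          rw [h1, (hen i hi).1 hPi]; norm_num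
        · rw [(hen i hi).2 hPi]
          by_cases hv : es[i].1 ∈ D ∨ es[i].1 ∈ stk
          · rw [(hs.mark _ hx).1 hv]; norm_num
          · rw [(hs.mark _ hx).2 hv]; norm_num
      simp [followCmd, Cmd.apply, Expr.eval, hP, hsrc, this]
    rw [hap]
    refine ⟨stk, hs.nodup, hs.disj, hs.sub, ?_, ?_, ?_, fun j hj => hs.pend_tgt j (by simp [hj]),
      ?_, hs.sound, hs.base, ?_, hmeas⟩
    · simpa [Memory.set_of_ne] using hs.holds
    · simpa [Memory.set_of_ne] using hs.len
    · simpa [Memory.set_of_ne, Memory.set_self] using hs.chain.2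
    · simpa [Memory.set_of_ne] using hs.mark
    · intro j hj hPj hD
      rcases hs.closed j hj hPj hD with h' | h'
      · exact Or.inl h'
      · rcases List.mem_cons.1 h' with rfl | h'
        · exact Or.inl (by_contra fun h' => hnew ⟨hPj, h'⟩)
        · exact Or.inr h'

/-- Taking a vertex from the stack preserves the state and uses up one step: the edges into this
vertex become pending, and the measure has already counted them. -/
theorem SearchState.pop {x : ℕ} (hs : SearchState B G es P S k D (stk ++ [x]) [] m)
    (hl : Linked B G es m) :
    SearchState B G es P S (k - 1) (insert x D) stk (inEdges es x es.length)
      ((popCmd B).apply m) ∧ 0 < k := by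
  obtain ⟨h1, h2⟩ := hs.holds.init
  obtain ⟨hx, hxD⟩ := hs.disj x (by simp)
  have hlen : m (B + svS) 0 - 1 = stk.length := by rw [hs.len]; simp
  have hap : (popCmd B).apply m = (m.set (B + svS) 0 stk.length).set (B + svP) 0
      (m (B + arHead) x) := by
    simp [popCmd, Cmd.apply, Expr.eval, hlen, Memory.set_of_ne, Memory.set_self, h2]
  obtain ⟨hn1, -, hn2⟩ := List.nodup_append.1 hs.nodup
  have hxs : x ∉ stk := fun h => hn2 x h x (by simp) rfl
  have hor : ∀ v, (v ∈ insert x D ∨ v ∈ stk) ↔ (v ∈ D ∨ v ∈ stk ++ [x]) := by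
    intro v
    simp only [Finset.mem_insert, List.mem_append, List.mem_singleton]
    tauto
  have hmem : ∀ i ∈ inEdges es x es.length, ∃ h : i < es.length, es[i].2 = x := by
    intro i hi
    obtain ⟨h3, h4⟩ := mem_inEdges.1 hi
    exact ⟨h3, by simpa [List.getElem?_eq_getElem h3] using h4⟩
  have hm := hs.measure
  rw [← Finset.sum_erase_add _ _ (Finset.mem_sdiff.2 ⟨hx, hxD⟩),
    ← Finset.sdiff_insert] at hm
  rw [hap]
  refine ⟨⟨hn1, ?_, ?_, ?_, ?_, ?_, ?_, ?_, ?_, ?_, ?_, ?_⟩, ?_⟩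
  · intro v hv
    obtain ⟨h3, h4⟩ := hs.disj v (by simp [hv])
    refine ⟨h3, fun h5 => ?_⟩
    rcases Finset.mem_insert.1 h5 with rfl | h5
    · exact hxs hv
    · exact h4 h5
  · exact Finset.insert_subset hx hs.sub
  · simpa [Memory.set_of_ne] using h1
  · simp [Memory.set_of_ne, Memory.set_self]
  · simpa [Memory.set_of_ne, Memory.set_self] using hl x hx
  · intro i hi
    obtain ⟨h3, h4⟩ := hmem i hi
    exact ⟨h3, by simp [h4]⟩
  · intro v hv
    rw [hor]
    simpa [Memory.set_of_ne] using hs.mark v hv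
  · intro v hv
    exact hs.sound v ((hor v).1 hv)
  · intro v hv hS
    exact (hor v).2 (hs.base v hv hS)
  · intro i hi hPi hD
    rw [hor]
    rcases Finset.mem_insert.1 hD with h3 | h3
    · exact Or.inr (mem_inEdges.2 ⟨hi, by simp [List.getElem?_eq_getElem hi, h3]⟩)
    · rcases hs.closed i hi hPi h3 with h4 | h4
      · exact Or.inl h4
      · simp at h4
  · simp only [List.length_nil] at hm
    omega
  · omega

open Classical in
/-- The search marks the vertices from which a vertex marked at the start can be reached along
enabled edges, in time linear in the size of the graph, since every vertex is put on the stack at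
most once and every edge is followed at most once. -/
theorem searchCmd_spec (h : Stored B G vs es m) (hl : Linked B G es m)
    (hen : ∀ (i : ℕ) (h : i < es.length), (P es[i] → m (B + arEn) i = 1) ∧
      (¬ P es[i] → m (B + arEn) i = 0))
    (hm : ∀ v ∈ G.verts, m (B + arMark) v = if S v then 1 else 0) :
    Ends (searchCmd B) m (17 * vs.length + 10 * es.length + 5) fun m' =>
      ∀ v ∈ G.verts, m' (B + arMark) v = if ∃ s ∈ G.verts, S s ∧
        Relation.ReflTransGen (fun v u => (v, u) ∈ G.edges ∧ P (v, u)) v s then 1 else 0 := by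
  set R : ℕ → ℕ → Prop := fun v u => (v, u) ∈ G.edges ∧ P (v, u)
  refine Ends.mono (T := (1 + (vs.length * 7 + 2)) + (1 + ((vs.length + es.length) * (9 + 1) + 1)))
    (Ends.seq (pushCmd_spec h hm) fun m1 q1 f1 => ?_) (by omega) fun m' hm' => hm'
  obtain ⟨stk, hnd, hstk, hholds, hlen⟩ := q1
  simp only [pushCmd, writes_forV, Cmd.writes, List.cons_append, List.nil_append] at f1
  refine Ends.seq (ends_assign (Q := fun m2 => m2 = m1.set (B + svP) 0 (-1)) rfl) ?_
  rintro m2 rfl -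
  set m2 := m1.set (B + svP) 0 (-1) with hm2
  have f2 : ∀ a, a ≠ B + svP → m2 a = m1 a := fun a ha => Memory.set_of_ne _ ha _ _
  have h2 : Stored B G vs es m2 := h.congr (by simp [f2, f1])
  have hl2 : Linked B G es m2 := by simpa [Linked, f2, f1] using hl
  have hen2 : ∀ (i : ℕ) (h : i < es.length), (P es[i] → m2 (B + arEn) i = 1) ∧
      (¬ P es[i] → m2 (B + arEn) i = 0) := by simpa [f2, f1] using hen
  have hP2 : m2 (B + svP) 0 = -1 := by simp [hm2, Memory.set_self]
  have h0 : SearchState B G es P (fun s => s ∈ G.verts ∧ S s)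
      (∑ x ∈ G.verts, (1 + (inEdges es x es.length).length)) ∅ stk [] m2 := by
    refine ⟨hnd, fun v hv => ⟨((hstk v).1 hv).1, by simp⟩, by simp, ?_, ?_, hP2, by simp, ?_, ?_,
      fun v hv hS => Or.inr ((hstk v).2 hS), by simp, by simp⟩
    · simpa [f2] using hholds
    · simpa [f2] using hlen
    · intro v hv
      have hmk : m2 (B + arMark) v = if S v then 1 else 0 := by simpa [f2, f1] using hm v hv
      have : v ∈ stk ↔ S v := by simp [hstk, hv]
      simp +contextual [hmk, this]
    · intro v hv
      exact ⟨v, (hstk v).1 (by simpa using hv), .refl⟩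
  have hk : ∑ x ∈ G.verts, (1 + (inEdges es x es.length).length) ≤ vs.length + es.length := by
    rw [Finset.sum_add_distrib, h.length_vs, ← Finset.card_eq_sum_ones]
    exact Nat.add_le_add_left (sum_length_inEdges_le _ _) _
  refine (Ends.loop (T := 9) (fun k m' => (∃ D stk pend,
    SearchState B G es P (fun s => s ∈ G.verts ∧ S s) k D stk pend m') ∧
    ∀ a ∉ [B + arMark, B + arStack, B + svS, B + svP], m' a = m2 a) ?_
    ⟨⟨_, _, _, h0⟩, fun _ _ => rfl⟩).mono ?_ ?_
  · rintro k m' ⟨⟨D, stk, pend, hs⟩, hfr⟩ htest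
    have hs' : Stored B G vs es m' := h2.congr (by simp [hfr])
    have hl' : Linked B G es m' := by simpa [Linked, hfr] using hl2
    have hen' : ∀ (i : ℕ) (h : i < es.length), (P es[i] → m' (B + arEn) i = 1) ∧
        (¬ P es[i] → m' (B + arEn) i = 0) := by simpa [hfr] using hen2
    have hfr' : ∀ {c : Cmd}, c.Simple → (∀ a ∈ c.writes, a ∈ [B + arMark, B + arStack, B + svS,
        B + svP]) → ∀ a ∉ [B + arMark, B + arStack, B + svS, B + svP], c.apply m' a = m2 a := by
      intro c hc hw a ha
      obtain ⟨r, t, m'', h1, -, -, h3⟩ := (Ends.of_simple (Q := fun m'' => m'' = c.apply m') hc rfl)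
      rw [← h3, h1.frame fun h' => ha (hw a h'), hfr a ha]
    refine Ends.of_simple (c := .ite (.const 0) (.var (B + svP)) (followCmd B) (popCmd B))
      (by simp [Cmd.Simple, followCmd, popCmd]) ?_
    cases pend with
    | cons i pend =>
      obtain ⟨h3, stk', h4⟩ := hs.follow hs' hen'
      have h5 : (Expr.const 0).eval m' ≤ (Expr.var (B + svP)).eval m' := by simp [Expr.eval, h3]
      have h6 := hs.measure
      simp only [List.length_cons] at h6
      refine ⟨k - 1, by omega, ?_⟩
      rw [Cmd.apply, if_pos h5]
      exact ⟨⟨_, _, _, h4⟩,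
        hfr' (by simp [followCmd, Cmd.Simple]) (by simp [followCmd, Cmd.writes])⟩
    | nil =>
      have h3 : m' (B + svP) 0 = -1 := hs.chain
      rcases List.eq_nil_or_concat stk with rfl | ⟨stk', x, hx⟩
      · have h4 := hs.len
        simp [Expr.eval, h3, h4] at htest
      · rw [List.concat_eq_append] at hx
        subst hx
        obtain ⟨h4, h5⟩ := hs.pop hl'
        refine ⟨k - 1, by omega, ?_⟩
        rw [Cmd.apply, if_neg (by simp [Expr.eval, h3])]
        exact ⟨⟨_, _, _, h4⟩, hfr' (by simp [popCmd, Cmd.Simple]) (by simp [popCmd, Cmd.writes])⟩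
  · exact Nat.add_le_add_right (Nat.mul_le_mul_right _ hk) 1
  · rintro m' ⟨⟨k, ⟨D, stk, pend, hs⟩, hfr⟩, htest⟩ v hv
    have hl4 := hs.len
    cases pend with
    | cons i pend =>
      have h3 : m' (B + svP) 0 = i := hs.chain.1
      exact absurd (by simp only [Expr.eval, h3, hl4]; positivity) htest
    | nil =>
      have h3 : m' (B + svP) 0 = -1 := hs.chain
      obtain rfl : stk = [] := by
        cases stk with
        | nil => rfl
        | cons x l =>
          refine absurd ?_ htest
          simp [Expr.eval, h3, hl4]
      have hcl : ∀ {v s : ℕ}, Relation.ReflTransGen R v s → s ∈ D → v ∈ D := by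
        intro v s hvs hsD
        induction hvs using Relation.ReflTransGen.head_induction_on with
        | refl => exact hsD
        | head hab _ ih =>
          obtain ⟨i, hi, he⟩ := List.getElem_of_mem (h.mem_es.2 hab.1)
          have := hs.closed i hi (by rw [he]; exact hab.2) (by rw [he]; exact ih)
          simpa [he] using this
      by_cases hD : v ∈ D
      · obtain ⟨s, h5, h6⟩ := hs.sound v (Or.inl hD)
        rw [if_pos ⟨s, h5.1, h5.2, h6⟩, (hs.mark v hv).1 (Or.inl hD)]
      · rw [if_neg, (hs.mark v hv).2 (by simp [hD])]
        rintro ⟨s, h5, h6, h7⟩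
        exact hD (hcl h7 (by simpa using hs.base s h5 ⟨h5, h6⟩))

end StratImp

namespace StratImp

open Arena

variable {B : ℕ} {G : Arena} {vs : List ℕ} {es : List (ℕ × ℕ)} {m m' : Memory} {c : Cmd}
  {σ ρ : ℕ → Option ℕ}

/-! ### Preprocessing -/

/-- The array `a` stores the indicator function of a set of vertices. -/
def StoredSet (G : Arena) (a : ℤ → ℤ) (U : Finset ℕ) : Prop :=
  ∀ v ∈ G.verts, a v = if v ∈ U then 1 else 0

theorem StoredAttr.own_le_zero (ha : StoredAttr B G m) {v : ℕ} (hv : v ∈ G.verts) :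
    m (B + arOwn) v ≤ 0 ↔ v ∈ G.minV := by
  rcases mem_verts.1 hv with h | h
  · simp [ha.ownMax v h, not_mem_minV h]
  · simp [ha.ownMin v h, h]

/-- Compute the set of the vertices that are not hopeless, and the lists of incoming edges. -/
def prepCmd (B : ℕ) : Cmd :=
  .seq (scaleCmd B) (.seq (relaxCmd B) (.seq (markRelaxCmd B) (.seq (linkCmd B)
    (.seq (forE B (.ite (.read (B + arOwn) (.var (B + svV))) (.const 0)
      (.assign (B + arEn) (.var (B + svE)) (.const 1))
      (.assign (B + arEn) (.var (B + svE)) (.const 0))))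
    (.seq (searchCmd B) (forV B (.assign (B + arCore) (.var (B + svX))
      (.sub (.const 1) (.read (B + arMark) (.var (B + svX)))))))))))

theorem writes_prepCmd (B : ℕ) : ∀ a ∈ [B + svN, B + svM, B + svT, B + arVert, B + arSrc, B + arTgt,
    B + arOwn, B + arWt, B + arStr], a ∉ (prepCmd B).writes := by
  simp [prepCmd, scaleCmd, relaxCmd, markRelaxCmd, ifRelax, linkCmd, searchCmd, pushCmd, followCmd,
    popCmd, writes_forV, writes_forE, writes_forRange, Cmd.writes]

theorem prepCmd_spec (hG : G.MinMoves) (h : Stored B G vs es m) (ha : StoredAttr B G m)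
    (ht : m (B + svT) 0 = (vs.length + 1 : ℕ)) :
    Ends (prepCmd B) m (4 * vs.length * vs.length + 9 * vs.length * es.length + 49 * vs.length +
      32 * es.length + 30) fun m' =>
      Linked B G es m' ∧ StoredSet G (m' (B + arCore)) G.core.verts := by
  classical
  refine Ends.mono (T := ((vs.length * 4 + 2) + ((vs.length + 1) * (vs.length * 4 + 4) + 2)) +
    (((vs.length * 4 + 2) + (vs.length * (es.length * 9 + 4) + 2)) +
    (((vs.length * 4 + 2) + (es.length * 9 + 2)) + (((vs.length * 4 + 2) + (es.length * 6 + 2)) +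
    ((es.length * (3 + 4) + 2) + ((17 * vs.length + 10 * es.length + 5) +
    (vs.length * (1 + 3) + 2))))))) ?_ (by nlinarith) fun _ h => h
  refine Ends.seq (scaleCmd_spec h ha ht) fun m1 q1 f1 => ?_
  simp only [scaleCmd, writes_forV, writes_forRange, Cmd.writes, List.cons_append,
    List.nil_append] at f1
  have h1 : Stored B G vs es m1 := h.congr (by simp [f1])
  have ha1 : StoredAttr B G m1 := ha.congr (by simp [f1])
  refine Ends.seq (relaxCmd_spec h1 ha1 q1) fun m2 q2 f2 => ?_
  simp only [relaxCmd, ifRelax, writes_forV, writes_forE, writes_forRange, Cmd.writes,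
    List.cons_append, List.nil_append, List.append_nil] at f2
  have h2 : Stored B G vs es m2 := h1.congr (by simp [f2])
  have ha2 : StoredAttr B G m2 := ha1.congr (by simp [f2])
  refine Ends.seq (markRelaxCmd_spec h2 ha2 (by simpa [f2] using q1)) fun m3 q3 f3 => ?_
  simp only [markRelaxCmd, ifRelax, writes_forV, writes_forE, Cmd.writes,
    List.cons_append, List.nil_append, List.append_nil] at f3
  have h3 : Stored B G vs es m3 := h2.congr (by simp [f3])
  have ha3 : StoredAttr B G m3 := ha2.congr (by simp [f3])
  refine Ends.seq (linkCmd_spec h3) fun m4 q4 f4 => ?_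
  simp only [linkCmd, writes_forV, writes_forE, Cmd.writes, List.cons_append, List.nil_append] at f4
  have h4 : Stored B G vs es m4 := h3.congr (by simp [f4])
  have ha4 : StoredAttr B G m4 := ha3.congr (by simp [f4])
  refine Ends.seq (h4.mapE (B + arEn) (by simp [Cmd.Simple]) (by simp [Cmd.writes]) (by simp)
    (fun e => if e.1 ∈ G.minV then 1 else 0) ?_) fun m5 q5 f5 => ?_
  · intro e he m' i hfr hi hx _
    have hv := (mem_verts_of_edge (v := e.1) (u := e.2) he).1
    have := (ha4.congr (m' := m') (by simp [hfr])).own_le_zero hv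
    by_cases hmin : e.1 ∈ G.minV
    · have := this.2 hmin
      simp +contextual [Cmd.apply, Expr.eval, hi, hx, this, hmin, Memory.set_self]
    · have := mt this.1 hmin
      simp +contextual [Cmd.apply, Expr.eval, hi, hx, this, hmin, Memory.set_self]
  simp only [writes_forE, Cmd.writes, List.cons_append, List.nil_append] at f5
  have h5 : Stored B G vs es m5 := h4.congr (by simp [f5])
  have hl5 : Linked B G es m5 := by simpa [Linked, f5] using q4
  refine Ends.seq (searchCmd_spec (P := fun e => e.1 ∈ G.minV)
    (S := G.Relaxable (fun v => m2 (B + arDist) v)) h5 hl5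
    (fun i hi => by simp +contextual [q5 i hi]) (by simpa [f5, f4] using q3)) fun m6 q6 f6 => ?_
  simp only [searchCmd, pushCmd, followCmd, popCmd, writes_forV, Cmd.writes, List.cons_append,
    List.nil_append, List.append_nil] at f6
  have h6 : Stored B G vs es m6 := h5.congr (by simp [f6])
  have hl6 : Linked B G es m6 := by simpa [Linked, f6] using hl5
  refine (h6.mapV (B + arCore) (by simp [Cmd.Simple]) (by simp [Cmd.writes]) (by simp)
    (fun v => if v ∈ G.core.verts then 1 else 0) ?_).frame.mono le_rfl fun m7 ⟨q7, f7⟩ => ?_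
  · intro v hv m' hfr _ hx
    have hd := q2.below
    rw [h.length_vs] at hd
    have hiff : v ∈ G.core.verts ↔ ¬ ∃ s ∈ G.verts, G.Relaxable (fun v => m2 (B + arDist) v) s ∧
        Relation.ReflTransGen (fun v u => (v, u) ∈ G.edges ∧ v ∈ G.minV) v s := by
      rw [mem_core_verts, hopeless_iff hG q2.sound hd hv]
      refine ⟨fun h h' => h.2 ?_, fun h' => ⟨hv, fun h => h' ?_⟩⟩
      · obtain ⟨s, -, hs⟩ := h'
        exact ⟨s, hs⟩
      · obtain ⟨s, hs⟩ := h
        exact ⟨s, mem_verts.2 (Or.inr hs.1.1), hs⟩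
    have hmk : m' (B + arMark) v = if v ∈ G.core.verts then 0 else 1 := by
      rw [hfr _ (by simp) (by simp) (by simp), q6 v hv]
      by_cases hc : v ∈ G.core.verts
      · rw [if_pos hc, if_neg (hiff.1 hc)]
      · rw [if_neg hc, if_pos (not_not.1 (mt hiff.2 hc))]
    by_cases hc : v ∈ G.core.verts <;>
      simp +contextual [Cmd.apply, Expr.eval, hx, Memory.set_self, hmk, hc]
  · simp only [writes_forV, Cmd.writes, List.cons_append, List.nil_append] at f7
    exact ⟨by simpa [Linked, f7] using hl6, q7⟩

/-! ### The vertices with infinite valuation -/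

/-- Mark the vertices from which the sink is reached by some play of the current strategy. -/
def escapeCmd (B : ℕ) : Cmd :=
  .seq (forE B (.ite (.read (B + arOwn) (.var (B + svV))) (.const 0)
      (.assign (B + arEn) (.var (B + svE)) (.const 1))
      (.ite (.read (B + arStr) (.var (B + svV))) (.var (B + svU))
        (.ite (.var (B + svU)) (.read (B + arStr) (.var (B + svV)))
          (.assign (B + arEn) (.var (B + svE)) (.const 1))
          (.assign (B + arEn) (.var (B + svE)) (.const 0)))
        (.assign (B + arEn) (.var (B + svE)) (.const 0)))))
  (.seq (forV B (.ite (.read (B + arOwn) (.var (B + svX))) (.const 0)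
      (.assign (B + arMark) (.var (B + svX)) (.const 0))
      (.ite (.read (B + arStr) (.var (B + svX))) (.const (-1))
        (.assign (B + arMark) (.var (B + svX)) (.const 1))
        (.assign (B + arMark) (.var (B + svX)) (.const 0)))))
    (searchCmd B))

theorem code_inj {x y : Option ℕ} : code x = code y ↔ x = y := by
  cases x <;> cases y <;> simp [code]

open Classical in
theorem escapeCmd_spec (h : Stored B G vs es m) (ha : StoredAttr B G m) (hs : StoredStr B G σ m)
    (hl : Linked B G es m) :
    Ends (escapeCmd B) m (25 * vs.length + 21 * es.length + 9) fun m' =>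
      ∀ v ∈ G.verts, m' (B + arMark) v = if G.Escapes σ v then 1 else 0 := by
  refine Ends.mono (T := (es.length * (7 + 4) + 2) + ((vs.length * (5 + 3) + 2) +
    (17 * vs.length + 10 * es.length + 5))) ?_ (by omega) fun _ h => h
  refine Ends.seq (h.mapE (B + arEn) (by simp [Cmd.Simple]) (by simp [Cmd.writes]) (by simp)
    (fun e => if e.1 ∈ G.minV ∨ σ e.1 = some e.2 then 1 else 0) ?_) fun m1 q1 f1 => ?_
  · intro e he m' i hfr hi hx hu
    have hv := (mem_verts_of_edge (v := e.1) (u := e.2) he).1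
    have hle := (ha.congr (m' := m') (by simp [hfr])).own_le_zero hv
    by_cases hmin : e.1 ∈ G.minV
    · have := hle.2 hmin
      simp +contextual [Cmd.apply, Expr.eval, hi, hx, this, hmin, Memory.set_self]
    · have h1 := mt hle.1 hmin
      have h2 : m' (B + arStr) e.1 = code (σ e.1) := by
        rw [hfr _ (by simp) (by simp) (by simp) (by simp)]
        exact hs _ ((mem_verts.1 hv).resolve_right hmin)
      have h3 : σ e.1 = some e.2 ↔ code (σ e.1) = (e.2 : ℤ) := by
        rw [← code_inj]; rfl
      simp only [h3]
      rcases lt_trichotomy (code (σ e.1)) (e.2 : ℤ) with h4 | h4 | h4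
      · simp +contextual [Cmd.apply, Expr.eval, hi, hx, hu, h1, h2, hmin, Memory.set_self, h4.le,
          h4.not_ge, h4.ne]
      · simp +contextual [Cmd.apply, Expr.eval, hi, hx, hu, h1, h2, hmin, Memory.set_self, h4]
      · simp +contextual [Cmd.apply, Expr.eval, hi, hx, hu, h1, h2, hmin, Memory.set_self,
          h4.not_ge, h4.ne']
  simp only [writes_forE, Cmd.writes, List.cons_append, List.nil_append] at f1
  have h1 : Stored B G vs es m1 := h.congr (by simp [f1])
  have ha1 : StoredAttr B G m1 := ha.congr (by simp [f1])
  refine Ends.seq (h1.mapV (B + arMark) (by simp [Cmd.Simple]) (by simp [Cmd.writes]) (by simp)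
    (fun v => if v ∈ G.maxV ∧ σ v = none then 1 else 0) ?_) fun m2 q2 f2 => ?_
  · intro v hv m' hfr _ hx
    have hle := (ha1.congr (m' := m') (by simp [hfr])).own_le_zero hv
    by_cases hmin : v ∈ G.minV
    · have := hle.2 hmin
      simp +contextual [Cmd.apply, Expr.eval, hx, this, not_mem_maxV hmin, Memory.set_self]
    · have hmax := (mem_verts.1 hv).resolve_right hmin
      have h1 := mt hle.1 hmin
      have h2 : m' (B + arStr) v = code (σ v) := by
        rw [hfr _ (by simp) (by simp) (by simp), f1 _ (by simp)]
        exact hs _ hmax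
      cases hσ : σ v with
      | none =>
        simp +contextual [Cmd.apply, Expr.eval, hx, h1, h2, hmax, hσ, code, Memory.set_self]
      | some u =>
        have h3 : ¬ (u : ℤ) ≤ -1 := by omega
        simp +contextual [Cmd.apply, Expr.eval, hx, h1, h2, hmax, hσ, code, h3, Memory.set_self]
  simp only [writes_forV, Cmd.writes, List.cons_append, List.nil_append] at f2
  have h2 : Stored B G vs es m2 := h1.congr (by simp [f2])
  refine (searchCmd_spec (P := fun e => e.1 ∈ G.minV ∨ σ e.1 = some e.2)
    (S := fun v => v ∈ G.maxV ∧ σ v = none) h2 (by simpa [Linked, f2, f1] using hl)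
    (fun i hi => by simp +contextual [f2, q1 i hi]) fun v hv => by simp [q2 v hv]).mono
    le_rfl fun m3 q3 v hv => ?_
  rw [q3 v hv]
  congr 1
  refine propext ⟨?_, ?_⟩
  · rintro ⟨s, -, h3, h4⟩
    exact ⟨s, h3.1, h3.2, h4⟩
  · rintro ⟨s, h3, h4, h5⟩
    exact ⟨s, mem_verts.2 (Or.inl h3), ⟨h3, h4⟩, h5⟩

/-- Split the game without the hopeless vertices into the vertices at which the current strategy has
valuation `∞`, stored in the array 7, and the others. -/
def splitCmd (B : ℕ) : Cmd :=
  .seq (escapeCmd B)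
  (.seq (forV B (.ite (.const 2) (.add (.read (B + arCore) (.var (B + svX)))
        (.read (B + arMark) (.var (B + svX))))
      (.assign (B + arIn) (.var (B + svX)) (.const 1))
      (.assign (B + arIn) (.var (B + svX)) (.const 0))))
    (forV B (.ite (.const 2) (.add (.read (B + arCore) (.var (B + svX)))
        (.sub (.const 1) (.read (B + arMark) (.var (B + svX)))))
      (.assign 7 (.var (B + svX)) (.const 1))
      (.assign 7 (.var (B + svX)) (.const 0)))))

theorem writes_splitCmd (B : ℕ) : ∀ a ∈ [B + svN, B + svM, B + svT, B + svR, B + arVert, B + arSrc,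
    B + arTgt, B + arOwn, B + arWt, B + arStr, B + arCore, B + arHead, B + arNext],
    a ∉ (splitCmd B).writes := by
  simp [splitCmd, escapeCmd, searchCmd, pushCmd, followCmd,
    popCmd, writes_forV, writes_forE, Cmd.writes]

theorem splitCmd_spec (hG : G.MinMoves) (hσ : G.core.IsStart σ) (h : Stored B G vs es m)
    (ha : StoredAttr B G m) (hs : StoredStr B G σ m) (hl : Linked B G es m)
    (hc : StoredSet G (m (B + arCore)) G.core.verts) :
    Ends (splitCmd B) m (37 * vs.length + 21 * es.length + 13) fun m' =>
      StoredSet G (m' (B + arIn)) (G.core.rest σ).verts ∧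
        StoredSet G (m' 7) (G.core.topSet σ) := by
  classical
  refine Ends.mono (T := (25 * vs.length + 21 * es.length + 9) + ((vs.length * (3 + 3) + 2) +
    (vs.length * (3 + 3) + 2))) ?_ (by omega) fun _ h => h
  refine Ends.seq (escapeCmd_spec h ha hs hl) fun m1 q1 f1 => ?_
  simp only [escapeCmd, searchCmd, pushCmd, followCmd, popCmd, writes_forV, writes_forE, Cmd.writes,
    List.cons_append, List.nil_append, List.append_nil] at f1
  have h1 : Stored B G vs es m1 := h.congr (by simp [f1])
  have hc1 : StoredSet G (m1 (B + arCore)) G.core.verts := by simpa [f1] using hc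
  have hcore : ∀ v ∈ G.core.verts, v ∈ G.core.topSet σ ↔ ¬ G.Escapes σ v := fun v hv => by
    rw [mem_topSet_iff_not_escapes (core_minMoves hG) hσ hv, core_escapes_iff hG hσ.1 hv]
  refine Ends.seq (h1.mapV (B + arIn) (by simp [Cmd.Simple]) (by simp [Cmd.writes]) (by simp)
    (fun v => if v ∈ (G.core.rest σ).verts then 1 else 0) ?_) fun m2 q2 f2 => ?_
  · intro v hv m' hfr _ hx
    have e1 := hc1 v hv
    have e2 := q1 v hv
    simp only [mem_rest_verts]
    by_cases hvc : v ∈ G.core.verts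
    · simp only [hcore v hvc]
      by_cases hve : G.Escapes σ v <;> simp only [hvc, hve, if_true, if_false] at e1 e2 <;>
      simp +contextual [Cmd.apply, Expr.eval, hx, hfr, e1, e2, hvc, hve, Memory.set_self]
    · by_cases hve : G.Escapes σ v <;> simp only [hvc, hve, if_true, if_false] at e1 e2 <;>
      simp +contextual [Cmd.apply, Expr.eval, hx, hfr, e1, e2, hvc, Memory.set_self]
  simp only [writes_forV, Cmd.writes, List.cons_append, List.nil_append] at f2
  have h2 : Stored B G vs es m2 := h1.congr (by simp [f2])
  refine (h2.mapV 7 (by simp [Cmd.Simple]) (by simp [Cmd.writes]) (by simp)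
    (fun v => if v ∈ G.core.topSet σ then 1 else 0) ?_).frame.mono le_rfl fun m3 ⟨q3, f3⟩ => ?_
  · intro v hv m' hfr _ hx
    have e1 := hc1 v hv
    have e2 := q1 v hv
    have e3 : m' (B + arCore) = m1 (B + arCore) := by
      rw [hfr _ (by omega) (by simp) (by simp), f2 _ (by simp)]
    have e4 : m' (B + arMark) = m1 (B + arMark) := by
      rw [hfr _ (by omega) (by simp) (by simp), f2 _ (by simp)]
    by_cases hvc : v ∈ G.core.verts
    · simp only [hcore v hvc]
      by_cases hve : G.Escapes σ v <;> simp only [hvc, hve, if_true, if_false] at e1 e2 <;>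
      simp +contextual [Cmd.apply, Expr.eval, hx, e3, e4, e1, e2, hve, Memory.set_self]
    · have hvt : v ∉ G.core.topSet σ := fun h => hvc (mem_topSet.1 h).1
      by_cases hve : G.Escapes σ v <;> simp only [hvc, hve, if_true, if_false] at e1 e2 <;>
      simp +contextual [Cmd.apply, Expr.eval, hx, e3, e4, e1, e2, hvt, Memory.set_self]
  · simp only [writes_forV, Cmd.writes, List.cons_append, List.nil_append] at f3
    refine ⟨?_, q3⟩
    rw [f3 _ (by simp)]
    exact q2

end StratImp

namespace StratImp

open Arena

variable {B : ℕ} {G : Arena} {vs : List ℕ} {es : List (ℕ × ℕ)} {m m' : Memory} {c : Cmd}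
  {σ ρ : ℕ → Option ℕ} {U W : Finset ℕ}

/-! ### A round of the algorithm -/

theorem StoredAttr.own (ha : StoredAttr B G m) {v : ℕ} (hv : v ∈ G.verts) :
    m (B + arOwn) v = if v ∈ G.maxV then 1 else 0 := by
  rcases mem_verts.1 hv with h | h
  · simp [ha.ownMax v h, h]
  · simp [ha.ownMin v h, not_mem_maxV h]

/-- Look for an edge from a Max vertex in the set `arIn` to a vertex in the set `7`. -/
def findCmd (B : ℕ) : Cmd :=
  .seq (.assign (B + svF) (.const 0) (.const (-1)))
    (forE B (.ite (.const 3) (.add (.add (.read (B + arOwn) (.var (B + svV)))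
      (.read (B + arIn) (.var (B + svV)))) (.read 7 (.var (B + svU))))
      (.assign (B + svF) (.const 0) (.var (B + svE))) .skip))

theorem findCmd_spec (h : Stored B G vs es m) (ha : StoredAttr B G m)
    (hU : StoredSet G (m (B + arIn)) U) (hW : StoredSet G (m 7) W) :
    Ends (findCmd B) m (7 * es.length + 3) fun m' =>
      (m' (B + svF) 0 = -1 ∧ ∀ v u, (v, u) ∈ G.edges → v ∈ G.maxV → v ∈ U → u ∉ W) ∨
      ∃ (i : ℕ) (hi : i < es.length), m' (B + svF) 0 = i ∧ es[i].1 ∈ G.maxV ∧ es[i].1 ∈ U ∧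
        es[i].2 ∈ W := by
  refine Ends.mono (T := 1 + (es.length * (3 + 4) + 2)) ?_ (by omega) fun _ h => h
  refine Ends.seq (ends_assign (Q := fun m' => m' (B + svF) 0 = -1) ?_) fun m1 q1 f1 => ?_
  · simp [Expr.eval, Memory.set_self]
  simp only [Cmd.writes, List.mem_singleton] at f1
  have h1 : Stored B G vs es m1 := h.congr (by simp [f1])
  refine (Ends.forEdges (T := 3) (by simp [Cmd.writes]) (by simp [Cmd.writes])
    (by simp [Cmd.writes]) (by simp [Cmd.writes]) (by simp) (by simp)
    h1.lengthE h1.holdsE (fun l m' =>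
      (m' (B + svF) 0 = -1 ∧ ∀ v u, (v, u) ∈ l → v ∈ G.maxV → v ∈ U → u ∉ W) ∨
      ∃ (i : ℕ) (hi : i < es.length), m' (B + svF) 0 = i ∧ es[i].1 ∈ G.maxV ∧ es[i].1 ∈ U ∧
        es[i].2 ∈ W) ?_ (Or.inl ⟨q1, by simp⟩) ?_).mono le_rfl fun m' hm => ?_
  · rintro l m' a z (rfl | rfl | rfl) hm <;> simpa [Memory.set_of_ne] using hm
  · rintro l₁ x y l₂ hl m' hfr hk hx hy hI
    refine Ends.of_simple (c := .ite (.const 3) (.add (.add (.read (B + arOwn) (.var (B + svV)))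
      (.read (B + arIn) (.var (B + svV)))) (.read 7 (.var (B + svU))))
      (.assign (B + svF) (.const 0) (.var (B + svE))) .skip) (by simp [Cmd.Simple]) ?_
    have hxy := mem_verts_of_edge (h.mem_es.1 (show (x, y) ∈ es by simp [hl]))
    have e1 : m' (B + arOwn) x = if x ∈ G.maxV then 1 else 0 := by
      rw [hfr _ (by simp [Cmd.writes]), f1 _ (by simp)]; exact ha.own hxy.1
    have e2 : m' (B + arIn) x = if x ∈ U then 1 else 0 := by
      rw [hfr _ (by simp [Cmd.writes]), f1 _ (by simp)]; exact hU x hxy.1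
    have e3 : m' 7 y = if y ∈ W then 1 else 0 := by
      rw [hfr _ (by simp [Cmd.writes]), f1 _ (by omega)]; exact hW y hxy.2
    by_cases hc : x ∈ G.maxV ∧ x ∈ U ∧ y ∈ W
    · right
      have hi : es[l₁.length]? = some (x, y) := by simp [hl]
      obtain ⟨hi, hi'⟩ := List.getElem?_eq_some_iff.1 hi
      refine ⟨l₁.length, hi, ?_, by simp [hi', hc]⟩
      simp [Cmd.apply, Expr.eval, hx, hy, e1, e2, e3, hc, hk, Memory.set_self]
    · have hap : (Cmd.ite (.const 3) (.add (.add (.read (B + arOwn) (.var (B + svV)))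
          (.read (B + arIn) (.var (B + svV)))) (.read 7 (.var (B + svU))))
          (.assign (B + svF) (.const 0) (.var (B + svE))) .skip).apply m' = m' := by
        have : ¬ (3 : ℤ) ≤ m' (B + arOwn) x + m' (B + arIn) x + m' 7 y := by
          rw [e1, e2, e3]
          split_ifs <;> simp_all
        simp [Cmd.apply, Expr.eval, hx, hy, this]
      rw [hap]
      rcases hI with ⟨h2, h3⟩ | hI
      · left
        refine ⟨h2, fun v u hvu hv hvU hu => ?_⟩
        rcases List.mem_append.1 hvu with h4 | h4
        · exact h3 v u h4 hv hvU hu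
        · obtain ⟨rfl, rfl⟩ := Prod.mk.inj (List.mem_singleton.1 h4)
          exact hc ⟨hv, hvU, hu⟩
      · exact Or.inr hI
  · exact hm.imp (fun h2 => ⟨h2.1, fun v u he => h2.2 v u (h.mem_es.2 he)⟩) id

/-- Switch the edge that has been found. -/
def switchCmd (B : ℕ) : Cmd :=
  .seq (.switch (.read (B + arSrc) (.var (B + svF))) (.read (B + arTgt) (.var (B + svF))))
    (.seq .commit (.assign (B + arStr) (.read (B + arSrc) (.var (B + svF)))
      (.read (B + arTgt) (.var (B + svF)))))

theorem switchCmd_spec (h : Stored B G vs es m) (hs : StoredStr B G σ m) {i : ℕ}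
    (hi : i < es.length) (hF : m (B + svF) 0 = i) :
    Halts (switchCmd B) m 3 fun r m' => r = [Event.switch es[i].1 es[i].2, Event.commit] ∧
      StoredStr B G (switchEdges σ [(es[i].1, some es[i].2)]) m' := by
  obtain ⟨e1, e2⟩ := h.holdsE i hi
  refine ⟨_, _, _, (Exec.switch _ _ _).seq ((Exec.commit _).seq (Exec.assign _ _ _ _)), le_rfl,
    ?_, ?_⟩
  · simp [Expr.eval, hF, e1, e2]
  · intro v hv
    simp only [Expr.eval, hF, e1, e2, Memory.set_self]
    by_cases hvx : v = es[i].1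
    · subst hvx; simp [switchEdges, code]
    · have : (v : ℤ) ≠ es[i].1 := by exact_mod_cast hvx
      rw [Function.update_of_ne this, hs v hv]
      have hb : (v == es[i].1) = false := by simpa using hvx
      simp [switchEdges, List.lookup, hb]

/-- Write the sub-game on the set `arIn`, with the current strategy, to the input arrays. -/
def buildCmd (B : ℕ) : Cmd :=
  .seq (.assign (B + svC) (.const 0) (.const 0))
  (.seq (forV B (.ite (.const 1) (.read (B + arIn) (.var (B + svX)))
    (.seq (.assign 1 (.var (B + svC)) (.var (B + svX)))
      (.assign (B + svC) (.const 0) (.add (.var (B + svC)) (.const 1)))) .skip))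
  (.seq (.assign 0 (.const 0) (.var (B + svC)))
  (.seq (.assign (B + svC) (.const 0) (.const 0))
  (.seq (forE B (.ite (.const 2) (.add (.read (B + arIn) (.var (B + svV)))
      (.read (B + arIn) (.var (B + svU))))
    (.seq (.assign 4 (.var (B + svC)) (.var (B + svV)))
      (.seq (.assign 5 (.var (B + svC)) (.var (B + svU)))
        (.assign (B + svC) (.const 0) (.add (.var (B + svC)) (.const 1))))) .skip))
  (.seq (.assign 0 (.const 1) (.var (B + svC)))
  (.seq (forV B (.assign 2 (.var (B + svX)) (.read (B + arOwn) (.var (B + svX)))))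
  (.seq (forV B (.assign 3 (.var (B + svX)) (.read (B + arWt) (.var (B + svX)))))
    (forV B (.assign 6 (.var (B + svX)) (.read (B + arStr) (.var (B + svX))))))))))))

theorem HoldsEdges.push {a b : ℤ → ℤ} {l : List (ℕ × ℕ)} (h : HoldsEdges a b l) (x y : ℕ) :
    HoldsEdges (Function.update a l.length x) (Function.update b l.length y) (l ++ [(x, y)]) := by
  intro i hi
  rcases Nat.lt_or_ge i l.length with h' | h'
  · rw [Function.update_of_ne (by exact_mod_cast h'.ne), Function.update_of_ne
      (by exact_mod_cast h'.ne), List.getElem_append_left h']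
    exact h i h'
  · obtain rfl : i = l.length := by simp at hi; omega
    simp

theorem buildCmd_spec (h : Stored B G vs es m) (ha : StoredAttr B G m) (hs : StoredStr B G σ m)
    (hU : StoredSet G (m (B + arIn)) U) :
    Ends (buildCmd B) m (19 * vs.length + 9 * es.length + 14) fun m' =>
      Encodes m' (G.restrict U) σ := by
  refine Ends.mono (T := 1 + ((vs.length * (4 + 3) + 2) + (1 + (1 + ((es.length * (5 + 4) + 2) +
    (1 + ((vs.length * (1 + 3) + 2) + ((vs.length * (1 + 3) + 2) +
      (vs.length * (1 + 3) + 2))))))))) ?_ (by omega) fun _ h => h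
  refine Ends.seq (ends_assign (Q := fun m' => m' (B + svC) 0 = 0) ?_) fun m1 q1 f1 => ?_
  · simp [Expr.eval, Memory.set_self]
  simp only [Cmd.writes, List.mem_singleton] at f1
  have h1 : Stored B G vs es m1 := h.congr (by simp [f1])
  refine Ends.seq (Q := fun m' => HoldsList (m' 1) (vs.filter (· ∈ U)) ∧
      m' (B + svC) 0 = (vs.filter (· ∈ U)).length) ?_ fun m2 q2 f2 => ?_
  · refine (Ends.forList (T := 4) (by simp [Cmd.writes]) (by simp [Cmd.writes])
      (by simp [Cmd.writes]) (by simp) h1.lengthV h1.holdsV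
      (fun l m' => HoldsList (m' 1) (l.filter (· ∈ U)) ∧
        m' (B + svC) 0 = (l.filter (· ∈ U)).length) ?_ ?_ ?_)
    · rintro l m' a z (rfl | rfl) hm <;>
        rwa [Memory.set_of_ne _ (by omega), Memory.set_of_ne _ (by omega)]
    · exact ⟨fun i hi => by simp at hi, by simpa using q1⟩
    · rintro l₁ v l₂ hl m' hfr hx ⟨hI1, hI2⟩
      refine Ends.of_simple (c := .ite (.const 1) (.read (B + arIn) (.var (B + svX)))
        (.seq (.assign 1 (.var (B + svC)) (.var (B + svX)))
          (.assign (B + svC) (.const 0) (.add (.var (B + svC)) (.const 1)))) .skip)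
        (by simp [Cmd.Simple]) ?_
      have hv : v ∈ G.verts := h.mem_vs.1 (by simp [hl])
      have hmk : m' (B + arIn) v = if v ∈ U then 1 else 0 := by
        rw [hfr _ (by simp [Cmd.writes]), f1 _ (by simp)]; exact hU v hv
      have hne : (1 : ℕ) ≠ B + svC := by omega
      by_cases hP : v ∈ U
      · rw [if_pos hP] at hmk
        have := hI1.push v
        simp only [List.filter_append]
        simpa [Cmd.apply, Expr.eval, hx, hmk, Memory.set_self, Memory.set_of_ne, hI2, hP, hne,
          hne.symm] using this
      · rw [if_neg hP] at hmk
        simp only [List.filter_append]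
        simpa [Cmd.apply, Expr.eval, hx, hmk, hP] using ⟨hI1, hI2⟩
  simp only [writes_forV, Cmd.writes, List.cons_append, List.nil_append, List.append_nil,
    List.mem_cons, not_or, List.not_mem_nil, not_false_eq_true, and_true, and_imp] at f2
  refine Ends.seq (ends_assign (Q := fun m' => m' 0 0 = (vs.filter (· ∈ U)).length) ?_)
    fun m3 q3 f3 => ?_
  · simp [Expr.eval, Memory.set_self, q2.2]
  simp only [Cmd.writes, List.mem_singleton] at f3
  refine Ends.seq (ends_assign (Q := fun m' => m' (B + svC) 0 = 0) ?_) fun m4 q4 f4 => ?_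
  · simp [Expr.eval, Memory.set_self]
  simp only [Cmd.writes, List.mem_singleton] at f4
  have g4 : ∀ a, 8 ≤ a → a ≠ B + svC → a ≠ B + svK → a ≠ B + svX → m4 a = m a := by
    intro a h1 h2 h3 h4
    rw [f4 a h2, f3 a (by omega), f2 a h3 h4 (by omega) h2 h3, f1 a h2]
  have h4 : Stored B G vs es m4 := h.congr (by
    simp only [List.forall_mem_cons, List.not_mem_nil, false_imp_iff, implies_true, and_true]
    refine ⟨?_, ?_, ?_, ?_, ?_⟩ <;> exact g4 _ (by omega) (by omega) (by omega) (by omega))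
  refine Ends.seq (Q := fun m' => HoldsEdges (m' 4) (m' 5) (es.filter fun e => e.1 ∈ U ∧ e.2 ∈ U) ∧
      m' (B + svC) 0 = (es.filter fun e => e.1 ∈ U ∧ e.2 ∈ U).length) ?_ fun m5 q5 f5 => ?_
  · refine (Ends.forEdges (T := 5) (by simp [Cmd.writes]) (by simp [Cmd.writes])
      (by simp [Cmd.writes]) (by simp [Cmd.writes]) (by simp) (by simp)
      h4.lengthE h4.holdsE
      (fun l m' => HoldsEdges (m' 4) (m' 5) (l.filter fun e => e.1 ∈ U ∧ e.2 ∈ U) ∧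
        m' (B + svC) 0 = (l.filter fun e => e.1 ∈ U ∧ e.2 ∈ U).length) ?_ ?_ ?_)
    · rintro l m' a z (rfl | rfl | rfl) hm <;>
        rwa [Memory.set_of_ne _ (by omega), Memory.set_of_ne _ (by omega),
          Memory.set_of_ne _ (by omega)]
    · exact ⟨fun i hi => by simp at hi, by simpa using q4⟩
    · rintro l₁ x y l₂ hl m' hfr hk hx hy ⟨hI1, hI2⟩
      refine Ends.of_simple (c := .ite (.const 2) (.add (.read (B + arIn) (.var (B + svV)))
          (.read (B + arIn) (.var (B + svU))))
        (.seq (.assign 4 (.var (B + svC)) (.var (B + svV)))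
          (.seq (.assign 5 (.var (B + svC)) (.var (B + svU)))
            (.assign (B + svC) (.const 0) (.add (.var (B + svC)) (.const 1))))) .skip)
        (by simp [Cmd.Simple]) ?_
      have hxy := mem_verts_of_edge (h.mem_es.1 (show (x, y) ∈ es by simp [hl]))
      have hin : m' (B + arIn) = m (B + arIn) := by
        rw [hfr _ (by simp [Cmd.writes]), g4 _ (by omega) (by omega) (by omega) (by omega)]
      have e1 : m' (B + arIn) x = if x ∈ U then 1 else 0 := by rw [hin]; exact hU x hxy.1
      have e2 : m' (B + arIn) y = if y ∈ U then 1 else 0 := by rw [hin]; exact hU y hxy.2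
      have n1 : (4 : ℕ) ≠ B + svC := by omega
      have n2 : (5 : ℕ) ≠ B + svC := by omega
      have n3 : B + svU ≠ 4 := by omega
      by_cases hP : x ∈ U ∧ y ∈ U
      · have := hI1.push x y
        simp only [List.filter_append]
        rw [if_pos hP.1] at e1
        rw [if_pos hP.2] at e2
        simpa [Cmd.apply, Expr.eval, hx, hy, e1, e2, Memory.set_self, Memory.set_of_ne, hI2, hP,
          n1, n2, n1.symm, n2.symm, n3] using this
      · have : ¬ (2 : ℤ) ≤ m' (B + arIn) x + m' (B + arIn) y := by
          rw [e1, e2]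
          split_ifs <;> simp_all
        simp only [List.filter_append]
        have hP' : [(x, y)].filter (fun e => e.1 ∈ U ∧ e.2 ∈ U) = [] := by simpa using hP
        rw [hP', List.append_nil]
        rw [Cmd.apply, if_neg (by simpa [Expr.eval, hx, hy] using this)]
        exact ⟨hI1, hI2⟩
  simp only [writes_forE, Cmd.writes, List.cons_append, List.nil_append, List.append_nil,
    List.mem_cons, not_or, List.not_mem_nil, not_false_eq_true, and_true, and_imp] at f5
  refine Ends.seq (ends_assign (Q := fun m' => m' 0 0 = (vs.filter (· ∈ U)).length ∧
      m' 0 1 = (es.filter fun e => e.1 ∈ U ∧ e.2 ∈ U).length) ?_) fun m6 q6 f6 => ?_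
  · rw [← q3, ← f4 0 (by omega), ← f5 0 (by omega) (by omega) (by omega) (by omega) (by omega)
      (by omega) (by omega)]
    simp [Expr.eval, Memory.set_self, q5.2]
  simp only [Cmd.writes, List.mem_singleton] at f6
  have g6 : ∀ a, 8 ≤ a → a ∉ [B + svC, B + svK, B + svX, B + svE, B + svV, B + svU] →
      m6 a = m a := by
    intro a h1 h2
    simp only [List.mem_cons, not_or, List.not_mem_nil, not_false_eq_true, and_true] at h2
    obtain ⟨n1, n2, n3, n4, n5, n6⟩ := h2
    rw [f6 a (by omega), f5 a n4 n5 n6 (by omega) (by omega) n1 n4, g4 a h1 n1 n2 n3]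
  have k6 : m6 1 = m2 1 := by
    rw [f6 1 (by omega), f5 1 (by omega) (by omega) (by omega) (by omega) (by omega)
      (by omega) (by omega), f4 1 (by omega), f3 1 (by omega)]
  have h6 : Stored B G vs es m6 := h.congr (by
    simp only [List.forall_mem_cons, List.not_mem_nil, false_imp_iff, implies_true, and_true]
    refine ⟨?_, ?_, ?_, ?_, ?_⟩ <;> exact g6 _ (by omega) (by simp))
  refine Ends.seq (h6.mapV 2 (by simp [Cmd.Simple]) (by simp [Cmd.writes]) (by simp)
    (fun v => m (B + arOwn) v) ?_) fun m7 q7 f7 => ?_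
  · intro v hv m' hfr _ hx
    have e1 : m' (B + arOwn) = m (B + arOwn) := by
      rw [hfr _ (by omega) (by simp) (by simp), g6 _ (by omega) (by simp)]
    simp +contextual [Cmd.apply, Expr.eval, hx, Memory.set_self, e1]
  simp only [writes_forV, Cmd.writes, List.cons_append, List.nil_append,
    List.mem_cons, not_or, List.not_mem_nil, not_false_eq_true, and_true, and_imp] at f7
  have f7' : ∀ a, a ≠ 2 → a ≠ B + svK → a ≠ B + svX → m7 a = m6 a :=
    fun a h1 h2 h3 => f7 a h2 h3 h1 h2
  have h7 : Stored B G vs es m7 := h6.congr (by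
    simp only [List.forall_mem_cons, List.not_mem_nil, false_imp_iff, implies_true, and_true]
    refine ⟨?_, ?_, ?_, ?_, ?_⟩ <;> exact f7' _ (by omega) (by omega) (by omega))
  refine Ends.seq (h7.mapV 3 (by simp [Cmd.Simple]) (by simp [Cmd.writes]) (by simp)
    (fun v => m (B + arWt) v) ?_) fun m8 q8 f8 => ?_
  · intro v hv m' hfr _ hx
    have e1 : m' (B + arWt) = m (B + arWt) := by
      rw [hfr _ (by omega) (by simp) (by simp), f7' _ (by omega) (by simp) (by simp),
        g6 _ (by omega) (by simp)]
    simp +contextual [Cmd.apply, Expr.eval, hx, Memory.set_self, e1]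
  simp only [writes_forV, Cmd.writes, List.cons_append, List.nil_append,
    List.mem_cons, not_or, List.not_mem_nil, not_false_eq_true, and_true, and_imp] at f8
  have f8' : ∀ a, a ≠ 3 → a ≠ B + svK → a ≠ B + svX → m8 a = m7 a :=
    fun a h1 h2 h3 => f8 a h2 h3 h1 h2
  have h8 : Stored B G vs es m8 := h7.congr (by
    simp only [List.forall_mem_cons, List.not_mem_nil, false_imp_iff, implies_true, and_true]
    refine ⟨?_, ?_, ?_, ?_, ?_⟩ <;> exact f8' _ (by omega) (by omega) (by omega))
  refine (h8.mapV 6 (by simp [Cmd.Simple]) (by simp [Cmd.writes]) (by simp)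
    (fun v => m (B + arStr) v) ?_).frame.mono le_rfl fun m9 ⟨q9, f9⟩ => ?_
  · intro v hv m' hfr _ hx
    have e1 : m' (B + arStr) = m (B + arStr) := by
      rw [hfr _ (by omega) (by simp) (by simp), f8' _ (by omega) (by simp) (by simp),
        f7' _ (by omega) (by simp) (by simp), g6 _ (by omega) (by simp)]
    simp +contextual [Cmd.apply, Expr.eval, hx, Memory.set_self, e1]
  simp only [writes_forV, Cmd.writes, List.cons_append, List.nil_append,
    List.mem_cons, not_or, List.not_mem_nil, not_false_eq_true, and_true, and_imp] at f9
  have f9' : ∀ a, a ≠ 6 → a ≠ B + svK → a ≠ B + svX → m9 a = m8 a :=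
    fun a h1 h2 h3 => f9 a h2 h3 h1 h2
  have k9 : ∀ a, a < 8 → a ≠ 2 → a ≠ 3 → a ≠ 6 → m9 a = m6 a := by
    intro a h1 h2 h3 h4
    rw [f9' a h4 (by omega) (by omega), f8' a h3 (by omega) (by omega),
      f7' a h2 (by omega) (by omega)]
  have hvU : (vs.filter (· ∈ U)).toFinset = (G.restrict U).verts := by
    ext v
    rw [List.mem_toFinset, List.mem_filter, mem_restrict_verts, h.mem_vs]
    simp
  have heU : (es.filter fun e => e.1 ∈ U ∧ e.2 ∈ U).toFinset = (G.restrict U).edges := by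
    ext e
    rw [List.mem_toFinset, List.mem_filter, h.mem_es]
    simp [restrict]
  have hmx : ∀ v ∈ (G.restrict U).maxV, v ∈ G.maxV := fun v hv => (Finset.mem_inter.1 hv).1
  have hmn : ∀ v ∈ (G.restrict U).minV, v ∈ G.minV := fun v hv => (Finset.mem_inter.1 hv).1
  refine ⟨?_, ?_, ⟨_, h.nodup.filter _, hvU, ?_⟩, ?_, ?_, ?_, ⟨_, h.enodup.filter _, heU, ?_⟩, ?_⟩
  · rw [k9 0 (by omega) (by omega) (by omega) (by omega), q6.1, ← hvU,
      List.toFinset_card_of_nodup (h.nodup.filter _)]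
  · rw [k9 0 (by omega) (by omega) (by omega) (by omega), q6.2, ← heU,
      List.toFinset_card_of_nodup (h.enodup.filter _)]
  · rw [k9 1 (by omega) (by omega) (by omega) (by omega), k6]
    exact q2.1
  · intro v hv
    rw [f9' 2 (by omega) (by omega) (by omega), f8' 2 (by omega) (by omega) (by omega),
      q7 v (mem_verts.2 (Or.inl (hmx v hv))), ha.ownMax v (hmx v hv)]
  · intro v hv
    rw [f9' 2 (by omega) (by omega) (by omega), f8' 2 (by omega) (by omega) (by omega),
      q7 v (mem_verts.2 (Or.inr (hmn v hv))), ha.ownMin v (hmn v hv)]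
  · intro v hv
    have hv' := (mem_restrict_verts.1 hv).1
    rw [f9' 3 (by omega) (by omega) (by omega), q8 v hv', ha.wt v hv']
    rfl
  · rw [k9 4 (by omega) (by omega) (by omega) (by omega),
      k9 5 (by omega) (by omega) (by omega) (by omega), f6 4 (by omega), f6 5 (by omega)]
    exact q5.1
  · intro v hv
    rw [q9 v (mem_verts.2 (Or.inl (hmx v hv))), hs v (hmx v hv)]

/-- Copy the strategy on the set `arIn` from the output array. -/
def fetchCmd (B : ℕ) : Cmd :=
  forV B (.ite (.const 2) (.add (.read (B + arOwn) (.var (B + svX)))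
    (.read (B + arIn) (.var (B + svX))))
    (.assign (B + arStr) (.var (B + svX)) (.read 6 (.var (B + svX)))) .skip)

theorem fetchCmd_spec (h : Stored B G vs es m) (ha : StoredAttr B G m) (hs : StoredStr B G σ m)
    (hU : StoredSet G (m (B + arIn)) U) (hρ : StoresStrategy m (G.restrict U) ρ)
    (heq : ∀ v ∉ (G.restrict U).maxV, ρ v = σ v) :
    Ends (fetchCmd B) m (6 * vs.length + 2) (StoredStr B G ρ) := by
  refine (h.mapV (B + arStr) (by simp [Cmd.Simple]) (by simp [Cmd.writes]) (by simp)
    (fun v => if v ∈ G.maxV then code (ρ v) else m (B + arStr) v) ?_).mono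
    (by simp [Cmd.cost]; omega) fun m' hm v hv => ?_
  · intro v hv m' hfr h0 hx
    have e1 : m' (B + arOwn) v = if v ∈ G.maxV then 1 else 0 := by
      rw [hfr _ (by simp) (by simp) (by simp), ha.own hv]
    have e2 : m' (B + arIn) v = if v ∈ U then 1 else 0 := by
      rw [hfr _ (by simp) (by simp) (by simp)]; exact hU v hv
    have e3 : m' 6 = m 6 := hfr _ (by omega) (by omega) (by omega)
    by_cases hmax : v ∈ G.maxV
    · by_cases hvU : v ∈ U
      · have := hρ v (Finset.mem_inter.2 ⟨hmax, hvU⟩)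
        simp +contextual [Cmd.apply, Expr.eval, hx, e1, e2, e3, hmax, hvU, this, Memory.set_self]
      · have := heq v fun h' => hvU (Finset.mem_inter.1 h').2
        simp [Cmd.apply, Expr.eval, hx, e1, e2, hmax, hvU, h0, this, hs v hmax]
    · by_cases hvU : v ∈ U <;> simp [Cmd.apply, Expr.eval, hx, e1, e2, hmax, hvU, h0]
  · rw [hm v (mem_verts.2 (Or.inl hv)), if_pos hv]

end StratImp

namespace StratImp

open Arena

variable {B : ℕ} {G : Arena} {vs : List ℕ} {es : List (ℕ × ℕ)} {m m' : Memory} {c d : Cmd}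
  {σ ρ : ℕ → Option ℕ} {T T' : ℕ}

/-- Sequential composition of a silent program with a reporting one. -/
theorem Ends.seq_halts {Q : Memory → Prop} {Q' : List Event → Memory → Prop} (h : Ends c m T Q)
    (hd : ∀ m', Q m' → (∀ a ∉ c.writes, m' a = m a) → Halts d m' T' Q') :
    Halts (.seq c d) m (T + T') Q' :=
  Halts.seq (Halts.frame h) fun r m' h => by
    obtain ⟨⟨rfl, h1⟩, h2⟩ := h
    simpa using hd m' h1 h2

theorem Halts.ite_pos {e f : Expr} {Q : List Event → Memory → Prop} (h : e.eval m ≤ f.eval m)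
    (hc : Halts c m T Q) : Halts (.ite e f c d) m (T + 1) Q := by
  obtain ⟨r, t, m', h1, h2, h3⟩ := hc
  exact ⟨r, _, m', .ite_true h h1, by omega, h3⟩

theorem Halts.ite_neg {e f : Expr} {Q : List Event → Memory → Prop} (h : ¬ e.eval m ≤ f.eval m)
    (hd : Halts d m T Q) : Halts (.ite e f c d) m (T + 1) Q := by
  obtain ⟨r, t, m', h1, h2, h3⟩ := hd
  exact ⟨r, _, m', .ite_false h h1, by omega, h3⟩

/-- The program `α` solves the positive cycle problem on the game `H` within `T` steps. -/
def SolvesOn (α : Cmd) (H : Arena) (T : ℕ) : Prop :=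
  ∀ (σ : ℕ → Option ℕ) (m : Memory), H.IsPlayable → H.IsStart σ → Encodes m H σ →
    Halts α m T fun r m' => ∃ ρ, ImprovementRun H σ r ρ ∧ StoresStrategy m' H ρ ∧
      ((∃ v ∈ H.verts, H.val ρ (some v) = ⊤) ∨
        ∀ χ, H.IsMaxStrategy χ → ∀ v ∈ H.verts, H.val χ (some v) < ⊤)

/-- The memory holds the game, its preprocessed vertex set, and the lists of incoming edges. -/
structure Prepared (B : ℕ) (G : Arena) (vs : List ℕ) (es : List (ℕ × ℕ)) (m : Memory) : Prop where
  stored : Stored B G vs es m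
  attr : StoredAttr B G m
  linked : Linked B G es m
  core : StoredSet G (m (B + arCore)) G.core.verts

theorem Prepared.congr (h : Prepared B G vs es m)
    (hm : ∀ a ∈ [B + svN, B + svM, B + arVert, B + arSrc, B + arTgt, B + arOwn, B + arWt,
      B + arCore, B + arHead, B + arNext], m' a = m a) : Prepared B G vs es m' where
  stored := h.stored.congr fun a ha => hm a (by simp at ha ⊢; tauto)
  attr := h.attr.congr fun a ha => hm a (by simp at ha ⊢; tauto)
  linked := by
    have := h.linked
    rwa [Linked, ← hm (B + arNext) (by simp), ← hm (B + arHead) (by simp)] at this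
  core := by rw [hm _ (by simp)]; exact h.core

/-- A round of the algorithm: an edge into the set of the vertices with valuation `∞` is switched,
or else `α` is run on the sub-game without these vertices. -/
def roundCmd (B : ℕ) (α : Cmd) : Cmd :=
  .seq (splitCmd B) (.seq (findCmd B) (.ite (.const 0) (.var (B + svF)) (switchCmd B)
    (.seq (buildCmd B) (.ite (.const 1) (.read 0 (.const 0)) (.seq α (fetchCmd B)) .skip))))

theorem writes_roundCmd {α : Cmd} (hB : ∀ a ∈ α.writes, a < B) :
    ∀ a ∈ [B + svN, B + svM, B + arVert, B + arSrc, B + arTgt, B + arOwn, B + arWt,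
      B + arCore, B + arHead, B + arNext, B + svT, B + svR], a ∉ (roundCmd B α).writes := by
  have hα : ∀ k, B + k ∉ α.writes := fun k hk => by have := hB _ hk; omega
  simp [roundCmd, splitCmd, escapeCmd, searchCmd, pushCmd, followCmd, popCmd, findCmd, switchCmd,
    buildCmd, fetchCmd, writes_forV, writes_forE, Cmd.writes, hα]

theorem restrict_verts_restrict (U : Finset ℕ) :
    G.restrict (G.restrict U).verts = G.restrict U := by
  have h1 : G.maxV ∩ (G.restrict U).verts = G.maxV ∩ U := by
    ext v
    have := mem_verts (G := G) (v := v)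
    simp only [Finset.mem_inter, mem_restrict_verts]
    tauto
  have h2 : G.minV ∩ (G.restrict U).verts = G.minV ∩ U := by
    ext v
    have := mem_verts (G := G) (v := v)
    simp only [Finset.mem_inter, mem_restrict_verts]
    tauto
  have h3 : (G.edges.filter fun e => e.1 ∈ (G.restrict U).verts ∧ e.2 ∈ (G.restrict U).verts) =
      G.edges.filter fun e => e.1 ∈ U ∧ e.2 ∈ U := by
    refine Finset.filter_congr fun e he => ?_
    have := mem_verts_of_edge (v := e.1) (u := e.2) he
    simp only [mem_restrict_verts]
    tauto
  unfold restrict at h1 h2 h3 ⊢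
  simp only [h1, h2, h3]

/-- The remaining game arises from the given game in a single restriction, so that the monotonicity
of the time bound applies to it. -/
theorem restrict_rest_core (σ : ℕ → Option ℕ) :
    G.restrict (G.core.rest σ).verts = G.core.rest σ := by
  classical
  unfold rest core
  rw [restrict_restrict, restrict_verts_restrict]

/-- A round performs a strategy improvement run that enlarges the set of the vertices with valuation
`∞`, unless this set is final afterwards. -/
theorem roundCmd_spec {α : Cmd} (hB : ∀ a ∈ α.writes, a < B) (hG : G.MinMoves)
    (hα : ∀ U, SolvesOn α (G.restrict U) T) (h : Prepared B G vs es m)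
    (hσ : G.core.IsStart σ) (hs : StoredStr B G σ m) :
    Halts (roundCmd B α) m (62 * vs.length + 37 * es.length + 40 + T) fun r m' =>
      ∃ ρ, ImprovementRun G.core σ r ρ ∧ G.core.IsStart ρ ∧ StoredStr B G ρ m' ∧
        ((G.core.topSet σ).card < (G.core.topSet ρ).card ∨ G.core.Final ρ) ∧
        (G.core.Final σ → G.core.Final ρ) := by
  have hcG := core_minMoves hG
  refine Halts.mono (T := (37 * vs.length + 21 * es.length + 13) + ((7 * es.length + 3) +
    (((19 * vs.length + 9 * es.length + 14) + ((T + (6 * vs.length + 2)) + 1)) + 1))) ?_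
    (by omega) fun _ _ h => h
  refine Ends.seq_halts (splitCmd_spec hG hσ h.stored h.attr hs h.linked h.core)
    fun m1 ⟨q1, q1'⟩ f1 => ?_
  have g1 : ∀ a ∈ [B + svN, B + svM, B + arVert, B + arSrc, B + arTgt, B + arOwn, B + arWt,
      B + arCore, B + arHead, B + arNext, B + arStr], m1 a = m a := fun a ha =>
    f1 a (writes_splitCmd B a (by simp at ha ⊢; tauto))
  have h1 : Prepared B G vs es m1 := h.congr fun a ha => g1 a (by simp at ha ⊢; tauto)
  have hs1 : StoredStr B G σ m1 := by
    unfold StoredStr; rw [g1 _ (by simp)]; exact hs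
  refine Ends.seq_halts (findCmd_spec h1.stored h1.attr q1 q1') fun m2 q2 f2 => ?_
  simp only [findCmd, writes_forE, Cmd.writes, List.cons_append, List.nil_append,
    List.append_nil] at f2
  have h2 : Prepared B G vs es m2 := h1.congr (by simp [f2])
  have hs2 : StoredStr B G σ m2 := by
    unfold StoredStr; rw [f2 _ (by simp)]; exact hs1
  have hU2 : StoredSet G (m2 (B + arIn)) (G.core.rest σ).verts := by
    rw [f2 _ (by simp)]; exact q1
  rcases q2 with ⟨hF, hno⟩ | ⟨i, hi, hF, hmax, hr, ht⟩
  · refine Halts.ite_neg (by simp [Expr.eval, hF]) ?_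
    have hno' : ∀ v ∈ (G.core.rest σ).maxV, ∀ u ∈ G.core.topSet σ, (v, u) ∉ G.core.edges := by
      intro v hv u hu he
      exact hno v u (mem_core_edges.1 he).1 ((mem_core_maxV hG).1 (mem_rest_maxV.1 hv).1)
        (mem_verts.2 (Or.inl hv)) hu
    refine Ends.seq_halts (buildCmd_spec h2.stored h2.attr hs2 hU2) fun m3 q3 f3 => ?_
    simp only [buildCmd, writes_forV, writes_forE, Cmd.writes, List.cons_append, List.nil_append,
      List.append_nil] at f3
    have h3 : Prepared B G vs es m3 := h2.congr (by simp [f3])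
    have hs3 : StoredStr B G σ m3 := by
      unfold StoredStr; rw [f3 _ (by simp)]; exact hs2
    have hU3 : StoredSet G (m3 (B + arIn)) (G.core.rest σ).verts := by
      rw [f3 _ (by simp)]; exact hU2
    have hcard : m3 0 0 = (G.core.rest σ).verts.card := by
      rw [q3.1, restrict_rest_core]
    by_cases hne : (G.core.rest σ).verts.Nonempty
    · have := hne.card_pos
      refine Halts.ite_pos (by simp only [Expr.eval, hcard]; omega) ?_
      have hplay : (G.restrict (G.core.rest σ).verts).IsPlayable := by
        rw [restrict_rest_core]
        exact ⟨hne, rest_minMoves hcG hσ.1⟩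
      have hst : (G.restrict (G.core.rest σ).verts).IsStart σ := by
        rw [restrict_rest_core]
        exact rest_isStart hcG hσ
      refine Halts.seq (Halts.frame (hα _ σ m3 hplay hst q3)) ?_
      rintro r m4 ⟨⟨ρ, hrun, hρ, halt⟩, f4⟩
      have f4' : ∀ k, m4 (B + k) = m3 (B + k) := fun k => f4 _ fun hk => by
        have := hB _ hk; omega
      have h4 : Prepared B G vs es m4 := h3.congr (by simp [f4'])
      have hs4 : StoredStr B G σ m4 := by unfold StoredStr; rw [f4']; exact hs3
      have hU4 : StoredSet G (m4 (B + arIn)) (G.core.rest σ).verts := by rw [f4']; exact hU3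
      have hround := round_rest hcG hσ (by rwa [restrict_rest_core] at hrun) hno'
        (by rwa [restrict_rest_core] at halt)
      refine Halts.mono (fetchCmd_spec h4.stored h4.attr hs4 hU4 hρ ?_) le_rfl ?_
      · rw [restrict_rest_core]
        exact hround.2.2.1
      · rintro s m5 ⟨rfl, h5⟩
        rw [List.append_nil]
        exact ⟨ρ, hround.1, hround.2.1, h5, hround.2.2.2⟩
    · have hemp := Finset.not_nonempty_iff_eq_empty.1 hne
      have hfin : G.core.Final σ := ⟨hno', fun χ _ v hv => by simp [hemp] at hv⟩
      refine Halts.ite_neg (by simp [Expr.eval, hcard, hemp]) ?_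
      exact ⟨[], 1, m3, .skip m3, by omega, σ, .nil σ, hσ, hs3, Or.inr hfin, id⟩
  · refine Halts.ite_pos (by simp [Expr.eval, hF]) ?_
    have he := h.stored.mem_es.1 (List.getElem_mem hi)
    have hr' := mem_rest_verts.1 hr
    have hround := round_switch hcG hσ (v := es[i].1) (u := es[i].2)
      (mem_rest_maxV.2 ⟨(mem_core_maxV hG).2 hmax, hr'.2⟩) ht
      (mem_core_edges.2 ⟨he, (mem_core_verts.1 hr'.1).2, (mem_core_verts.1 (mem_topSet.1 ht).1).2⟩)
    refine (switchCmd_spec h2.stored hs2 hi hF).mono (by omega) ?_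
    rintro r m3 ⟨rfl, h3⟩
    exact ⟨_, hround.1, hround.2.1, h3, Or.inl hround.2.2.1, fun h => absurd h hround.2.2.2⟩

/-! ### The whole algorithm -/

/-- The algorithm that finds the 0-mean partition with the help of the algorithm `α`. Every round
adds a vertex to the set of the vertices with valuation `∞`, until this set is final. -/
def meanCmd (B : ℕ) (α : Cmd) : Cmd :=
  .seq (copyCmd B) (.seq (prepCmd B)
    (.seq (forRange (B + svR) (B + svT) (roundCmd B α)) (splitCmd B)))

/-- At most `|V|` rounds enlarge the set of the vertices with valuation `∞`. A round takes time
`O(|V| + |E| + T)`, and the preprocessing `O(|V| (|V| + |E|))`. -/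
theorem meanCmd_spec {α : Cmd} (hB : ∀ a ∈ α.writes, a < B) (hG : G.IsMeanPayoffGame)
    (hα : ∀ U, SolvesOn α (G.restrict U) T) (hσ : G.core.IsStart σ) (h : Encodes m G σ) :
    Halts (meanCmd B α) m (500 * (G.verts.card * (G.verts.card + G.edges.card + T))) fun r m' =>
      ∃ ρ, ImprovementRun G.core σ r ρ ∧ G.core.IsStart ρ ∧ G.core.Final ρ ∧
        StoredSet G (m' 7) (G.core.topSet ρ) := by
  have hmin := hG.minMoves
  obtain ⟨vs, es, hcopy⟩ := copyCmd_spec B h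
  obtain ⟨hn, he⟩ : vs.length = G.verts.card ∧ es.length = G.edges.card := by
    obtain ⟨_, _, _, _, _, _, h1, _⟩ := hcopy
    exact ⟨h1.length_vs, h1.length_es⟩
  have hcard : 1 ≤ vs.length := by rw [hn]; exact hG.1.card_pos
  refine Halts.mono (T := (15 * vs.length + 4 * es.length + 13) + ((4 * vs.length * vs.length +
    9 * vs.length * es.length + 49 * vs.length + 32 * es.length + 30) +
    (((vs.length + 1) * ((62 * vs.length + 37 * es.length + 40 + T) + 2) + 2) +
    (37 * vs.length + 21 * es.length + 13)))) ?_ ?_ fun _ _ h => h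
  · refine Ends.seq_halts hcopy fun m1 ⟨h1, ha1, hs1, ht1⟩ f1 => ?_
    refine Ends.seq_halts (prepCmd_spec hmin h1 ha1 ht1) fun m2 ⟨q2, q2'⟩ f2 => ?_
    have g2 : ∀ a ∈ [B + svN, B + svM, B + svT, B + arVert, B + arSrc, B + arTgt,
        B + arOwn, B + arWt, B + arStr], m2 a = m1 a := fun a ha => f2 a (writes_prepCmd B a ha)
    have h2 : Prepared B G vs es m2 := ⟨h1.congr fun a ha => g2 a (by simp at ha ⊢; tauto),
      ha1.congr fun a ha => g2 a (by simp at ha ⊢; tauto), q2, q2'⟩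
    have hs2 : StoredStr B G σ m2 := by unfold StoredStr; rw [g2 _ (by simp)]; exact hs1
    have hw := writes_roundCmd hB
    have hsR : B + svR ∉ (roundCmd B α).writes := hw _ (by simp)
    have hsT : B + svT ∉ (roundCmd B α).writes := hw _ (by simp)
    have hne : ∀ a ∈ [B + svN, B + svM, B + arVert, B + arSrc, B + arTgt, B + arOwn, B + arWt,
        B + arCore, B + arHead, B + arNext], a ≠ B + svR := by simp
    refine Halts.seq (Halts.frame (Halts.forRange (n := vs.length + 1) hsR hsT (by simp)
      (by rw [g2 _ (by simp), ht1])
      (fun k s m' => ∃ ρ, ImprovementRun G.core σ s ρ ∧ G.core.IsStart ρ ∧ StoredStr B G ρ m' ∧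
        (k ≤ (G.core.topSet ρ).card ∨ G.core.Final ρ)) ?_
      ⟨σ, .nil σ, hσ, hs2, Or.inl (Nat.zero_le _)⟩ ?_)) ?_
    · rintro k s m' z ⟨ρ, h3, h4, h5, h6⟩
      exact ⟨ρ, h3, h4, by unfold StoredStr; rw [Memory.set_of_ne _ (by simp)]; exact h5, h6⟩
    · rintro k hk s m' hfr - ⟨ρ, h3, h4, h5, h6⟩
      have h2' : Prepared B G vs es m' := h2.congr fun a ha => hfr a fun h' =>
        (List.mem_cons.1 h').elim (hne a ha) (hw a (List.mem_append_left [B + svT, B + svR] ha))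
      refine (roundCmd_spec hB hmin hα h2' h4 h5).mono le_rfl ?_
      rintro r m'' ⟨ρ', h7, h8, h9, h10, h11⟩
      refine ⟨ρ', h3.append h7, h8, h9, ?_⟩
      rcases h6 with h6 | h6
      · exact h10.imp (fun h => by omega) id
      · exact Or.inr (h11 h6)
    · rintro s m3 ⟨⟨ρ, h3, h4, h5, h6⟩, f3⟩
      rw [writes_forRange] at f3
      have h2' : Prepared B G vs es m3 := h2.congr fun a ha => f3 a fun h' =>
        (List.mem_cons.1 h').elim (hne a ha) fun h' => (List.mem_append.1 h').elim
          (hw a (List.mem_append_left [B + svT, B + svR] ha))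
          fun h' => hne a ha (List.mem_singleton.1 h')
      refine Halts.mono (splitCmd_spec hmin h4 h2'.stored h2'.attr h5 h2'.linked h2'.core) le_rfl ?_
      rintro r m4 ⟨rfl, -, h7⟩
      refine ⟨ρ, by simpa using h3, h4, h6.resolve_left fun h6 => ?_, h7⟩
      -- there are at most `vs.length` vertices, so that the loop has one round to spare
      have h8 : (G.core.topSet ρ).card ≤ G.verts.card :=
        Finset.card_le_card fun v hv => (mem_core_verts.1 (mem_topSet.1 hv).1).1
      omega
  · rw [← hn, ← he]
    have h1 : es.length ≤ vs.length * es.length := Nat.le_mul_of_pos_left _ hcard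
    have h2 : T ≤ vs.length * T := Nat.le_mul_of_pos_left _ hcard
    have h3 : vs.length ≤ vs.length * vs.length := Nat.le_mul_of_pos_left _ hcard
    nlinarith

/-- The time bound of the whole game is valid for all its sub-games. -/
theorem SolvesPositiveCycle.solvesOn {κ : Arena → ℝ} {α : Cmd} {C c : ℝ} (hc : 0 < c)
    (hsize : ∀ G : Arena, G.IsPlayable → (G.verts.card : ℝ) + (G.edges.card : ℝ) ≤ c * κ G)
    (hmono : ∀ (G : Arena) (U : Finset ℕ), G.IsPlayable → (G.restrict U).IsPlayable →
      κ (G.restrict U) ≤ κ G)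
    (hα : SolvesPositiveCycle α fun G => C * κ G) (hG : G.IsPlayable) (U : Finset ℕ) :
    SolvesOn α (G.restrict U) ⌊|C| * κ G⌋₊ := by
  intro σ m hH hσ hm
  obtain ⟨r, t, m', ρ, h1, h2, h3, h4, h5⟩ := hα _ σ m hH hσ hm
  refine ⟨r, t, m', h1, Nat.le_floor (h2.trans ?_), ρ, h3, h4, h5⟩
  have h6 : 0 ≤ κ (G.restrict U) := by
    have h7 : 0 ≤ c * κ (G.restrict U) := le_trans (by positivity) (hsize _ hH)
    exact nonneg_of_mul_nonneg_right h7 hc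
  exact (mul_le_mul_of_nonneg_right (le_abs_self C) h6).trans
    (mul_le_mul_of_nonneg_left (hmono G U hG hH) (abs_nonneg C))

end StratImp

theorem mainTheorem2 (κ : StratImp.Arena → ℝ)
    (hsize : ∃ c : ℝ, 0 < c ∧ ∀ G : StratImp.Arena, G.IsPlayable →
      (G.verts.card : ℝ) + (G.edges.card : ℝ) ≤ c * κ G)
    (hmono : ∀ (G : StratImp.Arena) (U : Finset ℕ), G.IsPlayable → (G.restrict U).IsPlayable →
      κ (G.restrict U) ≤ κ G)
    (α : StratImp.Cmd)
    (hα : ∃ C : ℝ, StratImp.SolvesPositiveCycle α (fun G => C * κ G)) :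
    ∃ (β : StratImp.Cmd) (C : ℝ),
      StratImp.FindsZeroMeanPartition β (fun G => C * ((G.verts.card : ℝ) * κ G)) := by
  obtain ⟨c, hc, hsize⟩ := hsize
  obtain ⟨C, hα⟩ := hα
  obtain ⟨B, hB⟩ : ∃ B, ∀ a ∈ α.writes, a < B :=
    ⟨α.writes.toFinset.sup id + 1, fun a ha =>
      Nat.lt_succ_of_le (Finset.le_sup (f := id) (List.mem_toFinset.2 ha))⟩
  refine ⟨StratImp.meanCmd B α, 500 * (c + |C|), fun G σ m hG hσ hm => ?_⟩
  have hplay : G.IsPlayable := ⟨hG.1, fun v hv => hG.2 v (Finset.mem_union_right _ hv)⟩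
  obtain ⟨r, t, m', hexec, ht, ρ, hrun, hstart, hfin, hout⟩ :=
    StratImp.meanCmd_spec hB hG (fun U => hα.solvesOn hc hsize hmono hplay U) hσ hm
  have hpart := StratImp.Arena.isZeroMeanPartition_of_final hG hstart hfin
  have hsub : ∀ v ∈ G.core.topSet ρ, v ∈ G.verts := fun v hv =>
    hpart.1 ▸ Finset.mem_union_left _ hv
  refine ⟨r, t, m', ρ, _, _, hexec, ?_, hrun, fun v hv => ?_, fun v hv => ?_, hpart⟩
  · have hκ : 0 ≤ κ G := by
      have h1 : 0 ≤ c * κ G := le_trans (by positivity) (hsize _ hplay)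
      exact nonneg_of_mul_nonneg_right h1 hc
    have h1 : ((⌊|C| * κ G⌋₊ : ℕ) : ℝ) ≤ |C| * κ G := Nat.floor_le (by positivity)
    have h2 := hsize G hplay
    calc (t : ℝ) ≤ 500 * (G.verts.card * (G.verts.card + G.edges.card + (⌊|C| * κ G⌋₊ : ℕ))) := by
          exact_mod_cast ht
      _ ≤ 500 * (G.verts.card * (c * κ G + |C| * κ G)) := by gcongr
      _ = _ := by ring
  · rw [hout v (hsub v hv), if_pos hv]
  · rw [Finset.mem_sdiff] at hv
    rw [hout v hv.1, if_neg hv.2]
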